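/- Let $G=(V,E)$ be a finite directed graph in which every node has at least one outgoing edge (loops are allowed), $V=\{0,\dots,n-1\}$, $n\ge 1$, let $v_0\in V$, let $\lambda\ge 0$ and $0<\gamma<1$ be rational, and let $B>1$ be an integer. **Rewards.** For an infinite path $\pi$, a time $t$ and a node $v$ let $\mathrm{Last}_\pi(t,v)=\min(\{t+1\}\cup\{t-j: j<t,\ \pi[j]=v\})$. At each time $s$ each node $v$ generates a random reward $\xi_s(v)$ with expected value $\lambda$ (on some probability space). Put $$r^{(N)}_{\mathrm{sum}}(\pi)=\mathbb E\Big[\sum_{t=0}^{N}\ \sum_{j=0}^{\mathrm{Last}_\pi(t,\pi[t])-1}\gamma^{j}\,\xi_{t-j}(\pi[t])\Big],\qquad r_{\mathrm{av}}(\pi)=\liminf_{N\to\infty}\frac{r^{(N)}_{\mathrm{sum}}(\pi)}{N+1},$$ and let $R_{\mathrm{av}}(v_0)$ be the supremum of $r_{\mathrm{av}}(\pi)$ over all infinite paths $\pi$ of $G$ with $\pi[0]=v_0$. **Strategies.** A strategy with memory of size at most $B$ is given by a finite set $M$ with $|M|\le B$, an initial state $m_0\in M$, an update function $\delta:M\times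 V\to M$ and a choice function $\tau:V\times M\to V$ with $(v,\tau(v,m))\in E$ for all $v,m$. It generates from $v_0$ the infinite path $\pi$ with $\pi[0]=v_0$ and $\pi[t+1]=\tau(\pi[t],m_t)$, where $m_{t+1}=\delta(m_t,\pi[t])$. It is *$B$-memory optimal* if no strategy with memory of size at most $B$ generates from $v_0$ a path with larger $r_{\mathrm{av}}$. **Theorem.** There are a single program (for a random access machine with integer registers and arrays) and two polynomials $p,q$ such that, for all $G,v_0,\lambda,\gamma,B$ as above, the program, given the number of nodes and the adjacency matrix of $G$, together with $v_0$, $\lambda$, $\gamma$ and $B$, halts and outputs tables $(m_0,\delta,\tau)$ with $|M|=B$ of a $B$-memory optimal strategy. It halts after at most $p\big(|V|^{|V|+1}B^{|V|}\big)$ elementary operations, and its total logarithmic (bit) cost is at most $q\big(|V|^{|V|+1}B^{|V|}+\langle\lambda\rangle+\langle\gamma\rangle\big)$, where $\langle x\rangle$ is the binary length of the rational number $x$. If $|V|\ge 2$, the path $\pi$ generated from $v_0$ by this strategy satisfies $$\big|R_{\mathrm{av}}(v_0)-r_{\mathrm{av}}(\pi)\big|\ \le\ \frac{\lambda}{1-\gamma}\,\gamma^{\left\lfloor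 \frac{\ln B}{\ln |V|}\right\rfloor-1};$$ if $|V|=1$, then $r_{\mathrm{av}}(\pi)=R_{\mathrm{av}}(v_0)$. -/

import Mathlib

open MeasureTheory Filter

noncomputable section

namespace RobotRouting

/-! ### Paths and rewards -/

section Rewards

variable {V Ω : Type}

/-- Infinite paths of a directed graph. -/
def IsInfinitePath (G : Digraph V) (π : ℕ → V) : Prop :=
  ∀ i, G.Adj (π i) (π (i + 1))

/-- The time that has passed at time `t` since the last visit to `v` strictly before `t`;
it is `t + 1` if there was no such visit. -/
def last (π : ℕ → V) (t : ℕ) (v : V) : ℕ :=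
  sInf (insert (t + 1) {k | ∃ j, j < t ∧ π j = v ∧ k = t - j})

/-- The decayed reward waiting at `v` at time `t`; `ξ s v ω` is the random reward generated at
the node `v` at time `s`. Since `last π t v ≤ t + 1`, the subtraction never truncates. -/
def acc (γ : ℝ) (ξ : ℕ → V → Ω → ℝ) (π : ℕ → V) (t : ℕ) (v : V) (ω : Ω) : ℝ :=
  ∑ j ∈ Finset.range (last π t v), γ ^ j * ξ (t - j) v ω

/-- The expected `N`-horizon sum reward of a path. -/
def sumReward [MeasurableSpace Ω] (μ : Measure Ω) (γ : ℝ) (ξ : ℕ → V → Ω → ℝ)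
    (N : ℕ) (π : ℕ → V) : ℝ :=
  ∫ ω, ∑ t ∈ Finset.range (N + 1), acc γ ξ π t (π t) ω ∂μ

/-- The limit-average expected reward of an infinite path. -/
def avgReward [MeasurableSpace Ω] (μ : Measure Ω) (γ : ℝ) (ξ : ℕ → V → Ω → ℝ)
    (π : ℕ → V) : ℝ :=
  liminf (fun N : ℕ => sumReward μ γ ξ N π / ((N : ℝ) + 1)) atTop

/-- The infinite-horizon reward value of a node: the supremum of the limit-average rewards of all
infinite paths that start there. -/
def avgValue [MeasurableSpace Ω] (μ : Measure Ω) (γ : ℝ) (ξ : ℕ → V → Ω → ℝ)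
    (G : Digraph V) (v₀ : V) : ℝ :=
  sSup {r | ∃ π : ℕ → V, IsInfinitePath G π ∧ π 0 = v₀ ∧ avgReward μ γ ξ π = r}

/-- The rewards generated at every node and time step have expected value `lam`. -/
def HasMeanReward [MeasurableSpace Ω] (μ : Measure Ω) (ξ : ℕ → V → Ω → ℝ) (lam : ℝ) : Prop :=
  ∀ t v, Integrable (ξ t v) μ ∧ ∫ ω, ξ t v ω ∂μ = lam

end Rewards

/-! ### Strategies and memory structures -/

section Strategies

variable {V M : Type}

/-- The finite path with `t` edges that the strategy `σ` generates from `v₀`. -/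
def outcomePrefix (v₀ : V) (σ : List V → V) : ℕ → List V
  | 0 => [v₀]
  | t + 1 => outcomePrefix v₀ σ t ++ [σ (outcomePrefix v₀ σ t)]

/-- The infinite path that the strategy `σ` generates from `v₀`. -/
def outcome (v₀ : V) (σ : List V → V) : ℕ → V
  | 0 => v₀
  | t + 1 => σ (outcomePrefix v₀ σ t)

/-- A memory structure with set of memory states `M`. -/
structure MemoryStructure (V M : Type) where
  init : M
  update : M → V → M

/-- The extension of the update function to finite sequences of nodes. -/
def MemoryStructure.run (𝓜 : MemoryStructure V M) (h : List V) : M :=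
  h.foldl 𝓜.update 𝓜.init

/-- The strategy given by a memory structure, a choice function `τ` and an initial node:
`σ(ε) = v₀` and `σ(h · v) = τ v (run h)`. -/
def MemoryStructure.strategy (𝓜 : MemoryStructure V M) (τ : V → M → V) (v₀ : V)
    (h : List V) : V :=
  match h.getLast? with
  | none => v₀
  | some v => τ v (𝓜.run h.dropLast)

/-- `σ` is a strategy in `G` that has a memory of size at most `B`. -/
def IsBMemory (G : Digraph V) (v₀ : V) (B : ℕ) (σ : List V → V) : Prop :=
  ∃ (M : Type) (_ : Fintype M) (𝓜 : MemoryStructure V M) (τ : V → M → V),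
    Fintype.card M ≤ B ∧ (∀ v m, G.Adj v (τ v m)) ∧ σ = 𝓜.strategy τ v₀

/-- `σ` maximizes the reward `r` of the generated path among all strategies with memory of
size at most `B`. -/
def IsBMemoryOptimal (G : Digraph V) (v₀ : V) (B : ℕ) (r : (ℕ → V) → ℝ)
    (σ : List V → V) : Prop :=
  IsBMemory G v₀ B σ ∧
    ∀ σ' : List V → V, IsBMemory G v₀ B σ' → r (outcome v₀ σ') ≤ r (outcome v₀ σ)

end Strategies

/-! ### A random access machine with integer registers and arrays

Programs are structured programs over integer variables and integer arrays with computed indices.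
Two measures are counted together: the number of elementary steps, and the logarithmic cost, where
every operation is also charged the bit lengths of the integers that it handles. -/

/-- Number of binary digits of an integer. -/
def bitLength (k : ℤ) : ℕ := Nat.size k.natAbs

/-- Length of a rational number written as a reduced fraction in binary. -/
def ratLength (x : ℚ) : ℕ := bitLength x.num + bitLength x.den

/-- Memory contents: variable `i` holds `vars i`, and the cell with index `k` of array `a`
holds `arrs a k`. -/
structure State where
  vars : ℕ → ℤ
  arrs : ℕ → ℤ → ℤ

def State.setVar (s : State) (x : ℕ) (k : ℤ) : State :=
  { s with vars := Function.update s.vars x k }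

def State.setCell (s : State) (a : ℕ) (i k : ℤ) : State :=
  { s with arrs := Function.update s.arrs a (Function.update (s.arrs a) i k) }

/-- Elementary operations; comparisons return `1` or `0`. -/
inductive BinOp
  | add | sub | mul | div | mod | lt | eq

/-- Division by zero returns `0`, and the remainder modulo zero is the dividend. -/
def BinOp.apply : BinOp → ℤ → ℤ → ℤ
  | .add, a, b => a + b
  | .sub, a, b => a - b
  | .mul, a, b => a * b
  | .div, a, b => a / b
  | .mod, a, b => a % b
  | .lt, a, b => if a < b then 1 else 0
  | .eq, a, b => if a = b then 1 else 0

/-- Expressions: constants, variables, array cells with a computed index, and operations. -/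
inductive Exp
  | lit (k : ℤ)
  | var (x : ℕ)
  | cell (a : ℕ) (i : Exp)
  | op (o : BinOp) (e₁ e₂ : Exp)

def Exp.eval (s : State) : Exp → ℤ
  | .lit k => k
  | .var x => s.vars x
  | .cell a i => s.arrs a (i.eval s)
  | .op o e₁ e₂ => o.apply (e₁.eval s) (e₂.eval s)

/-- Number of elementary operations in the evaluation of an expression. -/
def Exp.steps : Exp → ℕ
  | .lit _ => 1
  | .var _ => 1
  | .cell _ i => i.steps + 1
  | .op _ e₁ e₂ => e₁.steps + e₂.steps + 1

/-- Logarithmic cost of the evaluation of an expression: every constant, every fetched value,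
every index, every operand and every result is charged its bit length. -/
def Exp.logCost (s : State) : Exp → ℕ
  | .lit k => bitLength k + 1
  | .var x => bitLength (s.vars x) + 1
  | .cell a i => i.logCost s + bitLength (s.arrs a (i.eval s)) + 1
  | .op o e₁ e₂ =>
      e₁.logCost s + e₂.logCost s + bitLength (o.apply (e₁.eval s) (e₂.eval s)) + 1

/-- Programs; `loop e c` repeats `c` while the test `e` succeeds. A test succeeds if its value is
not `0`. -/
inductive Cmd
  | skip
  | assign (x : ℕ) (e : Exp)
  | store (a : ℕ) (i e : Exp)
  | seq (c₁ c₂ : Cmd)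
  | ite (e : Exp) (c₁ c₂ : Cmd)
  | loop (e : Exp) (c : Cmd)

/-- `Exec c s s' t b`: the program `c`, started in state `s`, halts in state `s'` after `t`
elementary steps, with total logarithmic cost `b`. -/
inductive Exec : Cmd → State → State → ℕ → ℕ → Prop
  | skip (s : State) : Exec .skip s s 1 1
  | assign (x : ℕ) (e : Exp) (s : State) :
      Exec (.assign x e) s (s.setVar x (e.eval s)) (e.steps + 1) (e.logCost s + 1)
  | store (a : ℕ) (i e : Exp) (s : State) :
      Exec (.store a i e) s (s.setCell a (i.eval s) (e.eval s))
        (i.steps + e.steps + 1) (i.logCost s + e.logCost s + 1)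
  | seq {c₁ c₂ : Cmd} {s₁ s₂ s₃ : State} {t₁ t₂ b₁ b₂ : ℕ} :
      Exec c₁ s₁ s₂ t₁ b₁ → Exec c₂ s₂ s₃ t₂ b₂ →
      Exec (.seq c₁ c₂) s₁ s₃ (t₁ + t₂) (b₁ + b₂)
  | ite_true {e : Exp} {c₁ c₂ : Cmd} {s s' : State} {t b : ℕ} :
      e.eval s ≠ 0 → Exec c₁ s s' t b →
      Exec (.ite e c₁ c₂) s s' (e.steps + 1 + t) (e.logCost s + 1 + b)
  | ite_false {e : Exp} {c₁ c₂ : Cmd} {s s' : State} {t b : ℕ} :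
      e.eval s = 0 → Exec c₂ s s' t b →
      Exec (.ite e c₁ c₂) s s' (e.steps + 1 + t) (e.logCost s + 1 + b)
  | loop_true {e : Exp} {c : Cmd} {s₁ s₂ s₃ : State} {t₁ t₂ b₁ b₂ : ℕ} :
      e.eval s₁ ≠ 0 → Exec c s₁ s₂ t₁ b₁ → Exec (.loop e c) s₂ s₃ t₂ b₂ →
      Exec (.loop e c) s₁ s₃ (e.steps + 1 + t₁ + t₂) (e.logCost s₁ + 1 + b₁ + b₂)
  | loop_false {e : Exp} {c : Cmd} {s : State} :
      e.eval s = 0 → Exec (.loop e c) s s (e.steps + 1) (e.logCost s + 1)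

/-! ### Input and output format -/

open Classical in
/-- The input: the variables `0, …, 6` hold the number of nodes, the memory bound, the initial
node, and the numerators and denominators of `lam` and `gam`; array `0` holds the adjacency matrix,
row by row; everything else is `0`. -/
def inputState {n : ℕ} (G : Digraph (Fin n)) (v₀ : Fin n) (lam gam : ℚ) (B : ℕ) : State where
  vars x :=
    match x with
    | 0 => n
    | 1 => B
    | 2 => (v₀ : ℕ)
    | 3 => lam.num
    | 4 => lam.den
    | 5 => gam.num
    | 6 => gam.den
    | _ => 0
  arrs a k :=
    if a = 0 ∧ ∃ u v : Fin n, G.Adj u v ∧ k = ((u : ℕ) : ℤ) * n + ((v : ℕ) : ℤ) then 1 else 0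

/-- The output: variable `0` holds the initial memory state, array `1` the table of the memory
update function, and array `2` the table of the choice function. -/
def State.Outputs {n B : ℕ} (s : State) (𝓜 : MemoryStructure (Fin n) (Fin B))
    (τ : Fin n → Fin B → Fin n) : Prop :=
  s.vars 0 = ((𝓜.init : ℕ) : ℤ) ∧
  (∀ (m : Fin B) (v : Fin n),
    s.arrs 1 (((m : ℕ) : ℤ) * n + ((v : ℕ) : ℤ)) = ((𝓜.update m v : ℕ) : ℤ)) ∧
  (∀ (v : Fin n) (m : Fin B),
    s.arrs 2 (((v : ℕ) : ℤ) * B + ((m : ℕ) : ℤ)) = ((τ v m : ℕ) : ℤ))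

end RobotRouting

end

/-!
The expected reward is linear in the means of the generated rewards, so a path that comes to a node
`k` steps after its last visit there collects `lam / (1 - γ) * (1 - γ ^ k)`, and `avgReward` is a
constant times the lower average of these normalized gains (`avgReward_eq_liminf`).

*Strategies with memory `B` are lassos.* A strategy with memory states `M` makes the pair of node
and memory state evolve by a function on `V × M`. Its path is therefore eventually periodic, and up
to the first repetition of a pair no node occurs more than `B` times
(`Problem.exists_isLasso_of_isBMemory`). Conversely, if no node occurs more than `B` times on a
lasso, then the number of earlier visits to the current node can serve as memory state, because the
pairs of node and memory state are then distinct (`Problem.occ_ne`,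
`Problem.Tables.exists_strategy`). So an optimal strategy amounts to a lasso with the largest mean
gain on its cycle.

*Finding the best lasso.* A partial lasso is written as one integer in base `n * B + 1`. The digits
are the current node, the number of departures from each node, the time of the last visit to each
node on the cycle, and a guess of the first node and the length of the cycle and of the times of
last visits with which the cycle closes. Every step increases this integer, since the digit that
counts departures from the node being left dominates the other digits that change. Thus a single
pass through all `(n * B + 1) ^ (3 * n + 4)` integers in increasing order computes the largest
weight of a chain from an initial state to each state (`System.Inv`), and the recorded predecessors
give a chain of largest weight (`System.Chain`). The gains are scaled to integers by
`(n * B)! * b ^ (n * B)`, where `γ = a / b`; after this scaling the weights of cycles of different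
lengths can be compared directly.

*Cost.* The numbers of steps come from Hoare triples with a step count (`Triple`): a program of loop
depth `d`, none of whose loops makes more than `T` iterations, takes `O((T + 2) ^ d)` steps. For the
logarithmic cost it suffices that in every product that a phase of the program evaluates, the size
of one factor is bounded in terms of the part of the memory that this phase leaves unchanged. Then
the bit lengths in memory grow by a bounded amount per step (`Exec.bits_le`), so they stay
polynomial.

*Comparison with unbounded memory.* A strategy that remembers the last `K` nodes, where
`n ^ K ≤ B`, knows the gain of each step up to `γ ^ (K + 1)`. The resulting problem is a mean payoff
problem on the finite graph of windows, in which a positional strategy is optimal, since the cycles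
can be removed one by one from any walk (`exists_optimal_positional`). Hence an optimal strategy
with memory `B` is within `lam / (1 - γ) * γ ^ (K + 1)` of the value
(`exists_isBMemory_avgReward_ge`).
-/

namespace RobotRouting

/-! ### Step-counted Hoare triples -/

/-- A coefficient that bounds the number of steps of a program, apart from loop iterations. -/
def Cmd.coeff : Cmd → ℕ
  | .skip => 1
  | .assign _ e => e.steps + 1
  | .store _ i e => i.steps + e.steps + 1
  | .seq c₁ c₂ => c₁.coeff + c₂.coeff
  | .ite e c₁ c₂ => e.steps + 1 + c₁.coeff + c₂.coeff
  | .loop e c => e.steps + 1 + c.coeff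

/-- The nesting depth of the loops of a program. -/
def Cmd.depth : Cmd → ℕ
  | .skip => 0
  | .assign _ _ => 0
  | .store _ _ _ => 0
  | .seq c₁ c₂ => max c₁.depth c₂.depth
  | .ite _ c₁ c₂ => max c₁.depth c₂.depth
  | .loop _ c => c.depth + 1

/-- Total correctness with a step bound: from every state that satisfies `P`, the program `c` halts
in a state that satisfies `Q`, after as many steps as a program of its size and loop depth takes
if no loop makes more than `T` iterations. -/
def Triple (T : ℕ) (P : State → Prop) (c : Cmd) (Q : State → Prop) : Prop :=
  ∀ s, P s → ∃ s' t b, Exec c s s' t b ∧ t ≤ c.coeff * (T + 2) ^ c.depth ∧ Q s'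

theorem Triple.skip {T : ℕ} {P Q : State → Prop} (h : ∀ s, P s → Q s) : Triple T P .skip Q :=
  fun s hs => ⟨s, 1, 1, .skip s, by simp [Cmd.coeff, Cmd.depth], h s hs⟩

theorem Triple.assign {T : ℕ} {P Q : State → Prop} {x : ℕ} {e : Exp}
    (h : ∀ s, P s → Q (s.setVar x (e.eval s))) : Triple T P (.assign x e) Q :=
  fun s hs => ⟨_, _, _, .assign x e s, by simp [Cmd.coeff, Cmd.depth], h s hs⟩

theorem Triple.store {T : ℕ} {P Q : State → Prop} {a : ℕ} {i e : Exp}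
    (h : ∀ s, P s → Q (s.setCell a (i.eval s) (e.eval s))) : Triple T P (.store a i e) Q :=
  fun s hs => ⟨_, _, _, .store a i e s, by simp [Cmd.coeff, Cmd.depth], h s hs⟩

theorem mul_pow_le_of_le {T a b d d' : ℕ} (h : a ≤ b * (T + 2) ^ d) (hd : d ≤ d') :
    a ≤ b * (T + 2) ^ d' :=
  h.trans (Nat.mul_le_mul_left _ (Nat.pow_le_pow_right (by omega) hd))

theorem Triple.seq {T : ℕ} {P R Q : State → Prop} {c₁ c₂ : Cmd}
    (h₁ : Triple T P c₁ R) (h₂ : Triple T R c₂ Q) : Triple T P (.seq c₁ c₂) Q := by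
  intro s hs
  obtain ⟨s₁, t₁, b₁, e₁, ht₁, hr⟩ := h₁ s hs
  obtain ⟨s₂, t₂, b₂, e₂, ht₂, hq⟩ := h₂ s₁ hr
  refine ⟨s₂, _, _, .seq e₁ e₂, ?_, hq⟩
  have h1 := mul_pow_le_of_le ht₁ (le_max_left c₁.depth c₂.depth)
  have h2 := mul_pow_le_of_le ht₂ (le_max_right c₁.depth c₂.depth)
  simp only [Cmd.coeff, Cmd.depth]
  linarith [add_mul c₁.coeff c₂.coeff ((T + 2) ^ max c₁.depth c₂.depth)]

theorem Triple.ite {T : ℕ} {P Q : State → Prop} {e : Exp} {c₁ c₂ : Cmd}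
    (h₁ : Triple T (fun s => P s ∧ e.eval s ≠ 0) c₁ Q)
    (h₂ : Triple T (fun s => P s ∧ e.eval s = 0) c₂ Q) : Triple T P (.ite e c₁ c₂) Q := by
  intro s hs
  have hp : 1 ≤ (T + 2) ^ max c₁.depth c₂.depth := Nat.one_le_pow _ _ (by omega)
  by_cases he : e.eval s = 0
  · obtain ⟨s', t, b, ex, ht, hq⟩ := h₂ s ⟨hs, he⟩
    refine ⟨s', _, _, .ite_false he ex, ?_, hq⟩
    have := mul_pow_le_of_le ht (le_max_right c₁.depth c₂.depth)
    simp only [Cmd.coeff, Cmd.depth]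
    nlinarith [Nat.zero_le (c₁.coeff * (T + 2) ^ max c₁.depth c₂.depth)]
  · obtain ⟨s', t, b, ex, ht, hq⟩ := h₁ s ⟨hs, he⟩
    refine ⟨s', _, _, .ite_true he ex, ?_, hq⟩
    have := mul_pow_le_of_le ht (le_max_left c₁.depth c₂.depth)
    simp only [Cmd.coeff, Cmd.depth]
    nlinarith [Nat.zero_le (c₂.coeff * (T + 2) ^ max c₁.depth c₂.depth)]

theorem Triple.conseq {T : ℕ} {P P' Q Q' : State → Prop} {c : Cmd} (h : Triple T P c Q)
    (hP : ∀ s, P' s → P s) (hQ : ∀ s, Q s → Q' s) : Triple T P' c Q' := by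
  intro s hs
  obtain ⟨s', t, b, ex, ht, hq⟩ := h s (hP s hs)
  exact ⟨s', t, b, ex, ht, hQ _ hq⟩

/-- The rule for `while` loops that run through `N` iterations, with an invariant indexed by the
number of completed iterations. -/
theorem Triple.loop {T N : ℕ} {I : ℕ → State → Prop} {e : Exp} {c : Cmd} (hN : N ≤ T)
    (hlt : ∀ i s, i < N → I i s → e.eval s ≠ 0) (hend : ∀ s, I N s → e.eval s = 0)
    (hbody : ∀ i, i < N → Triple T (I i) c (I (i + 1))) :
    Triple T (I 0) (.loop e c) (I N) := by
  have key : ∀ k i, i + k = N → ∀ s, I i s → ∃ s' t b, Exec (.loop e c) s s' t b ∧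
      t ≤ (k + 1) * (e.steps + 1) + k * (c.coeff * (T + 2) ^ c.depth) ∧ I N s' := by
    intro k
    induction k with
    | zero =>
      intro i hi s hs
      obtain rfl : i = N := by omega
      exact ⟨s, _, _, .loop_false (hend s hs), by simp, hs⟩
    | succ k ih =>
      intro i hi s hs
      obtain ⟨s₁, t₁, b₁, ex₁, ht₁, h₁⟩ := hbody i (by omega) s hs
      obtain ⟨s₂, t₂, b₂, ex₂, ht₂, h₂⟩ := ih (i + 1) (by omega) s₁ h₁
      refine ⟨s₂, _, _, .loop_true (hlt i s (by omega) hs) ex₁ ex₂, ?_, h₂⟩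
      nlinarith
  intro s hs
  obtain ⟨s', t, b, ex, ht, h⟩ := key N 0 (by omega) s hs
  refine ⟨s', t, b, ex, ht.trans ?_, h⟩
  have hp : 1 ≤ (T + 2) ^ c.depth := Nat.one_le_pow _ _ (by omega)
  simp only [Cmd.coeff, Cmd.depth, pow_succ]
  calc (N + 1) * (e.steps + 1) + N * (c.coeff * (T + 2) ^ c.depth)
      ≤ (T + 2) * ((e.steps + 1) * (T + 2) ^ c.depth) +
        (T + 2) * (c.coeff * (T + 2) ^ c.depth) := by
        gcongr
        · omega
        · exact Nat.le_mul_of_pos_right _ (by omega)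
        · omega
    _ = (e.steps + 1 + c.coeff) * ((T + 2) ^ c.depth * (T + 2)) := by ring

/-- `for x in 0, …, e - 1 do c`. -/
def Cmd.for (x : ℕ) (e : Exp) (c : Cmd) : Cmd :=
  .seq (.assign x (.lit 0))
    (.loop (.op .lt (.var x) e) (.seq c (.assign x (.op .add (.var x) (.lit 1)))))

/-- The rule for counting loops. The invariant `I i` holds with the counter set to `i`. -/
theorem Triple.for {T N : ℕ} {P : State → Prop} {I : ℕ → State → Prop} {x : ℕ} {e : Exp} {c : Cmd}
    (hN : N ≤ T) (hx : ∀ i s, I i s → s.vars x = i) (he : ∀ i s, I i s → e.eval s = N)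
    (hinit : ∀ s, P s → I 0 (s.setVar x 0))
    (hbody : ∀ i, i < N →
      Triple T (I i) c (fun s => s.vars x = i ∧ I (i + 1) (s.setVar x ((i + 1 : ℕ) : ℤ)))) :
    Triple T P (.for x e c) (I N) := by
  refine Triple.seq (R := I 0) (Triple.assign fun s hs => hinit s hs) ?_
  refine Triple.loop hN ?_ ?_ ?_
  · intro i s hi hs
    simp [Exp.eval, BinOp.apply, hx i s hs, he i s hs, hi]
  · intro s hs
    simp [Exp.eval, BinOp.apply, hx N s hs, he N s hs]
  · intro i hi
    refine Triple.seq (hbody i hi) (Triple.assign ?_)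
    rintro s ⟨h1, h2⟩
    simpa [Exp.eval, BinOp.apply, h1] using h2

/-! ### Bounds on the logarithmic cost -/

/-- Expressions whose value has a bounded size, independent of the running program: `K` lists the
variables and `A` the arrays that are never assigned, and the variables in `Z` are nonzero. -/
def Exp.small (K A Z : List ℕ) : Exp → Bool
  | .lit k => k.natAbs ≤ 7
  | .var x => x ∈ K
  | .cell a _ => a ∈ A
  | .op .lt _ _ => true
  | .op .eq _ _ => true
  | .op .div e _ => e.small K A Z
  | .op .mod _ (.var x) => x ∈ K && x ∈ Z
  | .op _ _ _ => false

/-- Expressions in which the left factor of every product is small. -/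
def Exp.tame (K A Z : List ℕ) : Exp → Bool
  | .lit k => k.natAbs ≤ 7
  | .var _ => true
  | .cell _ i => i.tame K A Z
  | .op .mul e₁ e₂ => e₁.small K A Z && e₁.tame K A Z && e₂.tame K A Z
  | .op _ e₁ e₂ => e₁.tame K A Z && e₂.tame K A Z

/-- Programs that assign no variable in `K` and no array in `A`, and all of whose expressions are
tame. -/
def Cmd.tame (K A Z : List ℕ) : Cmd → Bool
  | .skip => true
  | .assign x e => !(x ∈ K) && e.tame K A Z
  | .store a i e => !(a ∈ A) && i.tame K A Z && e.tame K A Z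
  | .seq c₁ c₂ => c₁.tame K A Z && c₂.tame K A Z
  | .ite e c₁ c₂ => e.tame K A Z && c₁.tame K A Z && c₂.tame K A Z
  | .loop e c => e.tame K A Z && c.tame K A Z

/-- All integers in memory have at most `M` binary digits. -/
def State.BitsLE (s : State) (M : ℕ) : Prop :=
  (∀ x, bitLength (s.vars x) ≤ M) ∧ ∀ a k, bitLength (s.arrs a k) ≤ M

/-- The never-assigned variables and arrays have at most `M` binary digits, and the variables in
`Z` are nonzero. -/
def State.ConstLE (K A Z : List ℕ) (s : State) (M : ℕ) : Prop :=
  (∀ x ∈ K, bitLength (s.vars x) ≤ M) ∧ (∀ a ∈ A, ∀ k, bitLength (s.arrs a k) ≤ M) ∧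
    ∀ x ∈ Z, s.vars x ≠ 0

theorem State.BitsLE.mono {s : State} {M M' : ℕ} (h : s.BitsLE M) (hM : M ≤ M') : s.BitsLE M' :=
  ⟨fun x => (h.1 x).trans hM, fun a k => (h.2 a k).trans hM⟩

theorem bitLength_le_iff {k : ℤ} {m : ℕ} : bitLength k ≤ m ↔ k.natAbs < 2 ^ m := Nat.size_le

theorem bitLength_mono {k l : ℤ} (h : k.natAbs ≤ l.natAbs) : bitLength k ≤ bitLength l :=
  Nat.size_le_size h

theorem bitLength_mul_le {k l : ℤ} {a b : ℕ} (hk : bitLength k ≤ a) (hl : bitLength l ≤ b) :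
    bitLength (k * l) ≤ a + b := by
  rw [bitLength_le_iff] at *
  rw [Int.natAbs_mul, pow_add]
  exact Nat.mul_lt_mul'' hk hl

theorem natAbs_lt_two_pow_of_le {k : ℤ} {a b : ℕ} (h : a ≤ b) (hk : k.natAbs < 2 ^ a) :
    k.natAbs < 2 ^ b :=
  hk.trans_le (Nat.pow_le_pow_right (by norm_num) h)

theorem bitLength_of_natAbs_le_add {k l m : ℤ} {a : ℕ} (hl : bitLength l ≤ a)
    (hm : bitLength m ≤ a) (h : k.natAbs ≤ l.natAbs + m.natAbs) : bitLength k ≤ a + 1 := by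
  rw [bitLength_le_iff] at *
  rw [pow_succ]; omega

theorem bitLength_ite_le (p : Prop) [Decidable p] : bitLength (if p then 1 else 0) ≤ 1 := by
  rw [bitLength_le_iff]; split_ifs <;> simp

theorem bitLength_mod_le {k l : ℤ} {a : ℕ} (hk : bitLength k ≤ a) (hl : bitLength l ≤ a) :
    bitLength (k % l) ≤ a + 1 := by
  rcases eq_or_ne l 0 with rfl | h0
  · simpa using hk.trans (Nat.le_succ a)
  · refine (bitLength_mono (l := l) ?_).trans (hl.trans (Nat.le_succ a))
    have h1 := Int.emod_nonneg k h0
    have h2 := Int.emod_lt_abs k h0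
    rw [Int.abs_eq_natAbs] at h2
    omega

theorem bitLength_mod_le_right {k l : ℤ} (h0 : l ≠ 0) : bitLength (k % l) ≤ bitLength l := by
  apply bitLength_mono
  have h1 := Int.emod_nonneg k h0
  have h2 := Int.emod_lt_abs k h0
  rw [Int.abs_eq_natAbs] at h2
  omega

theorem bitLength_of_natAbs_le_seven {k : ℤ} {M : ℕ} (hk : k.natAbs ≤ 7) (hM : 3 ≤ M) :
    bitLength k ≤ M := by
  rw [bitLength_le_iff]
  exact natAbs_lt_two_pow_of_le hM (by omega)

theorem Exp.one_le_steps (e : Exp) : 1 ≤ e.steps := by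
  cases e <;> simp [Exp.steps]

theorem Exp.small_bits {K A Z : List ℕ} {s : State} {M : ℕ} (hM : 3 ≤ M)
    (hs : s.ConstLE K A Z M) (e : Exp) (he : e.small K A Z = true) :
    bitLength (e.eval s) ≤ M := by
  induction e with
  | lit k => exact bitLength_of_natAbs_le_seven (k := k) (by simpa [Exp.small] using he) hM
  | var x => exact hs.1 x (by simpa [Exp.small] using he)
  | cell a i ih => exact hs.2.1 a (by simpa [Exp.small] using he) _
  | op o e₁ e₂ ih₁ ih₂ =>
    cases o with
    | add => simp [Exp.small] at he
    | sub => simp [Exp.small] at he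
    | mul => simp [Exp.small] at he
    | div =>
      exact (bitLength_mono (Int.natAbs_ediv_le_natAbs _ _)).trans
        (ih₁ (by simpa [Exp.small] using he))
    | mod =>
      cases e₂ with
      | var x =>
        have : x ∈ K ∧ x ∈ Z := by simpa [Exp.small] using he
        exact (bitLength_mod_le_right (hs.2.2 x this.2)).trans (hs.1 x this.1)
      | lit k => simp [Exp.small] at he
      | cell a i => simp [Exp.small] at he
      | op o a b => simp [Exp.small] at he
    | lt => exact (bitLength_ite_le _).trans (by omega)
    | eq => exact (bitLength_ite_le _).trans (by omega)

/-- One evaluation of a tame expression adds at most `M + 1` bits per step. -/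
theorem Exp.tame_bits {K A Z : List ℕ} {s : State} {M W : ℕ} (hM : 3 ≤ M) (hMW : M ≤ W)
    (hs : s.ConstLE K A Z M) (hW : s.BitsLE W) (e : Exp) (he : e.tame K A Z = true) :
    bitLength (e.eval s) ≤ W + e.steps * (M + 1) ∧
      e.logCost s ≤ e.steps * (W + e.steps * (M + 1) + 1) := by
  induction e with
  | lit k =>
    have h : bitLength k ≤ W :=
      bitLength_of_natAbs_le_seven (by simpa [Exp.tame] using he) (hM.trans hMW)
    simp only [Exp.eval, Exp.logCost, Exp.steps]; omega
  | var x =>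
    have h := hW.1 x
    simp only [Exp.eval, Exp.logCost, Exp.steps]; omega
  | cell a i ih =>
    obtain ⟨h1, h2⟩ := ih (by simpa [Exp.tame] using he)
    have h := hW.2 a (i.eval s)
    simp only [Exp.eval, Exp.logCost, Exp.steps]
    refine ⟨by nlinarith, ?_⟩
    nlinarith [Nat.zero_le (i.steps * (M + 1))]
  | op o e₁ e₂ ih₁ ih₂ =>
    have h₁ : e₁.tame K A Z = true := by
      cases o <;> simp [Exp.tame] at he <;> simp [he]
    have h₂ : e₂.tame K A Z = true := by
      cases o <;> simp [Exp.tame] at he <;> simp [he]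
    obtain ⟨a1, a2⟩ := ih₁ h₁
    obtain ⟨b1, b2⟩ := ih₂ h₂
    have s1 := e₁.one_le_steps
    have s2 := e₂.one_le_steps
    set u := W + (e₁.steps + e₂.steps) * (M + 1) with hu
    have a1' : bitLength (e₁.eval s) ≤ u := by nlinarith
    have b1' : bitLength (e₂.eval s) ≤ u := by nlinarith
    have key : bitLength ((Exp.op o e₁ e₂).eval s) ≤ u + (M + 1) := by
      cases o with
      | add => exact (bitLength_of_natAbs_le_add a1' b1' (Int.natAbs_add_le _ _)).trans (by omega)
      | sub => exact (bitLength_of_natAbs_le_add a1' b1' (Int.natAbs_sub_le _ _)).trans (by omega)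
      | mul =>
        have hsm : e₁.small K A Z = true := by simp [Exp.tame] at he; simp [he]
        have := bitLength_mul_le (e₁.small_bits hM hs hsm) b1'
        exact this.trans (by omega)
      | div => exact (bitLength_mono (Int.natAbs_ediv_le_natAbs _ _)).trans (by omega)
      | mod => exact (bitLength_mod_le a1' b1').trans (by omega)
      | lt => exact (bitLength_ite_le _).trans (by omega)
      | eq => exact (bitLength_ite_le _).trans (by omega)
    have hfull : u + (M + 1) = W + (Exp.op o e₁ e₂).steps * (M + 1) := by
      simp only [Exp.steps, hu]; ring
    refine ⟨hfull ▸ key, ?_⟩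
    simp only [Exp.eval] at key
    rw [← hfull]
    simp only [Exp.logCost, Exp.steps]
    have c1 : e₁.logCost s ≤ e₁.steps * (u + (M + 1) + 1) :=
      a2.trans (Nat.mul_le_mul_left _ (by nlinarith))
    have c2 : e₂.logCost s ≤ e₂.steps * (u + (M + 1) + 1) :=
      b2.trans (Nat.mul_le_mul_left _ (by nlinarith))
    nlinarith

/-- A run of a tame program adds at most `M + 1` bits per step to the integers in memory, which
bounds its logarithmic cost. -/
theorem Exec.tame_bits {K A Z : List ℕ} {M : ℕ} (hM : 3 ≤ M) {c : Cmd} {s s' : State} {t b : ℕ}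
    (ex : Exec c s s' t b) (hZ : ∀ x ∈ Z, x ∈ K) :
    ∀ W, M ≤ W → s.ConstLE K A Z M → s.BitsLE W → c.tame K A Z = true →
      s'.ConstLE K A Z M ∧ s'.BitsLE (W + t * (M + 1)) ∧
        b ≤ t * (W + t * (M + 1) + 1) := by
  induction ex with
  | skip s =>
    intro W hMW hs hW hc
    exact ⟨hs, hW.mono (by omega), by omega⟩
  | assign x e s =>
    intro W hMW hs hW hc
    have hc' : x ∉ K ∧ e.tame K A Z = true := by simpa [Cmd.tame] using hc
    obtain ⟨h1, h2⟩ := e.tame_bits hM hMW hs hW hc'.2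
    have hne : ∀ y ∈ K, y ≠ x := fun y hy h => hc'.1 (h ▸ hy)
    refine ⟨⟨fun y hy => ?_, hs.2.1, fun y hy => ?_⟩, ⟨fun y => ?_, fun a k => ?_⟩, ?_⟩
    · simpa [State.setVar, hne y hy] using hs.1 y hy
    · simpa [State.setVar, hne y (hZ y hy)] using hs.2.2 y hy
    · rcases eq_or_ne y x with rfl | h
      · simp only [State.setVar, Function.update_self]; nlinarith
      · simp only [State.setVar, Function.update_of_ne h]
        exact (hW.1 y).trans (by omega)
    · exact (hW.2 a k).trans (by omega)
    · have : e.steps * (W + e.steps * (M + 1) + 1) ≤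
          e.steps * (W + (e.steps + 1) * (M + 1) + 1) := Nat.mul_le_mul_left _ (by nlinarith)
      nlinarith
  | store a i e s =>
    intro W hMW hs hW hc
    have hc' : (a ∉ A ∧ i.tame K A Z = true) ∧ e.tame K A Z = true := by
      simpa [Cmd.tame] using hc
    obtain ⟨h1, h2⟩ := i.tame_bits hM hMW hs hW hc'.1.2
    obtain ⟨h3, h4⟩ := e.tame_bits hM hMW hs hW hc'.2
    have hne : ∀ y ∈ A, y ≠ a := fun y hy h => hc'.1.1 (h ▸ hy)
    refine ⟨⟨hs.1, fun y hy k => ?_, hs.2.2⟩, ⟨fun y => ?_, fun y k => ?_⟩, ?_⟩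
    · simpa [State.setCell, hne y hy] using hs.2.1 y hy k
    · exact (hW.1 y).trans (by omega)
    · rcases eq_or_ne y a with rfl | h
      · simp only [State.setCell, Function.update_self]
        rcases eq_or_ne k (i.eval s) with rfl | h'
        · simp only [Function.update_self]; nlinarith
        · simp only [Function.update_of_ne h']
          exact (hW.2 y k).trans (by omega)
      · simp only [State.setCell, Function.update_of_ne h]
        exact (hW.2 y k).trans (by omega)
    · have g1 : i.steps * (W + i.steps * (M + 1) + 1) ≤
          i.steps * (W + (i.steps + e.steps + 1) * (M + 1) + 1) :=
        Nat.mul_le_mul_left _ (by nlinarith)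
      have g2 : e.steps * (W + e.steps * (M + 1) + 1) ≤
          e.steps * (W + (i.steps + e.steps + 1) * (M + 1) + 1) :=
        Nat.mul_le_mul_left _ (by nlinarith)
      nlinarith
  | @seq c₁ c₂ s₁ s₂ s₃ t₁ t₂ b₁ b₂ _ _ ih₁ ih₂ =>
    intro W hMW hs hW hc
    have hc' : c₁.tame K A Z = true ∧ c₂.tame K A Z = true := by simpa [Cmd.tame] using hc
    obtain ⟨h1, h2, h3⟩ := ih₁ W hMW hs hW hc'.1
    obtain ⟨h4, h5, h6⟩ := ih₂ _ (by omega) h1 h2 hc'.2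
    refine ⟨h4, h5.mono (by nlinarith), ?_⟩
    have g1 : t₁ * (W + t₁ * (M + 1) + 1) ≤ t₁ * (W + (t₁ + t₂) * (M + 1) + 1) :=
      Nat.mul_le_mul_left _ (by nlinarith)
    nlinarith
  | @ite_true e c₁ c₂ s s' t b he _ ih =>
    intro W hMW hs hW hc
    have hc' : (e.tame K A Z = true ∧ c₁.tame K A Z = true) ∧ c₂.tame K A Z = true := by
      simpa [Cmd.tame] using hc
    obtain ⟨h1, h2, h3⟩ := ih W hMW hs hW hc'.1.2
    obtain ⟨h4, h5⟩ := e.tame_bits hM hMW hs hW hc'.1.1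
    refine ⟨h1, h2.mono (by nlinarith), ?_⟩
    have g1 : t * (W + t * (M + 1) + 1) ≤ t * (W + (e.steps + 1 + t) * (M + 1) + 1) :=
      Nat.mul_le_mul_left _ (by nlinarith)
    have g2 : e.steps * (W + e.steps * (M + 1) + 1) ≤
        e.steps * (W + (e.steps + 1 + t) * (M + 1) + 1) :=
      Nat.mul_le_mul_left _ (by nlinarith)
    nlinarith
  | @ite_false e c₁ c₂ s s' t b he _ ih =>
    intro W hMW hs hW hc
    have hc' : (e.tame K A Z = true ∧ c₁.tame K A Z = true) ∧ c₂.tame K A Z = true := by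
      simpa [Cmd.tame] using hc
    obtain ⟨h1, h2, h3⟩ := ih W hMW hs hW hc'.2
    obtain ⟨h4, h5⟩ := e.tame_bits hM hMW hs hW hc'.1.1
    refine ⟨h1, h2.mono (by nlinarith), ?_⟩
    have g1 : t * (W + t * (M + 1) + 1) ≤ t * (W + (e.steps + 1 + t) * (M + 1) + 1) :=
      Nat.mul_le_mul_left _ (by nlinarith)
    have g2 : e.steps * (W + e.steps * (M + 1) + 1) ≤
        e.steps * (W + (e.steps + 1 + t) * (M + 1) + 1) :=
      Nat.mul_le_mul_left _ (by nlinarith)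
    nlinarith
  | @loop_true e c s₁ s₂ s₃ t₁ t₂ b₁ b₂ he _ _ ih₁ ih₂ =>
    intro W hMW hs hW hc
    have hc' : e.tame K A Z = true ∧ c.tame K A Z = true := by simpa [Cmd.tame] using hc
    obtain ⟨h1, h2, h3⟩ := ih₁ W hMW hs hW hc'.2
    obtain ⟨h4, h5, h6⟩ := ih₂ _ (by omega) h1 h2 hc
    obtain ⟨h7, h8⟩ := e.tame_bits hM hMW hs hW hc'.1
    refine ⟨h4, h5.mono (by nlinarith), ?_⟩
    have g1 : t₁ * (W + t₁ * (M + 1) + 1) ≤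
        t₁ * (W + (e.steps + 1 + t₁ + t₂) * (M + 1) + 1) := Nat.mul_le_mul_left _ (by nlinarith)
    have g2 : e.steps * (W + e.steps * (M + 1) + 1) ≤
        e.steps * (W + (e.steps + 1 + t₁ + t₂) * (M + 1) + 1) :=
      Nat.mul_le_mul_left _ (by nlinarith)
    have g3 : t₂ * (W + t₁ * (M + 1) + t₂ * (M + 1) + 1) ≤
        t₂ * (W + (e.steps + 1 + t₁ + t₂) * (M + 1) + 1) := Nat.mul_le_mul_left _ (by nlinarith)
    nlinarith
  | @loop_false e c s he =>
    intro W hMW hs hW hc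
    have hc' : e.tame K A Z = true ∧ c.tame K A Z = true := by simpa [Cmd.tame] using hc
    obtain ⟨h7, h8⟩ := e.tame_bits hM hMW hs hW hc'.1
    refine ⟨hs, hW.mono (by omega), ?_⟩
    have : e.steps * (W + e.steps * (M + 1) + 1) ≤
        e.steps * (W + (e.steps + 1) * (M + 1) + 1) := Nat.mul_le_mul_left _ (by nlinarith)
    nlinarith

/-- A tame program that takes at most `T` steps from a state of at most `M` bits. -/
theorem Exec.bits_le {K A Z : List ℕ} {M T : ℕ} (hM : 3 ≤ M) {c : Cmd} {s s' : State} {t b : ℕ}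
    (ex : Exec c s s' t b) (hZ : ∀ x ∈ Z, x ∈ K) (hz : ∀ x ∈ Z, s.vars x ≠ 0) (hs : s.BitsLE M)
    (hc : c.tame K A Z = true) (ht : t ≤ T) :
    s'.BitsLE ((T + 1) * (M + 1)) ∧ b ≤ (T + 1) * ((T + 1) * (M + 1)) := by
  obtain ⟨-, h2, h3⟩ := ex.tame_bits hM hZ M le_rfl
    ⟨fun x _ => hs.1 x, fun a _ k => hs.2 a k, hz⟩ hs hc
  have : M + t * (M + 1) + 1 ≤ (T + 1) * (M + 1) := by nlinarith
  exact ⟨h2.mono (by omega), h3.trans (Nat.mul_le_mul (by omega) this)⟩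

/-! ### Longest paths in one pass over a topologically ordered system -/

/-- A weighted transition system on the integers `0, …, size - 1`: `J` choices are available at
each state, choice `j` at `z` is permitted if `edge z j` holds, and it then leads to
`next z j > z`. The predicate `good` is an invariant of the reachable states. -/
structure System where
  size : ℕ
  J : ℕ
  seed : ℤ → Prop
  edge : ℤ → ℕ → Prop
  next : ℤ → ℕ → ℤ
  weight : ℤ → ℕ → ℤ
  final : ℤ → Prop
  good : ℤ → Prop
  good_range : ∀ z, good z → 0 ≤ z ∧ z < size
  good_seed : ∀ z : ℤ, 0 ≤ z → z < size → seed z → good z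
  good_next : ∀ z j, good z → j < J → edge z j → good (next z j)
  lt_next : ∀ z j, good z → j < J → edge z j → z < next z j
  weight_nonneg : ∀ z j, good z → j < J → edge z j → 0 ≤ weight z j
  not_seed_next : ∀ z j, good z → j < J → edge z j → ¬ seed (next z j)

namespace System

variable (S : System)

/-- `S.Run z a`: there is a path from a seed to `z` of total weight `a - 1`. -/
inductive Run : ℤ → ℤ → Prop
  | start {z : ℤ} : 0 ≤ z → z < S.size → S.seed z → Run z 1
  | step {z a : ℤ} {j : ℕ} : Run z a → j < S.J → S.edge z j →
      Run (S.next z j) (a + S.weight z j)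

variable {S}

theorem Run.good {z a : ℤ} (h : S.Run z a) : S.good z := by
  induction h with
  | start h0 h1 hs => exact S.good_seed _ h0 h1 hs
  | step _ hj he ih => exact S.good_next _ _ ih hj he

variable (S)

/-- The invariant of the pass: the seeds below `s₀` have been initialized, and the edges `(z, j)`
that precede `(z₀, j₀)` in lexicographic order have been relaxed. The entry `val z` is `0` as long
as `z` has not been reached; otherwise it is one more than the weight of a path to `z`, and
`par z - 1` is the state before `z` on that path, or `par z = 0` if `z` is a seed. -/
structure Inv (val par : ℤ → ℤ) (s₀ z₀ : ℤ) (j₀ : ℕ) : Prop where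
  nonneg : ∀ z, 0 ≤ val z
  par_eq_zero : ∀ z, val z = 0 → par z = 0
  seed_le : ∀ z : ℤ, 0 ≤ z → z < S.size → z < s₀ → S.seed z → 1 ≤ val z
  relaxed : ∀ z j, j < S.J → (z < z₀ ∨ z = z₀ ∧ j < j₀) → 0 < val z → S.edge z j →
    val z + S.weight z j ≤ val (S.next z j)
  good : ∀ z, 0 < val z → S.good z
  origin : ∀ z, 0 < val z → (S.seed z ∧ val z = 1 ∧ par z = 0) ∨
    ∃ y j, j < S.J ∧ (y < z₀ ∨ y = z₀ ∧ j < j₀) ∧ 0 < val y ∧ S.edge y j ∧ z = S.next y j ∧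
      val z = val y + S.weight y j ∧ par z = y + 1

/-- The invariant for the best final state below `z₀`. -/
structure Best (val : ℤ → ℤ) (z₀ best bz : ℤ) : Prop where
  nonneg : 0 ≤ best
  le : ∀ z, z < z₀ → S.final z → val z ≤ best
  eq : best = 0 ∨ S.final bz ∧ bz < z₀ ∧ val bz = best

variable {S} {val par : ℤ → ℤ} {s₀ z₀ : ℤ} {j₀ : ℕ}

theorem Inv.init : S.Inv (fun _ => 0) (fun _ => 0) 0 0 0 where
  nonneg := by simp
  par_eq_zero := by simp
  seed_le := fun z h0 _ h1 => by omega
  relaxed := by simp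
  good := by simp
  origin := by simp

theorem Inv.seed_step (h : S.Inv val par z₀ z₀ 0) (h0 : 0 ≤ z₀) (h1 : z₀ < S.size)
    (hs : S.seed z₀) : S.Inv (Function.update val z₀ 1) par (z₀ + 1) z₀ 0 := by
  have hval : val z₀ = 0 ∨ val z₀ = 1 ∧ par z₀ = 0 := by
    rcases (h.nonneg z₀).eq_or_lt with h' | h'
    · exact Or.inl h'.symm
    · rcases h.origin z₀ h' with ⟨-, h2, h3⟩ | ⟨y, j, hj, -, hy, he, hz, -⟩
      · exact Or.inr ⟨h2, h3⟩
      · exact absurd (hz ▸ hs) (S.not_seed_next y j (h.good y hy) hj he)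
  have hpar : par z₀ = 0 := hval.elim (h.par_eq_zero z₀) And.right
  have hne : ∀ z, z ≠ z₀ → Function.update val z₀ 1 z = val z := fun z hz =>
    Function.update_of_ne hz _ _
  have hle : ∀ z, val z ≤ Function.update val z₀ 1 z := by
    intro z
    rcases eq_or_ne z z₀ with rfl | hz
    · rw [Function.update_self]; omega
    · rw [hne z hz]
  refine ⟨fun z => (h.nonneg z).trans (hle z), fun z hz => ?_, fun z hz hz' hlt hsz => ?_,
    fun z j hj hp hv he => ?_, fun z hv => ?_, fun z hv => ?_⟩
  · rcases eq_or_ne z z₀ with rfl | hn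
    · exact hpar
    · exact h.par_eq_zero z (by rwa [hne z hn] at hz)
  · rcases eq_or_ne z z₀ with rfl | hn
    · simp
    · rw [hne z hn]; exact h.seed_le z hz hz' (by omega) hsz
  · have hn : z ≠ z₀ := by rintro rfl; omega
    rw [hne z hn] at hv ⊢
    exact (h.relaxed z j hj hp hv he).trans (hle _)
  · rcases eq_or_ne z z₀ with rfl | hn
    · exact S.good_seed z h0 h1 hs
    · exact h.good z (by rwa [hne z hn] at hv)
  · rcases eq_or_ne z z₀ with rfl | hn
    · exact Or.inl ⟨hs, by simp, hpar⟩
    · rw [hne z hn] at hv ⊢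
      refine (h.origin z hv).imp_right ?_
      rintro ⟨y, j, hj, hp, hy, he, hz, hw, hpz⟩
      have hyn : y ≠ z₀ := by rintro rfl; omega
      exact ⟨y, j, hj, hp, by rwa [hne y hyn], he, hz, by rw [hne y hyn]; exact hw, hpz⟩

theorem Inv.no_seed_step (h : S.Inv val par z₀ z₀ 0) (hs : ¬ S.seed z₀) :
    S.Inv val par (z₀ + 1) z₀ 0 :=
  { h with
    seed_le := fun z h0 h1 hlt hsz => h.seed_le z h0 h1
      (lt_of_le_of_ne (by omega) fun e => hs (e ▸ hsz)) hsz }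

theorem Inv.relax_step (h : S.Inv val par s₀ z₀ j₀) (hj₀ : j₀ < S.J) (hv₀ : 0 < val z₀)
    (he₀ : S.edge z₀ j₀) (hlt : val (S.next z₀ j₀) < val z₀ + S.weight z₀ j₀) :
    S.Inv (Function.update val (S.next z₀ j₀) (val z₀ + S.weight z₀ j₀))
      (Function.update par (S.next z₀ j₀) (z₀ + 1)) s₀ z₀ (j₀ + 1) := by
  set w := S.next z₀ j₀ with hw
  have hzw : z₀ < w := S.lt_next z₀ j₀ (h.good z₀ hv₀) hj₀ he₀
  have hne : ∀ z, z ≠ w → Function.update val w (val z₀ + S.weight z₀ j₀) z = val z := fun z hz =>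
    Function.update_of_ne hz _ _
  have hnep : ∀ z, z ≠ w → Function.update par w (z₀ + 1) z = par z := fun z hz =>
    Function.update_of_ne hz _ _
  have hle : ∀ z, val z ≤ Function.update val w (val z₀ + S.weight z₀ j₀) z := by
    intro z
    rcases eq_or_ne z w with rfl | hz
    · rw [Function.update_self]; omega
    · rw [hne z hz]
  refine ⟨fun z => (h.nonneg z).trans (hle z), fun z hz => ?_,
    fun z hz hz' hlt hsz => (h.seed_le z hz hz' hlt hsz).trans (hle z),
    fun z j hj hp hv he => ?_, fun z hv => ?_, fun z hv => ?_⟩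
  · rcases eq_or_ne z w with rfl | hn
    · rw [Function.update_self] at hz
      have := h.nonneg w; omega
    · rw [hnep z hn]; exact h.par_eq_zero z (by rwa [hne z hn] at hz)
  · have hn : z ≠ w := by rintro rfl; omega
    rw [hne z hn] at hv ⊢
    by_cases hcase : z = z₀ ∧ j = j₀
    · obtain ⟨rfl, rfl⟩ := hcase
      rw [← hw, Function.update_self]
    · exact (h.relaxed z j hj (by omega) hv he).trans (hle _)
  · rcases eq_or_ne z w with rfl | hn
    · exact S.good_next z₀ j₀ (h.good z₀ hv₀) hj₀ he₀
    · exact h.good z (by rwa [hne z hn] at hv)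
  · rcases eq_or_ne z w with rfl | hn
    · refine Or.inr ⟨z₀, j₀, hj₀, by omega, ?_, he₀, hw, ?_, by simp⟩
      · rwa [hne z₀ hzw.ne]
      · rw [Function.update_self, hne z₀ hzw.ne]
    · rw [hne z hn] at hv ⊢
      rw [hnep z hn]
      refine (h.origin z hv).imp_right ?_
      rintro ⟨y, j, hj, hp, hy, he, hz, hw', hpz⟩
      have hyn : y ≠ w := by rintro rfl; omega
      exact ⟨y, j, hj, by omega, by rwa [hne y hyn], he, hz, by rw [hne y hyn]; exact hw', hpz⟩

theorem Inv.no_relax_step (h : S.Inv val par s₀ z₀ j₀)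
    (hno : 0 < val z₀ → S.edge z₀ j₀ → val z₀ + S.weight z₀ j₀ ≤ val (S.next z₀ j₀)) :
    S.Inv val par s₀ z₀ (j₀ + 1) :=
  { h with
    relaxed := fun z j hj hp hv he => by
      by_cases hcase : z = z₀ ∧ j = j₀
      · obtain ⟨rfl, rfl⟩ := hcase
        exact hno hv he
      · exact h.relaxed z j hj (by omega) hv he
    origin := fun z hv => (h.origin z hv).imp_right fun ⟨y, j, hj, hp, hr⟩ =>
      ⟨y, j, hj, by omega, hr⟩ }

theorem Inv.next_state (h : S.Inv val par (z₀ + 1) z₀ S.J) :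
    S.Inv val par (z₀ + 1) (z₀ + 1) 0 :=
  { h with
    relaxed := fun z j hj hp hv he => h.relaxed z j hj (by omega) hv he
    origin := fun z hv => (h.origin z hv).imp_right fun ⟨y, j, hj, hp, hr⟩ =>
      ⟨y, j, hj, by omega, hr⟩ }

/-- An unreached state has nothing to relax. -/
theorem Inv.skip_state (h : S.Inv val par (z₀ + 1) z₀ 0) (hv : val z₀ ≤ 0) :
    S.Inv val par (z₀ + 1) (z₀ + 1) 0 :=
  { h with
    relaxed := fun z j hj hp hv' he => by
      rcases eq_or_ne z z₀ with rfl | hn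
      · omega
      · exact h.relaxed z j hj (by omega) hv' he
    origin := fun z hv => (h.origin z hv).imp_right fun ⟨y, j, hj, hp, hr⟩ =>
      ⟨y, j, hj, by omega, hr⟩ }

theorem Best.init (bz : ℤ) (h : ∀ z < 0, val z = 0) : S.Best val 0 0 bz where
  nonneg := le_rfl
  le := fun z hz _ => (h z hz).le
  eq := Or.inl rfl

theorem Best.congr {val' : ℤ → ℤ} {best bz : ℤ} (h : S.Best val z₀ best bz)
    (he : ∀ z < z₀, val' z = val z) : S.Best val' z₀ best bz where
  nonneg := h.nonneg
  le := fun z hz hf => (he z hz).le.trans (h.le z hz hf)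
  eq := h.eq.imp_right fun ⟨h1, h2, h3⟩ => ⟨h1, h2, (he bz h2).trans h3⟩

theorem Best.improve {best bz : ℤ} (h : S.Best val z₀ best bz) (hf : S.final z₀)
    (hlt : best < val z₀) : S.Best val (z₀ + 1) (val z₀) z₀ where
  nonneg := h.nonneg.trans hlt.le
  le := fun z hz hf' => by
    rcases eq_or_ne z z₀ with rfl | hn
    · exact le_rfl
    · exact (h.le z (by omega) hf').trans hlt.le
  eq := Or.inr ⟨hf, by omega, rfl⟩

theorem Best.keep {best bz : ℤ} (h : S.Best val z₀ best bz)
    (hno : S.final z₀ → val z₀ ≤ best) : S.Best val (z₀ + 1) best bz where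
  nonneg := h.nonneg
  le := fun z hz hf' => by
    rcases eq_or_ne z z₀ with rfl | hn
    · exact hno hf'
    · exact h.le z (by omega) hf'
  eq := h.eq.imp_right fun ⟨h1, h2, h3⟩ => ⟨h1, by omega, h3⟩

/-- After the pass, `val` bounds the weight of every run. -/
theorem Inv.run_le (h : S.Inv val par S.size S.size 0) {z a : ℤ} (hr : S.Run z a) :
    1 ≤ a ∧ a ≤ val z := by
  induction hr with
  | start h0 h1 hs => exact ⟨le_rfl, h.seed_le _ h0 h1 h1 hs⟩
  | @step z a j hr hj he ih =>
    have hg := hr.good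
    have hw := S.weight_nonneg z j hg hj he
    have := h.relaxed z j hj (Or.inl (S.good_range z hg).2) (by omega) he
    omega

/-- The path recorded by the parent pointers of a reached state. -/
structure Chain (S : System) (val par : ℤ → ℤ) (z : ℤ) (q : ℕ) (zs : ℕ → ℤ) (js : ℕ → ℕ) :
    Prop where
  seed : S.seed (zs 0)
  par_seed : par (zs 0) = 0
  last : zs q = z
  good : ∀ i ≤ q, S.good (zs i)
  J : ∀ i < q, js i < S.J
  edge : ∀ i < q, S.edge (zs i) (js i)
  next : ∀ i < q, zs (i + 1) = S.next (zs i) (js i)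
  par : ∀ i < q, par (zs (i + 1)) = zs i + 1
  val_seed : val (zs 0) = 1
  val : ∀ i < q, val (zs (i + 1)) = val (zs i) + S.weight (zs i) (js i)

theorem Inv.exists_chain (h : S.Inv val par s₀ z₀ j₀) :
    ∀ z : ℤ, 0 < val z → ∃ (q : ℕ) (zs : ℕ → ℤ) (js : ℕ → ℕ),
      S.Chain val par z q zs js ∧ q ≤ z := by
  suffices H : ∀ m : ℕ, ∀ z : ℤ, z.toNat = m → 0 < val z →
      ∃ (q : ℕ) (zs : ℕ → ℤ) (js : ℕ → ℕ), S.Chain val par z q zs js ∧ q ≤ z from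
    fun z hz => H _ z rfl hz
  intro m
  induction m using Nat.strong_induction_on with
  | _ m ih =>
  intro z hm hz
  have hgz := h.good z hz
  rcases h.origin z hz with ⟨h1, h2, h3⟩ | ⟨y, j, hj, -, hy, he, hzy, hw, hp⟩
  · refine ⟨0, fun _ => z, fun _ => 0, ⟨h1, h3, rfl, fun _ _ => hgz, ?_, ?_, ?_, ?_, h2, ?_⟩, ?_⟩
    all_goals first
      | exact_mod_cast (S.good_range z hgz).1
      | (intro i hi; exact absurd hi (Nat.not_lt_zero i))
  · have hgy := h.good y hy
    have hlt := S.lt_next y j hgy hj he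
    have hr := S.good_range y hgy
    obtain ⟨q, zs, js, hc, hq⟩ := ih y.toNat (by omega) y rfl hy
    have hz' : ∀ i ≤ q, (fun i => if i ≤ q then zs i else z) i = zs i := fun i hi => by simp [hi]
    have hs : (fun i => if i ≤ q then zs i else z) (q + 1) = z := by simp
    have hj' : ∀ i < q, (fun i => if i < q then js i else j) i = js i := fun i hi => by simp [hi]
    have hjq : (fun i => if i < q then js i else j) q = j := by simp
    generalize (fun i => if i ≤ q then zs i else z) = zs' at hz' hs
    generalize (fun i => if i < q then js i else j) = js' at hj' hjq
    refine ⟨q + 1, zs', js', ⟨?_, ?_, hs, ?_, ?_, ?_, ?_, ?_, ?_, ?_⟩, by push_cast; omega⟩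
    · rw [hz' 0 (by omega)]; exact hc.seed
    · rw [hz' 0 (by omega)]; exact hc.par_seed
    · intro i hi
      rcases Nat.lt_or_ge q i with hi' | hi'
      · obtain rfl : i = q + 1 := by omega
        rwa [hs]
      · rw [hz' i hi']; exact hc.good i hi'
    · intro i hi
      rcases Nat.lt_or_ge i q with hi' | hi'
      · rw [hj' i hi']; exact hc.J i hi'
      · obtain rfl : i = q := by omega
        rwa [hjq]
    · intro i hi
      rcases Nat.lt_or_ge i q with hi' | hi'
      · rw [hj' i hi', hz' i hi'.le]; exact hc.edge i hi'
      · obtain rfl : i = q := by omega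
        rwa [hjq, hz' i le_rfl, hc.last]
    · intro i hi
      rcases Nat.lt_or_ge i q with hi' | hi'
      · rw [hj' i hi', hz' i hi'.le, hz' (i + 1) hi']; exact hc.next i hi'
      · obtain rfl : i = q := by omega
        rwa [hjq, hz' i le_rfl, hc.last, hs]
    · intro i hi
      rcases Nat.lt_or_ge i q with hi' | hi'
      · rw [hz' i hi'.le, hz' (i + 1) hi']; exact hc.par i hi'
      · obtain rfl : i = q := by omega
        rwa [hz' i le_rfl, hc.last, hs]
    · rw [hz' 0 (by omega)]; exact hc.val_seed
    · intro i hi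
      rcases Nat.lt_or_ge i q with hi' | hi'
      · rw [hj' i hi', hz' i hi'.le, hz' (i + 1) hi']; exact hc.val i hi'
      · obtain rfl : i = q := by omega
        rwa [hjq, hz' i le_rfl, hc.last, hs]

theorem Chain.val_eq {z : ℤ} {q : ℕ} {zs : ℕ → ℤ} {js : ℕ → ℕ} (hc : S.Chain val par z q zs js) :
    ∀ i ≤ q, val (zs i) = 1 + ∑ k ∈ Finset.range i, S.weight (zs k) (js k) := by
  intro i
  induction i with
  | zero => intro _; simp [hc.val_seed]
  | succ i ih =>
    intro hi
    rw [hc.val i hi, ih (by omega), Finset.sum_range_succ]; ring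

end System

/-! ### Digits of integers -/

/-- The digit of `z` at position `k` in base `D`. -/
def digit (D z : ℤ) (k : ℕ) : ℤ := z / D ^ k % D

section Digit

variable {D : ℤ}

theorem digit_nonneg (hD : 0 < D) (z : ℤ) (k : ℕ) : 0 ≤ digit D z k := Int.emod_nonneg _ hD.ne'

theorem digit_lt (hD : 0 < D) (z : ℤ) (k : ℕ) : digit D z k < D := Int.emod_lt_of_pos _ hD

theorem div_pow_add (hD : 0 < D) (z : ℤ) (i k : ℕ) : z / D ^ (i + k) = z / D ^ i / D ^ k := by
  rw [pow_add, Int.ediv_ediv_of_nonneg (by positivity)]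

theorem digit_add_eq_digit_div (hD : 0 < D) (z : ℤ) (i k : ℕ) :
    digit D z (i + k) = digit D (z / D ^ i) k := by
  rw [digit, digit, div_pow_add hD]

theorem digit_change_self (hD : 0 < D) {z a : ℤ} {k : ℕ} (h0 : 0 ≤ digit D z k + a)
    (h1 : digit D z k + a < D) : digit D (z + D ^ k * a) k = digit D z k + a := by
  unfold digit at *
  rw [Int.add_mul_ediv_left _ _ (by positivity)]
  conv_rhs => rw [← Int.emod_eq_of_lt h0 h1]
  simp

/-- Changing one digit leaves the higher part of the number unchanged. -/
theorem div_change_of_lt (hD : 0 < D) {z a : ℤ} {k i : ℕ} (h0 : 0 ≤ digit D z k + a)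
    (h1 : digit D z k + a < D) (hi : k < i) : (z + D ^ k * a) / D ^ i = z / D ^ i := by
  obtain ⟨m, rfl⟩ : ∃ m, i = k + 1 + m := ⟨i - (k + 1), by omega⟩
  rw [div_pow_add hD, div_pow_add hD z]
  congr 1
  rw [div_pow_add hD, div_pow_add hD z, Int.add_mul_ediv_left _ _ (by positivity), pow_one]
  unfold digit at h0 h1
  have h2 := Int.emod_add_mul_ediv (z / D ^ k) D
  rw [show z / D ^ k + a = (z / D ^ k % D + a) + D * (z / D ^ k / D) by linarith,
    Int.add_mul_ediv_left _ _ hD.ne', Int.ediv_eq_zero_of_lt h0 h1, zero_add]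

theorem digit_change_ne (hD : 0 < D) {z a : ℤ} {k i : ℕ} (h0 : 0 ≤ digit D z k + a)
    (h1 : digit D z k + a < D) (hi : i ≠ k) : digit D (z + D ^ k * a) i = digit D z i := by
  rcases lt_or_gt_of_ne hi with h | h
  · obtain ⟨m, rfl⟩ : ∃ m, k = i + 1 + m := ⟨k - (i + 1), by omega⟩
    unfold digit
    rw [show D ^ (i + 1 + m) * a = D ^ i * (D * (D ^ m * a)) by ring,
      Int.add_mul_ediv_left _ _ (by positivity)]
    simp
  · unfold digit
    rw [div_change_of_lt hD h0 h1 h]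

theorem digit_of_lt {z : ℤ} {k : ℕ} (h0 : 0 ≤ z) (h1 : z < D ^ k) :
    digit D z k = 0 := by
  rw [digit, Int.ediv_eq_zero_of_lt h0 h1, Int.zero_emod]

theorem digit_emod_pow (hD : 0 < D) (z : ℤ) {i k : ℕ} (h : i < k) :
    digit D (z % D ^ k) i = digit D z i := by
  obtain ⟨m, rfl⟩ : ∃ m, k = i + 1 + m := ⟨k - (i + 1), by omega⟩
  unfold digit
  conv_rhs => rw [← Int.emod_add_mul_ediv z (D ^ (i + 1 + m))]
  rw [show D ^ (i + 1 + m) * (z / D ^ (i + 1 + m)) = D ^ i * (D * (D ^ m * (z / D ^ (i + 1 + m))))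
    by ring, Int.add_mul_ediv_left _ _ (by positivity)]
  simp

theorem eq_of_digit_eq (hD : 0 < D) {k : ℕ} : ∀ {z y : ℤ}, 0 ≤ z → z < D ^ k → 0 ≤ y → y < D ^ k →
    (∀ i < k, digit D z i = digit D y i) → z = y := by
  induction k with
  | zero => intro z y h1 h2 h3 h4 _; simp at h2 h4; omega
  | succ k ih =>
    intro z y h1 h2 h3 h4 h
    have h0 := h 0 (by omega)
    simp only [digit, pow_zero, Int.ediv_one] at h0
    have hdiv : z / D = y / D := by
      refine ih (Int.ediv_nonneg h1 hD.le) ?_ (Int.ediv_nonneg h3 hD.le) ?_ fun i hi => ?_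
      · exact Int.ediv_lt_of_lt_mul hD (by rwa [← pow_succ])
      · exact Int.ediv_lt_of_lt_mul hD (by rwa [← pow_succ])
      · have := h (1 + i) (by omega)
        rwa [digit_add_eq_digit_div hD, digit_add_eq_digit_div hD y, pow_one] at this
    rw [← Int.emod_add_mul_ediv z D, ← Int.emod_add_mul_ediv y D, h0, hdiv]

theorem exists_digit_eq (hD : 0 < D) (d : ℕ → ℤ) (h0 : ∀ i, 0 ≤ d i) (h1 : ∀ i, d i < D) (k : ℕ) :
    ∃ z : ℤ, 0 ≤ z ∧ z < D ^ k ∧ ∀ i < k, digit D z i = d i := by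
  induction k with
  | zero => exact ⟨0, by simp⟩
  | succ k ih =>
    obtain ⟨z, hz0, hz1, hz⟩ := ih
    have e : digit D z k + d k = d k := by rw [digit_of_lt hz0 hz1, zero_add]
    refine ⟨z + D ^ k * d k, by have := h0 k; positivity, ?_, fun i hi => ?_⟩
    · rw [pow_succ]
      have := h1 k
      nlinarith [pow_pos hD k]
    · rcases Nat.lt_or_ge i k with h | h
      · rw [digit_change_ne hD (by rw [e]; exact h0 k) (by rw [e]; exact h1 k) h.ne, hz i h]
      · obtain rfl : i = k := by omega
        rw [digit_change_self hD (by rw [e]; exact h0 i) (by rw [e]; exact h1 i), e]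

/-- Equality of two blocks of `m` digits, compared as numbers. -/
theorem block_eq_iff (hD : 0 < D) {z : ℤ} {i k m : ℕ} (hz : 0 ≤ z) (hk : z < D ^ (k + m)) :
    z / D ^ i % D ^ m = z / D ^ k ↔ ∀ u < m, digit D z (i + u) = digit D z (k + u) := by
  constructor
  · intro h u hu
    rw [digit_add_eq_digit_div hD, digit_add_eq_digit_div hD, ← h, digit_emod_pow hD _ hu]
  · intro h
    refine eq_of_digit_eq hD (k := m) (Int.emod_nonneg _ (by positivity))
      (Int.emod_lt_of_pos _ (by positivity)) (Int.ediv_nonneg hz (by positivity))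
      (Int.ediv_lt_of_lt_mul (by positivity) (by rwa [mul_comm, ← pow_add] )) fun u hu => ?_
    rw [digit_emod_pow hD _ hu, ← digit_add_eq_digit_div hD, ← digit_add_eq_digit_div hD, h u hu]

theorem block_eq_zero_iff (hD : 0 < D) {z : ℤ} {i m : ℕ} :
    z / D ^ i % D ^ m = 0 ↔ ∀ u < m, digit D z (i + u) = 0 := by
  have hz : ∀ u, digit D 0 u = 0 := by simp [digit]
  constructor
  · intro h u hu
    rw [digit_add_eq_digit_div hD, ← digit_emod_pow hD _ hu, h, hz]
  · intro h
    refine eq_of_digit_eq hD (k := m) (Int.emod_nonneg _ (by positivity))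
      (Int.emod_lt_of_pos _ (by positivity)) le_rfl (by positivity) fun u hu => ?_
    rw [digit_emod_pow hD _ hu, ← digit_add_eq_digit_div hD, h u hu, hz]

end Digit

/-! ### The system of states explored by the program -/

/-- A routing problem with decay factor `a / b` and memory bound `B`. -/
structure Problem where
  n : ℕ
  B : ℕ
  G : Digraph (Fin n)
  v₀ : Fin n
  a : ℕ
  b : ℕ
  one_lt_B : 1 < B
  a_pos : 0 < a
  a_lt_b : a < b

namespace Problem

variable (P : Problem)

/-- The base in which states are written. No digit of a reachable state exceeds `n * B`. -/
def D : ℤ := P.n * P.B + 1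

/-- Digit `k` of the state `z`. Digit `0` is the current node. Then come, one digit per node, the
times of the last visits and the numbers of departures, followed by a clock that counts the steps
on the cycle. The remaining digits never change: the node at which the cycle starts, its length,
and the times of the last visits that are assumed initially. -/
def dg (z : ℤ) (k : ℕ) : ℕ := (digit P.D z k).toNat

/-- The current node of the state `z`. -/
def node (z : ℤ) : ℕ := P.dg z 0
/-- The time of the last visit to `u` on the cycle. -/
def visit (z : ℤ) (u : ℕ) : ℕ := P.dg z (1 + u)
/-- The number of departures from `u` so far. -/
def count (z : ℤ) (u : ℕ) : ℕ := P.dg z (P.n + 1 + u)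
/-- The number of steps made on the cycle; it is `0` as long as the cycle has not been entered. -/
def clock (z : ℤ) : ℕ := P.dg z (2 * P.n + 1)
/-- The node at which the cycle starts, guessed in the seed. -/
def start (z : ℤ) : ℕ := P.dg z (2 * P.n + 2)
/-- The length of the cycle, guessed in the seed. -/
def len (z : ℤ) : ℕ := P.dg z (2 * P.n + 3)
/-- The time of the last visit to `u` that is assumed when the cycle is entered. -/
def visit₀ (z : ℤ) (u : ℕ) : ℕ := P.dg z (2 * P.n + 4 + u)

/-- The memory state in which the current node is left. -/
def mem (z : ℤ) : ℕ := P.count z (P.node z)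

/-- Adjacency of nodes that are given by their numbers. -/
def Adj (u w : ℕ) : Prop := ∃ (hu : u < P.n) (hw : w < P.n), P.G.Adj ⟨u, hu⟩ ⟨w, hw⟩

/-- The node to which choice `j` leads. The choices `j < n` are steps before the cycle. -/
def target (j : ℕ) : ℕ := j % P.n

/-- Initial states: nothing has been traversed, and the last visits are those assumed. -/
def Seed (z : ℤ) : Prop :=
  P.node z = P.v₀ ∧ (∀ u < P.n, P.visit z u = P.visit₀ z u) ∧
    ∀ u < P.n + 1, P.dg z (P.n + 1 + u) = 0

/-- Final states: the cycle has been traversed once, and the last visits at its end are the assumed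
ones, so that a further traversal brings the same rewards. -/
def Final (z : ℤ) : Prop :=
  0 < P.clock z ∧ P.clock z = P.len z ∧ P.node z = P.start z ∧
    ∀ u < P.n, P.visit z u = P.visit₀ z u

/-- Choice `j` is permitted in the state `z`. A step before the cycle requires that the clock still
stands at `0`; a step on the cycle starts the clock at the node `start z` only. -/
def Edge (z : ℤ) (j : ℕ) : Prop :=
  P.Adj (P.node z) (P.target j) ∧ P.mem z < P.B ∧
    (j < P.n ∧ P.clock z = 0 ∨
      P.n ≤ j ∧ P.clock z < P.len z ∧ (0 < P.clock z ∨ P.node z = P.start z))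

/-- The state after choice `j`. The count of the node that is left goes up by one and the current
node is exchanged; on the cycle, also the clock advances and the last visit of the target is set. -/
def next (z : ℤ) (j : ℕ) : ℤ :=
  z + P.D ^ (P.n + 1 + P.node z) + (P.target j - P.node z) +
    if j < P.n then 0 else
      P.D ^ (2 * P.n + 1) + P.D ^ (1 + P.target j) * (P.clock z + 1 - P.visit z (P.target j))

/-- The time since the last visit of `u` when `u` is reached in the next step on the cycle: the
times of visits count modulo the length of the cycle. -/
def gap (z : ℤ) (u : ℕ) : ℕ := (((P.clock z : ℤ) - P.visit z u) % P.len z).toNat + 1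

/-- The reward `1 - (a / b) ^ g`, scaled to an integer. -/
def rew (g : ℕ) : ℤ := P.b ^ (P.n * P.B) - P.a ^ g * P.b ^ (P.n * P.B - g)

/-- The factor `(n * B)!` makes the sums over cycles of different lengths comparable. -/
def F : ℤ := (P.n * P.B).factorial

/-- The reward of choice `j`, scaled to an integer. Only steps on the cycle are rewarded. -/
def weight (z : ℤ) (j : ℕ) : ℤ :=
  if j < P.n then 0 else P.F / P.len z * P.rew (P.gap z (P.target j))

/-- States are the numbers with `3 * n + 4` digits. -/
def size : ℕ := (P.n * P.B + 1) ^ (3 * P.n + 4)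

/-- An invariant of the reachable states. -/
def Good (z : ℤ) : Prop := 0 ≤ z ∧ z < P.size ∧ P.node z < P.n

variable {P}

theorem n_pos : 0 < P.n := Fin.pos P.v₀

theorem le_n_mul_B : P.n ≤ P.n * P.B := Nat.le_mul_of_pos_right _ (by have := P.one_lt_B; omega)

theorem B_le_n_mul_B : P.B ≤ P.n * P.B := Nat.le_mul_of_pos_left _ n_pos

theorem D_pos : 0 < P.D := by unfold D; positivity

theorem cast_dg (z : ℤ) (k : ℕ) : (P.dg z k : ℤ) = digit P.D z k :=
  Int.toNat_of_nonneg (digit_nonneg D_pos z k)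

theorem dg_le (z : ℤ) (k : ℕ) : P.dg z k ≤ P.n * P.B := by
  have h1 := cast_dg (P := P) z k
  have h2 := digit_lt (D_pos (P := P)) z k
  simp only [D] at h1 h2
  have : (P.dg z k : ℤ) < (P.n * P.B + 1 : ℕ) := by push_cast; omega
  exact Nat.lt_succ_iff.1 (by exact_mod_cast this)

theorem dg_change {z a : ℤ} {k c : ℕ} (ha : (P.dg z k : ℤ) + a = c) (hc : c ≤ P.n * P.B) (i : ℕ) :
    P.dg (z + P.D ^ k * a) i = if i = k then c else P.dg z i := by
  have hc' : (c : ℤ) < P.D := by unfold D; exact_mod_cast Nat.lt_succ_iff.2 hc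
  rw [cast_dg] at ha
  split_ifs with h
  · subst h
    rw [dg, digit_change_self D_pos (by omega) (by omega), ha, Int.toNat_natCast]
  · rw [dg, digit_change_ne D_pos (by omega) (by omega) h, dg]

theorem div_change {z a : ℤ} {k c i : ℕ} (ha : (P.dg z k : ℤ) + a = c) (hc : c ≤ P.n * P.B)
    (hi : k < i) : (z + P.D ^ k * a) / P.D ^ i = z / P.D ^ i := by
  have hc' : (c : ℤ) < P.D := by unfold D; exact_mod_cast Nat.lt_succ_iff.2 hc
  rw [cast_dg] at ha
  exact div_change_of_lt D_pos (by omega) (by omega) hi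

theorem cast_size : (P.size : ℤ) = P.D ^ (3 * P.n + 4) := by simp [size, D]

theorem target_lt (j : ℕ) : P.target j < P.n := Nat.mod_lt _ n_pos

/-- The state after the change of the node and of the number of departures. -/
def nextBase (P : Problem) (z : ℤ) (j : ℕ) : ℤ :=
  z + P.D ^ (P.n + 1 + P.node z) + (P.target j - P.node z)

theorem dg_nextBase {z : ℤ} {j : ℕ} (he : P.Edge z j) (i : ℕ) :
    P.dg (P.nextBase z j) i =
      if i = 0 then P.target j else if i = P.n + 1 + P.node z then P.mem z + 1 else P.dg z i := by
  have h1 : ∀ i, P.dg (z + P.D ^ (P.n + 1 + P.node z) * 1) i =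
      if i = P.n + 1 + P.node z then P.mem z + 1 else P.dg z i :=
    dg_change (c := P.mem z + 1) (by push_cast; rfl) 
      (by have := he.2.1; have := B_le_n_mul_B (P := P); omega)
  have h2 := dg_change (z := z + P.D ^ (P.n + 1 + P.node z) * 1) (k := 0) (P := P)
    (a := P.target j - P.node z) (c := P.target j) (by rw [h1, if_neg (by omega)]; simp [node])
    (((target_lt j).le).trans le_n_mul_B) i
  rw [h1] at h2
  rw [← h2, nextBase]
  simp

theorem div_nextBase {z : ℤ} {j i : ℕ} (he : P.Edge z j) (hi : P.n + 1 + P.node z < i) :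
    P.nextBase z j / P.D ^ i = z / P.D ^ i := by
  have h1 : ∀ i, P.dg (z + P.D ^ (P.n + 1 + P.node z) * 1) i =
      if i = P.n + 1 + P.node z then P.mem z + 1 else P.dg z i :=
    dg_change (c := P.mem z + 1) (by push_cast; rfl) 
      (by have := he.2.1; have := B_le_n_mul_B (P := P); omega)
  have h2 := div_change (z := z + P.D ^ (P.n + 1 + P.node z) * 1) (k := 0) (P := P)
    (a := P.target j - P.node z) (c := P.target j) (i := i)
      (by rw [h1, if_neg (by omega)]; simp [node])
    (((target_lt j).le).trans le_n_mul_B) (by omega)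
  rw [div_change (c := P.mem z + 1) (by push_cast; rfl)
    
      (by have := he.2.1; have := B_le_n_mul_B (P := P); omega) hi] at h2
  rw [← h2, nextBase]
  simp

theorem next_of_lt {z : ℤ} {j : ℕ} (hj : j < P.n) : P.next z j = P.nextBase z j := by
  simp [next, nextBase, hj]

theorem next_of_le {z : ℤ} {j : ℕ} (hj : P.n ≤ j) : P.next z j =
    P.nextBase z j + P.D ^ (1 + P.target j) * (P.clock z + 1 - P.visit z (P.target j)) +
      P.D ^ (2 * P.n + 1) * 1 := by
  simp only [next, nextBase, Nat.not_lt.2 hj, if_false]; ring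

theorem dg_next_of_le {z : ℤ} {j : ℕ} (hz : P.Good z) (he : P.Edge z j) (hj : P.n ≤ j) (i : ℕ) :
    P.dg (P.next z j) i =
      if i = 2 * P.n + 1 then P.clock z + 1 else if i = 1 + P.target j then P.clock z + 1 else
      if i = 0 then P.target j else if i = P.n + 1 + P.node z then P.mem z + 1 else P.dg z i := by
  have hw := target_lt (P := P) j
  have hn := hz.2.2
  have hcl : P.clock z + 1 ≤ P.n * P.B := by
    have := he.2.2
    have := dg_le (P := P) z (2 * P.n + 3)
    simp only [len] at *
    omega
  have h3 := dg_change (z := P.nextBase z j) (k := 1 + P.target j)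
    (a := P.clock z + 1 - P.visit z (P.target j)) (c := P.clock z + 1)
    (by rw [dg_nextBase he, if_neg (by omega), if_neg (by omega)]; simp [visit]) hcl
  rw [next_of_le hj, dg_change (c := P.clock z + 1) _ hcl, h3, dg_nextBase he]
  rw [h3, if_neg (by omega), dg_nextBase he, if_neg (by omega), if_neg (by omega)]
  simp [clock]

theorem div_next_of_le {z : ℤ} {j i : ℕ} (hz : P.Good z) (he : P.Edge z j) (hj : P.n ≤ j)
    (hi : 2 * P.n + 1 ≤ i) : P.next z j / P.D ^ i =
      (z + P.D ^ (2 * P.n + 1) * 1) / P.D ^ i := by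
  have hw := target_lt (P := P) j
  have hn := hz.2.2
  have hcl : P.clock z + 1 ≤ P.n * P.B := by
    have := he.2.2
    have := dg_le (P := P) z (2 * P.n + 3)
    simp only [len] at *
    omega
  obtain ⟨m, rfl⟩ : ∃ m, i = 2 * P.n + 1 + m := ⟨i - (2 * P.n + 1), by omega⟩
  rw [div_pow_add D_pos, div_pow_add D_pos (z + _), next_of_le hj,
    Int.add_mul_ediv_left _ _ (pow_pos D_pos _).ne',
      Int.add_mul_ediv_left _ _ (pow_pos D_pos _).ne',
    div_change (c := P.clock z + 1) _ hcl (by omega), div_nextBase he (by omega)]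
  rw [dg_nextBase he, if_neg (by omega), if_neg (by omega)]; simp [visit]

theorem node_next {z : ℤ} {j : ℕ} (hz : P.Good z) (he : P.Edge z j) :
    P.node (P.next z j) = P.target j := by
  rcases Nat.lt_or_ge j P.n with hj | hj
  · rw [node, next_of_lt hj, dg_nextBase he]; simp
  · have := target_lt (P := P) j
    rw [node, dg_next_of_le hz he hj, if_neg (by omega), if_neg (by omega), if_pos rfl]

theorem visit_next {z : ℤ} {j u : ℕ} (hz : P.Good z) (he : P.Edge z j) (hu : u < P.n) :
    P.visit (P.next z j) u =
      if P.n ≤ j ∧ P.target j = u then P.clock z + 1 else P.visit z u := by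
  have hn := hz.2.2
  rcases Nat.lt_or_ge j P.n with hj | hj
  · rw [visit, next_of_lt hj, dg_nextBase he, if_neg (by omega), if_neg (by omega),
      if_neg (by omega), visit]
  · rw [visit, dg_next_of_le hz he hj, if_neg (by omega)]
    by_cases h : P.target j = u
    · rw [if_pos (by omega), if_pos ⟨hj, h⟩]
    · rw [if_neg (by omega), if_neg (by omega), if_neg (by omega), if_neg (by omega), visit]

theorem count_next {z : ℤ} {j u : ℕ} (hz : P.Good z) (he : P.Edge z j) (hu : u < P.n) :
    P.count (P.next z j) u = if u = P.node z then P.count z u + 1 else P.count z u := by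
  have hn := hz.2.2
  have hw := target_lt (P := P) j
  have key : P.dg (P.next z j) (P.n + 1 + u) =
      if P.n + 1 + u = P.n + 1 + P.node z then P.mem z + 1 else P.dg z (P.n + 1 + u) := by
    rcases Nat.lt_or_ge j P.n with hj | hj
    · rw [next_of_lt hj, dg_nextBase he, if_neg (by omega)]
    · rw [dg_next_of_le hz he hj, if_neg (by omega), if_neg (by omega), if_neg (by omega)]
  rw [count, key]
  by_cases h : u = P.node z
  · subst h; simp [mem]
  · rw [if_neg (by omega), if_neg h, count]

theorem clock_next {z : ℤ} {j : ℕ} (hz : P.Good z) (he : P.Edge z j) :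
    P.clock (P.next z j) = if j < P.n then 0 else P.clock z + 1 := by
  have hn := hz.2.2
  have hw := target_lt (P := P) j
  rcases Nat.lt_or_ge j P.n with hj | hj
  · rw [clock, next_of_lt hj, dg_nextBase he, if_neg (by omega), if_neg (by omega), if_pos hj]
    have := he.2.2
    simp only [clock] at this
    omega
  · rw [clock, dg_next_of_le hz he hj, if_pos rfl, if_neg (by omega)]

theorem dg_next_of_lt {z : ℤ} {j i : ℕ} (hz : P.Good z) (he : P.Edge z j) (hi : 2 * P.n + 1 < i) :
    P.dg (P.next z j) i = P.dg z i := by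
  have hn := hz.2.2
  have hw := target_lt (P := P) j
  rcases Nat.lt_or_ge j P.n with hj | hj
  · rw [next_of_lt hj, dg_nextBase he, if_neg (by omega), if_neg (by omega)]
  · rw [dg_next_of_le hz he hj, if_neg (by omega), if_neg (by omega), if_neg (by omega),
      if_neg (by omega)]

theorem lt_next {z : ℤ} {j : ℕ} (hz : P.Good z) (he : P.Edge z j) : z < P.next z j := by
  have hn := hz.2.2
  have hlt : ∀ {y : ℤ} {k : ℕ}, y / P.D ^ k = (z + P.D ^ k * 1) / P.D ^ k → z < y := by
    intro y k h
    rw [Int.add_mul_ediv_left _ _ (pow_pos D_pos _).ne'] at h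
    by_contra hy
    have := Int.ediv_le_ediv (pow_pos (D_pos (P := P)) k) (not_lt.1 hy)
    omega
  rcases Nat.lt_or_ge j P.n with hj | hj
  · -- A step before the cycle raises the digit that counts the departures from the node.
    refine hlt (k := P.n + 1 + P.node z) ?_
    have h := div_change (P := P) (z := z) (k := 0) (a := P.target j - P.node z) (c := P.target j)
      (i := P.n + 1 + P.node z) (by simp [node]) (((target_lt j).le).trans le_n_mul_B) (by omega)
    rw [Int.add_mul_ediv_left _ _ (pow_pos D_pos _).ne', ← h,
      ← Int.add_mul_ediv_left _ _ (pow_pos D_pos _).ne', next_of_lt hj, nextBase]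
    congr 1; ring
  · exact hlt (k := 2 * P.n + 1) (div_next_of_le hz he hj le_rfl)

theorem good_next {z : ℤ} {j : ℕ} (hz : P.Good z) (he : P.Edge z j) : P.Good (P.next z j) := by
  have hn := hz.2.2
  have hcl : P.n ≤ j → P.clock z + 1 ≤ P.n * P.B := by
    have := he.2.2
    have := dg_le (P := P) z (2 * P.n + 3)
    simp only [len] at *
    omega
  refine ⟨hz.1.trans (lt_next hz he).le, ?_, by rw [node_next hz he]; exact target_lt j⟩
  have h : P.next z j / P.D ^ (3 * P.n + 4) = z / P.D ^ (3 * P.n + 4) := by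
    rcases Nat.lt_or_ge j P.n with hj | hj
    · rw [next_of_lt hj, div_nextBase he (by omega)]
    · rw [div_next_of_le hz he hj (by omega)]
      exact div_change (c := P.clock z + 1) (by push_cast; rfl) (hcl hj) (by omega)
  have hz1 := hz.2.1
  rw [cast_size] at hz1 ⊢
  rw [Int.ediv_eq_zero_of_lt hz.1 hz1] at h
  have := (Int.ediv_lt_iff_lt_mul (pow_pos (D_pos (P := P)) _)).1 (h.trans_lt Int.one_pos)
  simpa using this

theorem rew_nonneg {g : ℕ} (hg : g ≤ P.n * P.B) : 0 ≤ P.rew g := by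
  have h : (P.b : ℤ) ^ (P.n * P.B) = P.b ^ g * P.b ^ (P.n * P.B - g) := by
    rw [← pow_add]; congr 1; omega
  have h2 : (P.a : ℤ) ^ g ≤ P.b ^ g := pow_le_pow_left₀ (by positivity)
    (by exact_mod_cast P.a_lt_b.le) _
  rw [rew, h]
  nlinarith [pow_nonneg (Int.natCast_nonneg P.b) (P.n * P.B - g)]

theorem gap_le {z : ℤ} (u : ℕ) (hl : 0 < P.len z) : P.gap z u ≤ P.len z := by
  have h1 := Int.emod_lt_of_pos ((P.clock z : ℤ) - P.visit z u) (b := P.len z) (by omega)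
  have h2 := Int.emod_nonneg ((P.clock z : ℤ) - P.visit z u) (b := P.len z) (by omega)
  unfold gap
  omega

theorem weight_nonneg {z : ℤ} {j : ℕ} (he : P.Edge z j) : 0 ≤ P.weight z j := by
  unfold weight
  split_ifs with hj
  · rfl
  · have hl : 0 < P.len z := by have := he.2.2; omega
    exact mul_nonneg (Int.ediv_nonneg (by unfold F; positivity) (by positivity))
      (rew_nonneg ((gap_le _ hl).trans (dg_le _ _)))

variable (P)

/-- The transition system whose paths from a seed to a final state are the lasso-shaped paths of
the graph on which every node occurs at most `B` times. -/
def system : System where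
  size := P.size
  J := 2 * P.n
  seed := P.Seed
  edge := P.Edge
  next := P.next
  weight := P.weight
  final := P.Final
  good := P.Good
  good_range z h := ⟨h.1, h.2.1⟩
  good_seed z h0 h1 hs := ⟨h0, h1, by rw [hs.1]; exact P.v₀.2⟩
  good_next z j hz _ he := good_next hz he
  lt_next z j hz _ he := lt_next hz he
  weight_nonneg z j _ _ he := weight_nonneg he
  not_seed_next z j hz _ he hs := by
    have h := hs.2.2 (P.node z) (by have := hz.2.2; omega)
    have h2 := count_next hz he hz.2.2
    rw [if_pos rfl, count, h] at h2
    omega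

end Problem

/-! ### Times since the last visit -/

section Last

variable {V : Type} {π : ℕ → V}

theorem last_eq_of {t d : ℕ} {v : V} (h1 : 1 ≤ d) (h2 : d ≤ t) (h3 : π (t - d) = v)
    (h4 : ∀ e, 1 ≤ e → e < d → π (t - e) ≠ v) : last π t v = d := by
  refine IsLeast.csInf_eq ⟨Or.inr ⟨t - d, by omega, h3, by omega⟩, ?_⟩
  rintro k (rfl | ⟨j, hj, hv, rfl⟩)
  · omega
  · by_contra hlt
    exact h4 (t - j) (by omega) (by omega) (by rwa [show t - (t - j) = j by omega])

theorem last_le_of_eq {t e : ℕ} {v : V} (h1 : 1 ≤ e) (h2 : e ≤ t) (h : π (t - e) = v) :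
    last π t v ≤ e :=
  Nat.sInf_le (Or.inr ⟨t - e, by omega, h, by omega⟩)

theorem last_mem (π : ℕ → V) (t : ℕ) (v : V) :
    last π t v = t + 1 ∨ (1 ≤ last π t v ∧ last π t v ≤ t ∧ π (t - last π t v) = v) := by
  rcases Nat.sInf_mem (s := insert (t + 1) {k | ∃ j, j < t ∧ π j = v ∧ k = t - j})
    ⟨_, Set.mem_insert _ _⟩ with h | ⟨j, hj, hv, h⟩
  · exact Or.inl h
  · refine Or.inr ?_
    change last π t v = t - j at h
    rw [h]
    exact ⟨by omega, by omega, by rwa [show t - (t - j) = j by omega]⟩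

theorem one_le_last (π : ℕ → V) (t : ℕ) (v : V) : 1 ≤ last π t v := by
  rcases last_mem π t v with h | h <;> omega

theorem last_add_period {p l : ℕ} (hl : 0 < l) (hπ : ∀ i, p ≤ i → π (i + l) = π i) {t : ℕ}
    (ht : p + l ≤ t) : last π (t + l) (π (t + l)) = last π t (π t) := by
  have h0 : π (t - l) = π t := by
    rw [← hπ (t - l) (by omega), show t - l + l = t by omega]
  have hle : last π t (π t) ≤ l := last_le_of_eq hl (by omega) h0
  have h1 := one_le_last π t (π t)
  rw [hπ t (by omega)]
  refine last_eq_of h1 (by omega) ?_ fun e he1 he2 h => ?_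
  · rw [show t + l - last π t (π t) = t - last π t (π t) + l by omega, hπ _ (by omega)]
    rcases last_mem π t (π t) with h | h
    · omega
    · exact h.2.2
  · rw [show t + l - e = t - e + l by omega, hπ _ (by omega)] at h
    have := last_le_of_eq he1 (by omega) h
    omega

end Last

/-! ### Lassos -/

namespace Problem

variable (P : Problem)

/-- The number of visits of `u` before time `i`. -/
def occ (π : ℕ → Fin P.n) (i : ℕ) (u : Fin P.n) : ℕ := ((Finset.range i).filter (π · = u)).card

/-- An infinite path from the initial node that repeats itself with period `l` from time `p` on, and
visits no node more than `B` times before it begins to repeat. -/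
structure IsLasso (π : ℕ → Fin P.n) (p l : ℕ) : Prop where
  zero : π 0 = P.v₀
  adj : ∀ i, P.G.Adj (π i) (π (i + 1))
  len_pos : 0 < l
  period : ∀ i, p ≤ i → π (i + l) = π i
  occ_le : ∀ u, P.occ π (p + l) u ≤ P.B

/-- The time of the last visit to `u` up to time `i`, measured from time `p` on; it is `L₀ u` if
there has been no visit after time `p`. -/
def lastVisit {P : Problem} (π : ℕ → Fin P.n) (p : ℕ) (L₀ : ℕ → ℕ) : ℕ → ℕ → ℕ
  | 0, u => L₀ u
  | i + 1, u => if p ≤ i ∧ (π (i + 1) : ℕ) = u then i + 1 - p else lastVisit π p L₀ i u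

/-- The gap between visits that the transition system computes at time `i`. -/
def lassoGap {P : Problem} (π : ℕ → Fin P.n) (p l : ℕ) (L₀ : ℕ → ℕ) (i : ℕ) : ℕ :=
  ((((i - p : ℕ) : ℤ) - lastVisit π p L₀ i (π (i + 1))) % l).toNat + 1

/-- The reward that the transition system assigns to the step at time `i`. -/
def lassoWeight (π : ℕ → Fin P.n) (p l : ℕ) (L₀ : ℕ → ℕ) (i : ℕ) : ℤ :=
  if i < p then 0 else P.F / l * P.rew (lassoGap π p l L₀ i)

/-- The state `z` describes the situation at time `i` on the lasso `π`. -/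
structure Spec (π : ℕ → Fin P.n) (p l : ℕ) (L₀ : ℕ → ℕ) (i : ℕ) (z : ℤ) : Prop where
  good : P.Good z
  node : P.node z = π i
  visit : ∀ u < P.n, P.visit z u = lastVisit π p L₀ i u
  count : ∀ u : Fin P.n, P.count z u = P.occ π i u
  clock : P.clock z = i - p
  start : P.start z = π p
  len : P.len z = l
  visit₀ : ∀ u < P.n, P.visit₀ z u = L₀ u

variable {P} {π : ℕ → Fin P.n} {p l : ℕ} {L₀ : ℕ → ℕ}

theorem occ_succ (i : ℕ) (u : Fin P.n) :
    P.occ π (i + 1) u = if π i = u then P.occ π i u + 1 else P.occ π i u := by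
  unfold occ
  rw [Finset.range_add_one, Finset.filter_insert]
  split_ifs with h
  · rw [Finset.card_insert_of_notMem (by simp)]
  · rfl

theorem occ_mono {i k : ℕ} (h : i ≤ k) (u : Fin P.n) : P.occ π i u ≤ P.occ π k u :=
  Finset.card_le_card (Finset.filter_subset_filter _ (Finset.range_mono h))

theorem le_of_occ_le {m : ℕ} (h : ∀ u, P.occ π m u ≤ P.B) : m ≤ P.n * P.B := by
  have h1 := Finset.card_eq_sum_card_fiberwise (s := Finset.range m) (t := Finset.univ) (f := π)
    (fun _ _ => Finset.mem_coe.2 (Finset.mem_univ _))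
  rw [Finset.card_range] at h1
  rw [h1]
  refine (Finset.sum_le_card_nsmul _ _ P.B fun u _ => h u).trans ?_
  simp

theorem IsLasso.le (h : P.IsLasso π p l) : p + l ≤ P.n * P.B := le_of_occ_le h.occ_le

theorem lastVisit_of_le {i : ℕ} (h : i ≤ p) (u : ℕ) : lastVisit π p L₀ i u = L₀ u := by
  induction i with
  | zero => rfl
  | succ i ih => rw [lastVisit, if_neg (by omega), ih (by omega)]

theorem lastVisit_spec {i : ℕ} (h : p ≤ i) (u : Fin P.n) :
    (0 < lastVisit π p L₀ i u ∧ lastVisit π p L₀ i u + p ≤ i ∧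
      π (lastVisit π p L₀ i u + p) = u ∧
      ∀ k, lastVisit π p L₀ i u + p < k → k ≤ i → π k ≠ u) ∨
    ((∀ k, p < k → k ≤ i → π k ≠ u) ∧ lastVisit π p L₀ i u = L₀ u) := by
  induction i, h using Nat.le_induction with
  | base => exact Or.inr ⟨fun k h1 h2 => by omega, lastVisit_of_le le_rfl _⟩
  | succ i hi ih =>
    rw [lastVisit]
    split_ifs with h
    · refine Or.inl ⟨by omega, by omega, ?_, fun k h1 h2 => by omega⟩
      rw [show i + 1 - p + p = i + 1 by omega]
      exact Fin.ext h.2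
    · have hne : π (i + 1) ≠ u := fun e => h ⟨hi, by rw [e]⟩
      rcases ih with ⟨h1, h2, h3, h4⟩ | ⟨h1, h2⟩
      · refine Or.inl ⟨h1, by omega, h3, fun k hk1 hk2 => ?_⟩
        rcases Nat.lt_or_ge i k with hk | hk
        · obtain rfl : k = i + 1 := by omega
          exact hne
        · exact h4 k hk1 hk
      · refine Or.inr ⟨fun k hk1 hk2 => ?_, h2⟩
        rcases Nat.lt_or_ge i k with hk | hk
        · obtain rfl : k = i + 1 := by omega
          exact hne
        · exact h1 k hk1 hk

/-- If the assumed last visits agree with those at the end of the cycle, the computed gaps are the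
times since the last visit on the infinite path, one period later. -/
theorem lassoGap_eq_last (hl : 0 < l) (hπ : ∀ i, p ≤ i → π (i + l) = π i)
    (hfix : ∀ u < P.n, lastVisit π p L₀ (p + l) u = L₀ u) {i : ℕ} (h1 : p ≤ i) (h2 : i < p + l) :
    lassoGap π p l L₀ i = last π (i + 1 + l) (π (i + 1 + l)) := by
  set w := π (i + 1) with hw
  rw [hπ (i + 1) (by omega), ← hw]
  symm
  unfold lassoGap
  rw [← hw]
  rcases lastVisit_spec (L₀ := L₀) h1 w with ⟨a1, a2, a3, a4⟩ | ⟨a1, a2⟩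
  · set s := lastVisit π p L₀ i w
    have e : ((((i - p : ℕ) : ℤ) - s) % l).toNat + 1 = i + 1 - (s + p) := by
      rw [Int.emod_eq_of_lt (by omega) (by omega)]; omega
    rw [e]
    refine last_eq_of (by omega) (by omega) ?_ fun e he1 he2 => ?_
    · rw [show i + 1 + l - (i + 1 - (s + p)) = s + p + l by omega, hπ _ (by omega), a3]
    · rw [show i + 1 + l - e = i + 1 - e + l by omega, hπ _ (by omega)]
      exact a4 _ (by omega) (by omega)
  · rw [a2, ← hfix w w.2]
    rcases lastVisit_spec (L₀ := L₀) (Nat.le_add_right p l) w with ⟨b1, b2, b3, b4⟩ | ⟨b1, -⟩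
    · set s := lastVisit π p L₀ (p + l) w
      have hs : i < s + p := by
        by_contra hs
        exact a1 (s + p) (by omega) (by omega) b3
      have e : ((((i - p : ℕ) : ℤ) - s) % l).toNat + 1 = i + 1 + l - (s + p) := by
        rw [← Int.add_emod_right, Int.emod_eq_of_lt (by omega) (by omega)]; omega
      rw [e]
      refine last_eq_of (by omega) (by omega) ?_ fun e he1 he2 => ?_
      · rw [show i + 1 + l - (i + 1 + l - (s + p)) = s + p by omega, b3]
      · rcases Nat.lt_or_ge (p + l) (i + 1 + l - e) with hk | hk
        · rw [show i + 1 + l - e = i + 1 - e + l by omega, hπ _ (by omega)]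
          exact a1 _ (by omega) (by omega)
        · exact b4 _ (by omega) hk
    · exact absurd hw.symm (b1 (i + 1) (by omega) (by omega))

theorem Spec.mem_eq {i : ℕ} {z : ℤ} (h : P.Spec π p l L₀ i z) : P.mem z = P.occ π i (π i) := by
  rw [mem, h.node, h.count]

theorem Spec.next {i j : ℕ} {z : ℤ} (h : P.Spec π p l L₀ i z) (he : P.Edge z j)
    (ht : P.target j = π (i + 1)) (hp : P.n ≤ j ↔ p ≤ i) :
    P.Spec π p l L₀ (i + 1) (P.next z j) where
  good := good_next h.good he
  node := by rw [node_next h.good he, ht]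
  visit u hu := by
    simp only [visit_next h.good he hu, lastVisit, hp, ht, h.visit u hu, h.clock]
    by_cases hc : p ≤ i ∧ (π (i + 1) : ℕ) = u
    · rw [if_pos hc, if_pos hc]; omega
    · rw [if_neg hc, if_neg hc]
  count u := by
    rw [count_next h.good he u.2, occ_succ, h.node, h.count]
    by_cases hc : π i = u
    · rw [if_pos hc, if_pos (by rw [hc])]
    · rw [if_neg hc, if_neg fun e => hc (Fin.ext e.symm)]
  clock := by
    rw [clock_next h.good he, h.clock]
    split_ifs with hc <;> omega
  start := by rw [Problem.start, dg_next_of_lt h.good he (by omega), ← h.start, Problem.start]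
  len := by rw [Problem.len, dg_next_of_lt h.good he (by omega), ← h.len, Problem.len]
  visit₀ u hu := by
    rw [Problem.visit₀, dg_next_of_lt h.good he (by omega), ← h.visit₀ u hu, Problem.visit₀]

theorem Spec.weight {i j : ℕ} {z : ℤ} (h : P.Spec π p l L₀ i z)
    (ht : P.target j = π (i + 1)) (hp : P.n ≤ j ↔ p ≤ i) :
    P.weight z j = P.lassoWeight π p l L₀ i := by
  unfold Problem.weight lassoWeight
  by_cases hj : j < P.n
  · rw [if_pos hj, if_pos (by omega)]
  · rw [if_neg hj, if_neg (by omega), h.len, gap, lassoGap, h.clock, ht, h.visit _ (Fin.is_lt _),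
      h.len]

/-- Every lasso is traced by a run of the transition system. -/
theorem IsLasso.exists_run (h : P.IsLasso π p l) :
    ∃ L₀ : ℕ → ℕ, (∀ u < P.n, lastVisit π p L₀ (p + l) u = L₀ u) ∧
      ∃ z, P.system.Run z (1 + ∑ i ∈ Finset.range (p + l), P.lassoWeight π p l L₀ i) ∧
        P.Final z := by
  set L₀ : ℕ → ℕ := lastVisit π p (fun _ => 0) (p + l) with hL₀
  have hle := h.le
  have hL₀le : ∀ u < P.n, L₀ u ≤ l := by
    intro u hu
    rcases lastVisit_spec (L₀ := fun _ => 0) (π := π) (Nat.le_add_right p l) ⟨u, hu⟩ with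
      ⟨-, h2, -⟩ | ⟨-, h2⟩
    · simp only [hL₀]; simp only at h2; omega
    · simp only [hL₀]; simp only at h2; omega
  have hfix : ∀ u < P.n, lastVisit π p L₀ (p + l) u = L₀ u := by
    intro u hu
    rcases lastVisit_spec (L₀ := L₀) (π := π) (Nat.le_add_right p l) ⟨u, hu⟩ with
      ⟨a1, a2, a3, a4⟩ | ⟨-, h2⟩
    · rcases lastVisit_spec (L₀ := fun _ => 0) (π := π) (Nat.le_add_right p l) ⟨u, hu⟩ with
        ⟨b1, b2, b3, b4⟩ | ⟨b1, -⟩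
      · simp only [← hL₀] at b1 b2 b3 b4 a1 a2 a3 a4
        rcases lt_trichotomy (lastVisit π p L₀ (p + l) u) (L₀ u) with hlt | heq | hlt
        · exact absurd b3 (a4 _ (by omega) b2)
        · exact heq
        · exact absurd a3 (b4 _ (by omega) a2)
      · exact absurd a3 (b1 _ (by simp only at a1 ⊢; omega) a2)
    · exact h2
  refine ⟨L₀, hfix, ?_⟩
  -- The digits of the seed.
  obtain ⟨d, hd⟩ : ∃ d : ℕ → ℕ, ∀ i, d i = if i = 0 then (P.v₀ : ℕ) else
      if i < 1 + P.n then min l (L₀ (i - 1)) else if i < 2 * P.n + 2 then 0 else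
      if i = 2 * P.n + 2 then (π p : ℕ) else if i = 2 * P.n + 3 then l else
      min l (L₀ (i - (2 * P.n + 4))) := ⟨_, fun _ => rfl⟩
  have hdle : ∀ i, d i ≤ P.n * P.B := by
    intro i
    have h1 := P.v₀.2
    have h2 := (π p).2
    have h3 := le_n_mul_B (P := P)
    rw [hd]
    split_ifs <;> omega
  obtain ⟨z₀, hz0, hz1, hz⟩ := exists_digit_eq (D_pos (P := P)) (fun k => (d k : ℤ))
    (fun i => by positivity)
    (fun i => by unfold D; exact_mod_cast Nat.lt_succ_iff.2 (hdle i)) (3 * P.n + 4)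
  rw [← cast_size] at hz1
  have hdg : ∀ i < 3 * P.n + 4, P.dg z₀ i = if i = 0 then (P.v₀ : ℕ) else
      if i < 1 + P.n then min l (L₀ (i - 1)) else if i < 2 * P.n + 2 then 0 else
      if i = 2 * P.n + 2 then (π p : ℕ) else if i = 2 * P.n + 3 then l else
      min l (L₀ (i - (2 * P.n + 4))) := by
    intro i hi
    rw [← hd i]
    have := hz i hi
    rw [← cast_dg] at this
    exact_mod_cast this
  have hnode : P.node z₀ = P.v₀ := by rw [node, hdg _ (by omega), if_pos rfl]
  have hvis : ∀ u < P.n, P.visit z₀ u = L₀ u := by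
    intro u hu
    rw [visit, hdg _ (by omega), if_neg (by omega), if_pos (by omega),
      show 1 + u - 1 = u by omega]
    exact min_eq_right (hL₀le u hu)
  have hvis₀ : ∀ u < P.n, P.visit₀ z₀ u = L₀ u := by
    intro u hu
    rw [visit₀, hdg _ (by omega), if_neg (by omega), if_neg (by omega), if_neg (by omega),
      if_neg (by omega), if_neg (by omega), show 2 * P.n + 4 + u - (2 * P.n + 4) = u by omega]
    exact min_eq_right (hL₀le u hu)
  have hzero : ∀ u < P.n + 1, P.dg z₀ (P.n + 1 + u) = 0 := by
    intro u hu
    rw [hdg _ (by omega), if_neg (by omega), if_neg (by omega), if_pos (by omega)]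
  have hseed : P.Seed z₀ := ⟨hnode, fun u hu => by rw [hvis u hu, hvis₀ u hu], hzero⟩
  have hspec₀ : P.Spec π p l L₀ 0 z₀ :=
    { good := P.system.good_seed z₀ hz0 hz1 hseed
      node := by rw [hnode, h.zero]
      visit := fun u hu => by rw [hvis u hu]; rfl
      count := fun u => by rw [count, hzero u (by omega)]; simp [occ]
      clock := by
        have := hzero P.n (by omega)
        rw [show P.n + 1 + P.n = 2 * P.n + 1 by ring] at this
        rw [clock, this]; omega
      start := by
        rw [start, hdg _ (by omega), if_neg (by omega), if_neg (by omega), if_neg (by omega),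
          if_pos rfl]
      len := by
        rw [len, hdg _ (by omega), if_neg (by omega), if_neg (by omega), if_neg (by omega),
          if_neg (by omega), if_pos rfl]
      visit₀ := hvis₀ }
  have key : ∀ i ≤ p + l, ∃ z,
      P.system.Run z (1 + ∑ k ∈ Finset.range i, P.lassoWeight π p l L₀ k) ∧
        P.Spec π p l L₀ i z := by
    intro i
    induction i with
    | zero => intro _; exact ⟨z₀, by simpa using System.Run.start hz0 hz1 hseed, hspec₀⟩
    | succ i ih =>
      intro hi
      obtain ⟨z, hr, hs⟩ := ih (by omega)
      have hw := (π (i + 1)).2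
      obtain ⟨j, hj, hjt, hjp⟩ : ∃ j, j < 2 * P.n ∧ P.target j = π (i + 1) ∧ (P.n ≤ j ↔ p ≤ i) := by
        rcases Nat.lt_or_ge i p with hip | hip
        · exact ⟨π (i + 1), by omega, Nat.mod_eq_of_lt hw, by omega⟩
        · refine ⟨P.n + π (i + 1), by omega, ?_, by omega⟩
          rw [target, Nat.add_mod_left, Nat.mod_eq_of_lt hw]
      have hmem : P.mem z < P.B := by
        have h1 := h.occ_le (π i)
        have h2 := occ_mono (π := π) (show i + 1 ≤ p + l by omega) (π i)
        rw [occ_succ, if_pos rfl] at h2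
        rw [hs.mem_eq]; omega
      have he : P.Edge z j := by
        refine ⟨?_, hmem, ?_⟩
        · rw [hjt, hs.node]
          exact ⟨(π i).2, hw, h.adj i⟩
        · rw [hs.clock, hs.len, hs.node, hs.start]
          rcases Nat.lt_or_ge i p with hip | hip
          · exact Or.inl ⟨by omega, by omega⟩
          · refine Or.inr ⟨by omega, by omega, ?_⟩
            rcases hip.eq_or_lt with rfl | hlt
            · exact Or.inr rfl
            · exact Or.inl (by omega)
      refine ⟨P.next z j, ?_, hs.next he hjt hjp⟩
      have := System.Run.step hr hj he
      rw [Finset.sum_range_succ, ← add_assoc, ← hs.weight hjt hjp]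
      exact this
  obtain ⟨z, hr, hs⟩ := key (p + l) le_rfl
  refine ⟨z, hr, ?_, ?_, ?_, fun u hu => ?_⟩
  · rw [hs.clock]; have := h.len_pos; omega
  · rw [hs.clock, hs.len]; omega
  · rw [hs.node, hs.start, h.period p le_rfl]
  · rw [hs.visit u hu, hfix u hu, hs.visit₀ u hu]

/-- A chain of states that ends in a final state traces a lasso. -/
theorem exists_lasso {val par : ℤ → ℤ} {z : ℤ} {q : ℕ} {zs : ℕ → ℤ} {js : ℕ → ℕ}
    (hc : P.system.Chain val par z q zs js) (hf : P.Final z) :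
    ∃ (π : ℕ → Fin P.n) (p l : ℕ) (L₀ : ℕ → ℕ), P.IsLasso π p l ∧
      (∀ u < P.n, lastVisit π p L₀ (p + l) u = L₀ u) ∧ q = p + l ∧
      (∀ i ≤ q, P.Spec π p l L₀ i (zs i)) ∧
      val z = 1 + ∑ i ∈ Finset.range (p + l), P.lassoWeight π p l L₀ i := by
  have hgood : ∀ i ≤ q, P.Good (zs i) := hc.good
  have hedge : ∀ i < q, P.Edge (zs i) (js i) := hc.edge
  have hnext : ∀ i < q, zs (i + 1) = P.next (zs i) (js i) := hc.next
  obtain ⟨hs1, hs2, hs3⟩ : P.Seed (zs 0) := hc.seed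
  have hclk0 : P.clock (zs 0) = 0 := by
    have := hs3 P.n (by omega)
    rwa [show P.n + 1 + P.n = 2 * P.n + 1 by ring] at this
  -- The clock stands still up to some time `p`, and runs afterwards.
  have hclk : ∀ i ≤ q, ∃ p ≤ i, ∀ k ≤ i, P.clock (zs k) = k - p := by
    intro i
    induction i with
    | zero => intro _; exact ⟨0, le_rfl, fun k hk => by rw [Nat.le_zero.1 hk, hclk0]⟩
    | succ i ih =>
      intro hi
      obtain ⟨p, hp, h⟩ := ih (by omega)
      have h1 := clock_next (hgood i (by omega)) (hedge i (by omega))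
      rw [← hnext i (by omega)] at h1
      by_cases hj : js i < P.n
      · have h2 : P.clock (zs i) = 0 := by have := (hedge i (by omega)).2.2; omega
        rw [if_pos hj] at h1
        have h3 := h i le_rfl
        refine ⟨i + 1, le_rfl, fun k hk => ?_⟩
        rcases hk.eq_or_lt with rfl | hlt
        · omega
        · have := h k (by omega); omega
      · rw [if_neg hj, h i le_rfl] at h1
        refine ⟨p, by omega, fun k hk => ?_⟩
        rcases hk.eq_or_lt with rfl | hlt
        · omega
        · exact h k (by omega)
  obtain ⟨p, hpq, hclk⟩ := hclk q le_rfl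
  have hconst : ∀ k, 2 * P.n + 1 < k → ∀ i ≤ q, P.dg (zs i) k = P.dg (zs 0) k := by
    intro k hk i
    induction i with
    | zero => intro _; rfl
    | succ i ih =>
      intro hi
      rw [hnext i (by omega), dg_next_of_lt (hgood i (by omega)) (hedge i (by omega)) hk,
        ih (by omega)]
  obtain ⟨hf1, hf2, hf3, hf4⟩ := hf
  rw [← hc.last] at hf1 hf2 hf3 hf4
  set l := P.len (zs 0) with hl
  have hlen : ∀ i ≤ q, P.len (zs i) = l := hconst _ (by omega)
  have hq : q = p + l := by
    have := hclk q le_rfl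
    rw [hlen q le_rfl] at hf2
    omega
  have hlpos : 0 < l := by rw [hlen q le_rfl] at hf2; omega
  have hjs : ∀ i < q, (P.n ≤ js i ↔ p ≤ i) := by
    intro i hi
    have h1 := clock_next (hgood i (by omega)) (hedge i hi)
    rw [← hnext i hi, hclk (i + 1) (by omega), hclk i (by omega)] at h1
    split_ifs at h1 <;> omega
  have hstart : P.node (zs p) = P.start (zs p) := by
    have h1 := (hedge p (by omega)).2.2
    have h2 := hclk p hpq
    have h3 := (hjs p (by omega)).2 le_rfl
    omega
  have hstartq : P.node (zs q) = P.node (zs p) := by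
    rw [hf3, hstart, start, start, hconst _ (by omega) q le_rfl, hconst _ (by omega) p hpq]
  -- The lasso is the sequence of nodes of the chain, folded periodically.
  set nd : ℕ → Fin P.n := fun i => if h : P.node (zs i) < P.n then ⟨_, h⟩ else P.v₀ with hnd
  have hnd' : ∀ i ≤ q, ((nd i : Fin P.n) : ℕ) = P.node (zs i) := by
    intro i hi
    simp only [hnd]
    rw [dif_pos (hgood i hi).2.2]
  set π : ℕ → Fin P.n := fun i => if i < p then nd i else nd (p + (i - p) % l) with hπdef
  have hπ : ∀ i ≤ q, (π i : ℕ) = P.node (zs i) := by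
    intro i hi
    simp only [hπdef]
    split_ifs with h
    · exact hnd' i hi
    · rcases hi.eq_or_lt with rfl | hlt
      · rw [show i - p = l by omega, Nat.mod_self, hnd' _ (by omega), Nat.add_zero, hstartq]
      · rw [Nat.mod_eq_of_lt (by omega), show p + (i - p) = i by omega, hnd' i hi]
  have hper : ∀ i, p ≤ i → π (i + l) = π i := by
    intro i hi
    simp only [hπdef]
    rw [if_neg (by omega), if_neg (by omega), show i + l - p = i - p + l by omega,
      Nat.add_mod_right]
  have htarget : ∀ i < q, P.target (js i) = π (i + 1) := by
    intro i hi
    rw [hπ (i + 1) (by omega), hnext i hi, node_next (hgood i (by omega)) (hedge i hi)]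
  have hadj : ∀ i < q, P.G.Adj (π i) (π (i + 1)) := by
    intro i hi
    obtain ⟨h1, h2, h3⟩ := (hedge i hi).1
    convert h3
    · exact hπ i (by omega)
    · exact (htarget i hi).symm
  have hspec : ∀ i ≤ q, P.Spec π p l (P.visit₀ (zs 0)) i (zs i) := by
    intro i
    induction i with
    | zero =>
      intro _
      exact
        { good := hgood 0 (by omega)
          node := (hπ 0 (by omega)).symm
          visit := fun u hu => by rw [hs2 u hu]; rfl
          count := fun u => by rw [count, hs3 u (by omega)]; simp [occ]
          clock := by rw [hclk0]; omega
          start := by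
            rw [hπ p hpq, hstart, start, start, hconst _ (by omega) p hpq]
          len := rfl
          visit₀ := fun u _ => rfl }
    | succ i ih =>
      intro hi
      rw [hnext i (by omega)]
      exact (ih (by omega)).next (hedge i (by omega)) (htarget i (by omega)) (hjs i (by omega))
  refine ⟨π, p, l, P.visit₀ (zs 0), ⟨?_, fun i => ?_, hlpos, hper, fun u => ?_⟩, fun u hu => ?_, hq,
    hspec, ?_⟩
  · exact Fin.ext ((hπ 0 (by omega)).trans hs1)
  · -- Edges of the periodic part are edges of the first period.
    have hfold : ∀ m, ∀ i < m, P.G.Adj (π i) (π (i + 1)) := by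
      intro m
      induction m with
      | zero => intro i hi; omega
      | succ m ih =>
        intro i hi
        rcases Nat.lt_or_ge i q with h | h
        · exact hadj i h
        · have := ih (i - l) (by omega)
          rw [← hper (i - l) (by omega), ← hper (i - l + 1) (by omega)] at this
          rwa [show i - l + l = i by omega, show i - l + 1 + l = i + 1 by omega] at this
    exact hfold (i + 1) i (by omega)
  · have hle : ∀ i ≤ q, P.occ π i u ≤ P.B := by
      intro i
      induction i with
      | zero => intro _; simp [occ]
      | succ i ih =>
        intro hi
        rw [occ_succ]
        split_ifs with h
        · have h1 := (hspec i (by omega)).mem_eq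
          have h2 := (hedge i (by omega)).2.1
          rw [h] at h1
          omega
        · exact ih (by omega)
    exact hle _ hq.ge
  · have h1 := hspec q le_rfl
    rw [← h1.visit₀ u hu, ← hf4 u hu, h1.visit u hu, hq]
  · rw [← hc.last, hc.val_eq q le_rfl, hq]
    congr 1
    refine Finset.sum_congr rfl fun i hi => ?_
    have hi' := Finset.mem_range.1 hi
    exact (hspec i (by omega)).weight (htarget i (by omega)) (hjs i (by omega))

end Problem

/-! ### Paths generated by strategies with finite memory -/

section Outcome

variable {V M : Type}

theorem outcomePrefix_eq_map (v₀ : V) (σ : List V → V) (t : ℕ) :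
    outcomePrefix v₀ σ t = (List.range (t + 1)).map (outcome v₀ σ) := by
  induction t with
  | zero => simp [outcomePrefix, outcome]
  | succ t ih =>
    rw [List.range_succ, List.map_append, ← ih]
    simp [outcomePrefix, outcome]

/-- A strategy given by a memory structure follows the joint evolution of node and memory. -/
theorem outcome_strategy_eq {𝓜 : MemoryStructure V M} {τ : V → M → V} {v₀ : V} {π : ℕ → V}
    {m : ℕ → M} (hπ : π 0 = v₀) (hm : m 0 = 𝓜.init)
    (hπ' : ∀ i, π (i + 1) = τ (π i) (m i)) (hm' : ∀ i, m (i + 1) = 𝓜.update (m i) (π i)) :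
    outcome v₀ (𝓜.strategy τ v₀) = π := by
  have hrun : ∀ t, 𝓜.run ((List.range t).map π) = m t := by
    intro t
    induction t with
    | zero => simp [MemoryStructure.run, hm]
    | succ t ih =>
      rw [List.range_succ, List.map_append, MemoryStructure.run, List.foldl_append]
      rw [MemoryStructure.run] at ih
      simp [ih, hm']
  have key : ∀ t, ∀ i ≤ t, outcome v₀ (𝓜.strategy τ v₀) i = π i := by
    intro t
    induction t with
    | zero => intro i hi; rw [Nat.le_zero.1 hi, hπ]; rfl
    | succ t ih =>
      intro i hi
      rcases hi.eq_or_lt with rfl | hlt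
      · rw [outcome, outcomePrefix_eq_map, List.map_congr_left (g := π), List.range_succ,
          List.map_append]
        · simp [MemoryStructure.strategy, hrun, hπ']
        · intro k hk
          exact ih k (by have := List.mem_range.1 hk; omega)
      · exact ih i (by omega)
  funext t
  exact key t t le_rfl

theorem exists_evolution (𝓜 : MemoryStructure V M) (τ : V → M → V) (v₀ : V) :
    ∃ x : ℕ → V × M, (fun i => (x i).1) = outcome v₀ (𝓜.strategy τ v₀) ∧ x 0 = (v₀, 𝓜.init) ∧
      ∀ i, x (i + 1) = (τ (x i).1 (x i).2, 𝓜.update (x i).2 (x i).1) := by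
  set f : V × M → V × M := fun y => (τ y.1 y.2, 𝓜.update y.2 y.1) with hf
  refine ⟨fun i => f^[i] (v₀, 𝓜.init), ?_, rfl, fun i => Function.iterate_succ_apply' f i _⟩
  refine (outcome_strategy_eq (m := fun i => (f^[i] (v₀, 𝓜.init)).2) rfl rfl ?_ ?_).symm <;>
  · intro i
    simp only [Function.iterate_succ_apply', hf]

end Outcome

/-- The first repetition in an orbit on a finite set. -/
theorem exists_first_repetition {α : Type} [Finite α] {f : α → α} {x : ℕ → α}
    (hx : ∀ i, x (i + 1) = f (x i)) :
    ∃ p l, 0 < l ∧ (∀ i, p ≤ i → x (i + l) = x i) ∧ Set.InjOn x {i | i < p + l} := by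
  classical
  have hex : ∃ q, ∃ p < q, x p = x q := by
    obtain ⟨i, j, hij, h⟩ := Finite.exists_ne_map_eq_of_infinite x
    rcases lt_or_gt_of_ne hij with h' | h'
    · exact ⟨j, i, h', h⟩
    · exact ⟨i, j, h', h.symm⟩
  obtain ⟨p, hpq, hp⟩ := Nat.find_spec hex
  set q := Nat.find hex with hq
  refine ⟨p, q - p, by omega, fun i hi => ?_, ?_⟩
  · induction i, hi using Nat.le_induction with
    | base => rw [show p + (q - p) = q by omega, hp]
    | succ i hi ih => rw [show i + 1 + (q - p) = i + (q - p) + 1 by omega, hx, ih, ← hx]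
  · have hno : ∀ i j, i < j → j < q → x i ≠ x j := fun i j hij hj h =>
      Nat.find_min hex hj ⟨i, hij, h⟩
    intro i hi j hj h
    simp only [Set.mem_ofPred_eq] at hi hj
    by_contra hne
    rcases lt_or_gt_of_ne hne with h' | h'
    · exact hno i j h' (by omega) h
    · exact hno j i h' (by omega) h.symm

/-- A strategy with memory of size at most `B` generates a lasso. -/
theorem Problem.exists_isLasso_of_isBMemory {P : Problem} {σ : List (Fin P.n) → Fin P.n}
    (hσ : IsBMemory P.G P.v₀ P.B σ) : ∃ p l, P.IsLasso (outcome P.v₀ σ) p l := by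
  classical
  obtain ⟨M, _, 𝓜, τ, hM, hadj, rfl⟩ := hσ
  obtain ⟨x, hx, hx0, hxs⟩ := exists_evolution 𝓜 τ P.v₀
  obtain ⟨p, l, hl, hper, hinj⟩ := exists_first_repetition
    (f := fun y : Fin P.n × M => (τ y.1 y.2, 𝓜.update y.2 y.1)) hxs
  refine ⟨p, l, ?_⟩
  rw [← hx]
  refine ⟨by simp [hx0], fun i => ?_, hl, fun i hi => by simp only [hper i hi], fun u => ?_⟩
  · simp only [hxs i]; exact hadj _ _
  · refine le_trans ?_ hM
    rw [Problem.occ, ← Finset.card_univ]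
    refine Finset.card_le_card_of_injOn (fun i => (x i).2) (fun _ _ => Finset.mem_univ _) ?_
    intro i hi j hj h
    simp only [Finset.coe_filter, Finset.mem_range, Set.mem_ofPred_eq] at hi hj
    exact hinj hi.1 hj.1 (Prod.ext (hi.2.trans hj.2.symm) h)

/-! ### Averages -/

section Average

theorem tendsto_const_div_succ (C : ℝ) :
    Tendsto (fun N : ℕ => C / ((N : ℝ) + 1)) atTop (nhds 0) := by
  simpa [Function.comp_def] using
    (tendsto_const_div_atTop_nhds_zero_nat C).comp (tendsto_add_atTop_nat 1)

theorem tendsto_average_of_abs_sum_sub_le {f : ℕ → ℝ} {m C : ℝ}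
    (h : ∀ N, |∑ t ∈ Finset.range N, f t - N * m| ≤ C) :
    Tendsto (fun N : ℕ => (∑ t ∈ Finset.range (N + 1), f t) / ((N : ℝ) + 1)) atTop (nhds m) := by
  rw [tendsto_iff_norm_sub_tendsto_zero]
  refine squeeze_zero (fun _ => norm_nonneg _) (fun N => ?_) (tendsto_const_div_succ C)
  have hN : (0 : ℝ) < N + 1 := by positivity
  have := h (N + 1)
  push_cast at this
  rw [Real.norm_eq_abs, div_sub' hN.ne', abs_div, abs_of_pos hN]
  gcongr

/-- The averages of an eventually periodic sequence converge to the average over a period. -/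
theorem tendsto_average_of_periodic {f : ℕ → ℝ} {T l : ℕ} (hl : 0 < l)
    (hf : ∀ t, T ≤ t → f (t + l) = f t) :
    Tendsto (fun N : ℕ => (∑ t ∈ Finset.range (N + 1), f t) / ((N : ℝ) + 1)) atTop
      (nhds ((∑ i ∈ Finset.range l, f (T + i)) / l)) := by
  set m := (∑ i ∈ Finset.range l, f (T + i)) / l with hm
  have hl' : (0 : ℝ) < l := by exact_mod_cast hl
  have hwin : ∀ N, T ≤ N → ∑ i ∈ Finset.range l, f (N + i) = l * m := by
    intro N hN
    induction N, hN using Nat.le_induction with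
    | base => rw [hm]; field_simp
    | succ N hN ih =>
      have h1 := Finset.sum_range_succ (fun i => f (N + i)) l
      have h2 := Finset.sum_range_succ' (fun i => f (N + i)) l
      have h3 := hf N hN
      have h4 : ∀ i, f (N + (i + 1)) = f (N + 1 + i) := fun i => by congr 1; omega
      simp only [h4, add_zero] at h2
      linarith
  set S : ℕ → ℝ := fun N => ∑ t ∈ Finset.range N, f t - N * m with hS
  have hper : ∀ N, T ≤ N → S (N + l) = S N := by
    intro N hN
    simp only [hS]
    rw [Finset.sum_range_add, hwin N hN]
    push_cast; ring
  refine tendsto_average_of_abs_sum_sub_le (C := ∑ k ∈ Finset.range (T + l), |S k|) fun N => ?_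
  change |S N| ≤ _
  induction N using Nat.strong_induction_on with
  | _ N ih =>
  rcases Nat.lt_or_ge N (T + l) with h | h
  · exact Finset.single_le_sum (f := fun k => |S k|) (fun _ _ => abs_nonneg _)
      (Finset.mem_range.2 h)
  · rw [show N = N - l + l by omega, hper _ (by omega)]
    exact ih _ (by omega)

end Average

/-! ### Expected rewards -/

section Reward

variable {V Ω : Type} [MeasurableSpace Ω] {μ : Measure Ω} {ξ : ℕ → V → Ω → ℝ} {γ lam : ℝ}

/-- The normalized expected reward collected at time `t`. -/
noncomputable def gain (γ : ℝ) (π : ℕ → V) (t : ℕ) : ℝ := 1 - γ ^ last π t (π t)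

theorem gain_nonneg (h0 : 0 ≤ γ) (h1 : γ ≤ 1) (π : ℕ → V) (t : ℕ) : 0 ≤ gain γ π t :=
  sub_nonneg.2 (pow_le_one₀ h0 h1)

theorem gain_le_one (h0 : 0 ≤ γ) (π : ℕ → V) (t : ℕ) : gain γ π t ≤ 1 := by
  have := pow_nonneg h0 (last π t (π t))
  unfold gain; linarith

theorem sumReward_eq (hξ : HasMeanReward μ ξ lam) (h1 : γ < 1) (N : ℕ) (π : ℕ → V) :
    sumReward μ γ ξ N π = lam / (1 - γ) * ∑ t ∈ Finset.range (N + 1), gain γ π t := by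
  have hint : ∀ t v (j : ℕ), Integrable (fun ω => γ ^ j * ξ t v ω) μ :=
    fun t v j => (hξ t v).1.const_mul _
  unfold sumReward acc
  rw [integral_finsetSum _ fun t _ => integrable_finsetSum _ fun j _ => hint _ _ _, Finset.mul_sum]
  refine Finset.sum_congr rfl fun t _ => ?_
  rw [integral_finsetSum _ fun j _ => hint _ _ _]
  simp only [integral_const_mul, (hξ _ _).2]
  rw [← Finset.sum_mul, geom_sum_eq h1.ne, gain]
  have h2 : γ - 1 ≠ 0 := by linarith
  have h3 : 1 - γ ≠ 0 := by linarith
  field_simp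
  ring

theorem avgReward_eq_liminf (hξ : HasMeanReward μ ξ lam) (h1 : γ < 1) (π : ℕ → V) :
    avgReward μ γ ξ π = liminf (fun N : ℕ =>
      lam / (1 - γ) * ((∑ t ∈ Finset.range (N + 1), gain γ π t) / ((N : ℝ) + 1))) atTop := by
  unfold avgReward
  simp only [sumReward_eq hξ h1, mul_div_assoc]

theorem avgReward_eq_of_tendsto (hξ : HasMeanReward μ ξ lam) (h1 : γ < 1) {π : ℕ → V} {m : ℝ}
    (h : Tendsto (fun N : ℕ => (∑ t ∈ Finset.range (N + 1), gain γ π t) / ((N : ℝ) + 1)) atTop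
      (nhds m)) : avgReward μ γ ξ π = lam / (1 - γ) * m := by
  rw [avgReward_eq_liminf hξ h1]
  exact (h.const_mul _).liminf_eq

theorem avgReward_le_of_sum_le (hξ : HasMeanReward μ ξ lam) (hlam : 0 ≤ lam) (h0 : 0 ≤ γ)
    (h1 : γ < 1) {π : ℕ → V} {m C : ℝ}
    (h : ∀ N, ∑ t ∈ Finset.range N, gain γ π t ≤ N * m + C) :
    avgReward μ γ ξ π ≤ lam / (1 - γ) * m := by
  rw [avgReward_eq_liminf hξ h1]
  have hc : 0 ≤ lam / (1 - γ) := div_nonneg hlam (by linarith)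
  have h0' : Tendsto (fun N : ℕ => m + C / ((N : ℝ) + 1)) atTop (nhds m) := by
    simpa using (tendsto_const_div_succ C).const_add m
  rw [← (h0'.const_mul (lam / (1 - γ))).liminf_eq]
  have hnn : ∀ N : ℕ, 0 ≤ (∑ t ∈ Finset.range (N + 1), gain γ π t) / ((N : ℝ) + 1) := fun N =>
    div_nonneg (Finset.sum_nonneg fun t _ => gain_nonneg h0 h1.le π t) (by positivity)
  refine liminf_le_liminf (Eventually.of_forall fun N => ?_)
    (isBoundedUnder_of ⟨0, fun N => mul_nonneg hc (hnn N)⟩)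
    (h0'.const_mul (lam / (1 - γ))).isBoundedUnder_le.isCoboundedUnder_ge
  refine mul_le_mul_of_nonneg_left ?_ hc
  have hN : (0 : ℝ) < N + 1 := by positivity
  rw [div_le_iff₀ hN, add_mul, div_mul_cancel₀ _ hN.ne']
  have := h (N + 1)
  push_cast at this
  linarith

theorem avgReward_le (hξ : HasMeanReward μ ξ lam) (hlam : 0 ≤ lam) (h0 : 0 ≤ γ)
    (h1 : γ < 1) (π : ℕ → V) : avgReward μ γ ξ π ≤ lam / (1 - γ) := by
  have := avgReward_le_of_sum_le (m := 1) (C := 0) hξ hlam h0 h1 (π := π) fun N => by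
    refine (Finset.sum_le_card_nsmul _ _ 1 fun t _ => gain_le_one h0 π t).trans ?_
    simp
  simpa using this

end Reward

namespace Problem

variable {P : Problem} {π : ℕ → Fin P.n} {p l : ℕ} {L₀ : ℕ → ℕ}

theorem b_pos : 0 < P.b := P.a_pos.trans P.a_lt_b

/-- The scale of the weights of the transition system. -/
noncomputable def scale (P : Problem) : ℝ := (P.n * P.B).factorial * (P.b : ℝ) ^ (P.n * P.B)

theorem scale_pos : 0 < P.scale := by
  have : (0 : ℝ) < P.b := by exact_mod_cast b_pos
  unfold scale; positivity

theorem cast_rew {g : ℕ} (hg : g ≤ P.n * P.B) :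
    (P.rew g : ℝ) = (P.b : ℝ) ^ (P.n * P.B) * (1 - ((P.a : ℝ) / P.b) ^ g) := by
  have hb : (P.b : ℝ) ≠ 0 := by exact_mod_cast b_pos.ne'
  have h : (P.b : ℝ) ^ (P.n * P.B) = (P.b : ℝ) ^ g * (P.b : ℝ) ^ (P.n * P.B - g) := by
    rw [← pow_add]; congr 1; omega
  simp only [rew, Int.cast_sub, Int.cast_mul, Int.cast_pow, Int.cast_natCast]
  rw [h, div_pow]
  field_simp

theorem cast_F_div {k : ℕ} (h0 : 0 < k) (h : k ≤ P.n * P.B) :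
    ((P.F / (k : ℤ) : ℤ) : ℝ) = ((P.n * P.B).factorial : ℝ) / k := by
  obtain ⟨c, hc⟩ := Nat.dvd_factorial h0 h
  have hk : (k : ℝ) ≠ 0 := by exact_mod_cast h0.ne'
  have hk' : (k : ℤ) ≠ 0 := by exact_mod_cast h0.ne'
  rw [F, hc]
  push_cast
  rw [Int.mul_ediv_cancel_left _ hk']
  field_simp
  simp

theorem lassoGap_le (hl : 0 < l) (i : ℕ) : lassoGap π p l L₀ i ≤ l := by
  have h1 := Int.emod_lt_of_pos (((i - p : ℕ) : ℤ) - lastVisit π p L₀ i (π (i + 1))) (b := l)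
    (by omega)
  have h2 := Int.emod_nonneg (((i - p : ℕ) : ℤ) - lastVisit π p L₀ i (π (i + 1))) (b := l)
    (by omega)
  unfold lassoGap
  omega

/-- The average reward of a lasso is given by the weights of the transition system. -/
theorem IsLasso.tendsto_gain (h : P.IsLasso π p l)
    (hfix : ∀ u < P.n, lastVisit π p L₀ (p + l) u = L₀ u) :
    Tendsto (fun N : ℕ => (∑ t ∈ Finset.range (N + 1), gain ((P.a : ℝ) / P.b) π t) / ((N : ℝ) + 1))
      atTop (nhds (((∑ i ∈ Finset.range (p + l), P.lassoWeight π p l L₀ i : ℤ) : ℝ) /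
        P.scale)) := by
  have hle := h.le
  have hper : ∀ t, p + l + 1 ≤ t →
      gain ((P.a : ℝ) / P.b) π (t + l) = gain ((P.a : ℝ) / P.b) π t := by
    intro t ht
    rw [gain, last_add_period h.len_pos h.period (by omega), gain]
  convert tendsto_average_of_periodic h.len_pos hper using 2
  have hl : (0 : ℝ) < l := by exact_mod_cast h.len_pos
  rw [Finset.sum_range_add, Finset.sum_eq_zero (s := Finset.range p), zero_add, Int.cast_sum,
    Finset.sum_div, Finset.sum_div]
  · refine Finset.sum_congr rfl fun i hi => ?_
    have hi' := Finset.mem_range.1 hi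
    rw [lassoWeight, if_neg (by omega), Int.cast_mul, cast_F_div h.len_pos (by omega),
      cast_rew ((lassoGap_le h.len_pos _).trans (by omega)), gain,
      lassoGap_eq_last h.len_pos h.period hfix (by omega) (by omega),
      show p + i + 1 + l = p + l + 1 + i by omega, scale]
    have hb : (P.b : ℝ) ≠ 0 := by exact_mod_cast b_pos.ne'
    have hfac : ((P.n * P.B).factorial : ℝ) ≠ 0 := by positivity
    field_simp
  · intro i hi
    rw [lassoWeight, if_pos (Finset.mem_range.1 hi)]

end Problem

/-! ### Positional strategies maximize the average weight in a finite graph -/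

section Positional

variable {S : Type}

/-- There is a walk with `k` edges from a node to `y`. -/
def WalkTo (E : S → S → Prop) (y : S) : ℕ → S → Prop
  | 0, s => s = y
  | k + 1, s => ∃ s', E s s' ∧ WalkTo E y k s'

theorem walkTo_of_walk {E : S → S → Prop} {x : ℕ → S} {N : ℕ} (hx : ∀ t < N, E (x t) (x (t + 1))) :
    WalkTo E (x N) N (x 0) := by
  induction N generalizing x with
  | zero => rfl
  | succ N ih =>
    exact ⟨x 1, hx 0 (by omega), ih (x := fun t => x (t + 1)) fun t ht => hx (t + 1) (by omega)⟩

/-- A positional strategy that enters a given cycle from every node that can reach it, and follows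
the cycle from then on. -/
theorem exists_positional_cycle {E : S → S → Prop} (hE : ∀ s, ∃ s', E s s') {y : ℕ → S} {l : ℕ}
    (hl : 0 < l) (hy : ∀ t < l, E (y t) (y (t + 1))) (hyl : y l = y 0)
    (hinj : Set.InjOn y {t | t < l}) :
    ∃ f : S → S, (∀ s, E s (f s)) ∧ (∀ t < l, f (y t) = y (t + 1)) ∧
      ∀ k s, WalkTo E (y 0) k s → ∃ T, f^[T] s = y 0 := by
  classical
  have hchoice : ∀ s, ∃ s', E s s' ∧ (∀ t < l, s = y t → s' = y (t + 1)) ∧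
      ((∀ t < l, s ≠ y t) → ∀ h : ∃ k, WalkTo E (y 0) k s,
        ∃ k < Nat.find h, WalkTo E (y 0) k s') := by
    intro s
    by_cases hs : ∃ t < l, s = y t
    · obtain ⟨t, ht, rfl⟩ := hs
      refine ⟨y (t + 1), hy t ht, fun t' ht' h => ?_, fun h => absurd rfl (h t ht)⟩
      rw [hinj (show t ∈ {t | t < l} from ht) (show t' ∈ {t | t < l} from ht') h]
    · push Not at hs
      by_cases h : ∃ k, WalkTo E (y 0) k s
      · have hspec := Nat.find_spec h
        obtain ⟨m, hm⟩ : ∃ m, Nat.find h = m + 1 := by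
          refine ⟨Nat.find h - 1, ?_⟩
          have : Nat.find h ≠ 0 := fun h0 => by
            rw [h0] at hspec
            exact hs 0 hl hspec
          omega
        rw [hm] at hspec
        obtain ⟨s', h1, h2⟩ := hspec
        exact ⟨s', h1, fun t ht h => absurd h (hs t ht), fun _ _ => ⟨m, by omega, h2⟩⟩
      · obtain ⟨s', hs'⟩ := hE s
        exact ⟨s', hs', fun t ht h => absurd h (hs t ht), fun _ h' => absurd h' h⟩
  choose f hf1 hf2 hf3 using hchoice
  refine ⟨f, hf1, fun t ht => hf2 _ t ht rfl, ?_⟩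
  have hcyc : ∀ d t, t + d = l → f^[d] (y t) = y 0 := by
    intro d
    induction d with
    | zero => intro t ht; rw [show t = l by omega, Function.iterate_zero, id, hyl]
    | succ d ih =>
      intro t ht
      rw [Function.iterate_succ_apply, hf2 _ t (by omega) rfl, ih (t + 1) (by omega)]
  intro k
  induction k using Nat.strong_induction_on with
  | _ k ih =>
  intro s hs
  by_cases h : ∃ t < l, s = y t
  · obtain ⟨t, ht, rfl⟩ := h
    exact ⟨l - t, hcyc _ t (by omega)⟩
  · push Not at h
    obtain ⟨m, hm, hw⟩ := hf3 s h ⟨k, hs⟩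
    obtain ⟨T, hT⟩ := ih m (hm.trans_le (Nat.find_min' _ hs)) _ hw
    exact ⟨T + 1, by rwa [Function.iterate_succ_apply]⟩

/-- The average weight along an orbit that enters a cycle. -/
theorem tendsto_average_orbit (w : S → ℝ) {f : S → S} {s₀ : S} {y : ℕ → S} {l T : ℕ} (hl : 0 < l)
    (hf : ∀ t < l, f (y t) = y (t + 1)) (hyl : y l = y 0) (hT : f^[T] s₀ = y 0) :
    Tendsto (fun N : ℕ => (∑ t ∈ Finset.range (N + 1), w (f^[t] s₀)) / ((N : ℝ) + 1)) atTop
      (nhds ((∑ t ∈ Finset.range l, w (y t)) / l)) := by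
  have h1 : ∀ t ≤ l, f^[T + t] s₀ = y t := by
    intro t
    induction t with
    | zero => intro _; exact hT
    | succ t ih =>
      intro ht
      rw [← add_assoc, Function.iterate_succ_apply', ih (by omega), hf t (by omega)]
  have h2 : ∀ t, T ≤ t → f^[t + l] s₀ = f^[t] s₀ := by
    intro t ht
    induction t, ht using Nat.le_induction with
    | base => rw [h1 l le_rfl, hyl, hT]
    | succ t ht ih =>
      rw [show t + 1 + l = t + l + 1 by omega, Function.iterate_succ_apply', ih,
        Function.iterate_succ_apply']
  have := tendsto_average_of_periodic (f := fun t => w (f^[t] s₀)) (T := T) hl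
    (fun t ht => by rw [h2 t ht])
  convert this using 3
  exact Finset.sum_congr rfl fun t ht => by rw [h1 t (Finset.mem_range.1 ht).le]

/-- If no simple cycle that is reachable from `s₀` has an average weight above `ρ`, then the
weight of every walk from `s₀` exceeds `ρ` times its length by at most a constant: remove cycles
from the walk until no node is repeated. -/
theorem sum_weight_le [Fintype S] {E : S → S → Prop} (w : S → ℝ) {s₀ : S} {ρ W : ℝ}
    (hW : ∀ s, |w s| ≤ W)
    (hρ : ∀ (y : ℕ → S) (l : ℕ), 0 < l → (∀ t < l, E (y t) (y (t + 1))) → y l = y 0 →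
      Set.InjOn y {t | t < l} → (∃ k, WalkTo E (y 0) k s₀) →
      ∑ t ∈ Finset.range l, w (y t) ≤ l * ρ) (N : ℕ) :
    ∀ x : ℕ → S, x 0 = s₀ → (∀ t < N, E (x t) (x (t + 1))) →
      ∑ t ∈ Finset.range N, w (x t) ≤ N * ρ + Fintype.card S * (W + |ρ|) := by
  classical
  have hW0 : 0 ≤ W := (abs_nonneg _).trans (hW s₀)
  induction N using Nat.strong_induction_on with
  | _ N ih =>
  intro x hx0 hx
  by_cases hrep : ∃ q, q ≤ N ∧ ∃ p < q, x p = x q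
  · obtain ⟨hqN, p, hpq, hp⟩ := Nat.find_spec hrep
    have hmin : ∀ q' < Nat.find hrep, ∀ p' < q', x p' ≠ x q' := fun q' hq' p' hp' h =>
      Nat.find_min hrep hq' ⟨by omega, p', hp', h⟩
    generalize Nat.find hrep = q at *
    obtain ⟨l, rfl⟩ : ∃ l, q = p + l := ⟨q - p, by omega⟩
    obtain ⟨r, rfl⟩ : ∃ r, N = p + l + r := ⟨N - (p + l), by omega⟩
    have hcyc : ∑ t ∈ Finset.range l, w (x (p + t)) ≤ l * ρ := by
      refine hρ (fun t => x (p + t)) l (by omega) (fun t ht => hx (p + t) (by omega)) hp.symm ?_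
        ⟨p, ?_⟩
      · intro i hi j hj h
        simp only [Set.mem_ofPred_eq] at hi hj h
        by_contra hne
        rcases lt_or_gt_of_ne hne with h' | h'
        · exact hmin (p + j) (by omega) (p + i) (by omega) h
        · exact hmin (p + i) (by omega) (p + j) (by omega) h.symm
      · rw [← hx0]
        exact walkTo_of_walk fun t ht => hx t (by omega)
    set x' : ℕ → S := fun t => if t ≤ p then x t else x (t + l) with hx'
    have hx'p : ∀ t, x' (p + t) = x (p + l + t) := by
      intro t
      simp only [hx']
      split_ifs with h
      · obtain rfl : t = 0 := by omega
        simpa using hp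
      · congr 1; omega
    have hx'lt : ∀ t ≤ p, x' t = x t := fun t ht => by simp [hx', ht]
    have hrest := ih (p + r) (by omega) x' (by rw [hx'lt 0 (by omega), hx0]) (by
      intro t ht
      rcases Nat.lt_or_ge t p with h | h
      · rw [hx'lt t h.le, hx'lt (t + 1) h]
        exact hx t (by omega)
      · obtain ⟨u, rfl⟩ : ∃ u, t = p + u := ⟨t - p, by omega⟩
        rw [hx'p, show p + u + 1 = p + (u + 1) by omega, hx'p]
        exact hx (p + l + u) (by omega))
    rw [Finset.sum_range_add] at hrest
    rw [Finset.sum_range_add, Finset.sum_range_add]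
    simp only [hx'p] at hrest
    rw [Finset.sum_congr rfl fun t ht => by rw [hx'lt t (Finset.mem_range.1 ht).le]] at hrest
    push_cast at hrest ⊢
    linarith
  · push Not at hrep
    have hcard : N + 1 ≤ Fintype.card S := by
      have : Function.Injective fun i : Fin (N + 1) => x i := by
        intro i j h
        by_contra hne
        rcases lt_or_gt_of_ne (fun e => hne (Fin.ext e)) with h' | h'
        · exact hrep j (by omega) i h' h
        · exact hrep i (by omega) j h' h.symm
      simpa using Fintype.card_le_of_injective _ this
    have h1 : ∑ t ∈ Finset.range N, w (x t) ≤ N * W := by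
      simpa using Finset.sum_le_card_nsmul (Finset.range N) (fun t => w (x t)) W
        fun t _ => (le_abs_self _).trans (hW _)
    have h2 : (N : ℝ) ≤ Fintype.card S := by exact_mod_cast (by omega : N ≤ Fintype.card S)
    have h3 : (N : ℝ) * (W + |ρ|) ≤ Fintype.card S * (W + |ρ|) :=
      mul_le_mul_of_nonneg_right h2 (by positivity)
    have h4 : -(N * |ρ|) ≤ N * ρ := by
      rw [← mul_neg]
      exact mul_le_mul_of_nonneg_left (neg_abs_le _) (by positivity)
    linarith

/-- Some positional strategy attains the largest average weight among all walks from `s₀`. -/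
theorem exists_optimal_positional [Fintype S] {E : S → S → Prop} (hE : ∀ s, ∃ s', E s s')
    (w : S → ℝ) (s₀ : S) :
    ∃ (f : S → S) (ρ C : ℝ), (∀ s, E s (f s)) ∧
      Tendsto (fun N : ℕ => (∑ t ∈ Finset.range (N + 1), w (f^[t] s₀)) / ((N : ℝ) + 1)) atTop
        (nhds ρ) ∧
      ∀ x : ℕ → S, x 0 = s₀ → (∀ t, E (x t) (x (t + 1))) →
        ∀ N, ∑ t ∈ Finset.range N, w (x t) ≤ N * ρ + C := by
  classical
  have hlim : ∀ f : S → S, ∃ ρ, Tendsto (fun N : ℕ =>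
      (∑ t ∈ Finset.range (N + 1), w (f^[t] s₀)) / ((N : ℝ) + 1)) atTop (nhds ρ) := by
    intro f
    obtain ⟨p, l, hl, hper, -⟩ := exists_first_repetition (f := f) (x := fun t => f^[t] s₀)
      fun i => Function.iterate_succ_apply' f i s₀
    exact ⟨_, tendsto_average_of_periodic hl fun t ht => congrArg w (hper t ht)⟩
  choose val hval using hlim
  have hne : (Finset.univ.filter fun f : S → S => ∀ s, E s (f s)).Nonempty := by
    choose f hf using hE
    exact ⟨f, by simpa using hf⟩
  obtain ⟨f, hf, hmax⟩ := Finset.exists_max_image _ val hne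
  obtain ⟨W, hW⟩ : ∃ W, ∀ s, |w s| ≤ W :=
    ⟨∑ s, |w s|, fun s => Finset.single_le_sum (f := fun s => |w s|) (fun _ _ => abs_nonneg _)
      (Finset.mem_univ s)⟩
  refine ⟨f, val f, _, by simpa using hf, hval f, fun x hx0 hx N =>
    sum_weight_le (E := E) w hW ?_ N x hx0 fun t _ => hx t⟩
  intro y l hl hy hyl hinj hreach
  obtain ⟨g, hg1, hg2, hg3⟩ := exists_positional_cycle hE hl hy hyl hinj
  obtain ⟨k, hk⟩ := hreach
  obtain ⟨T, hT⟩ := hg3 k s₀ hk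
  have h1 := tendsto_nhds_unique (hval g) (tendsto_average_orbit w hl hg2 hyl hT)
  have h2 := hmax g (by simpa using hg1)
  rw [h1, div_le_iff₀ (by exact_mod_cast hl)] at h2
  linarith

end Positional

/-! ### Strategies that remember the last `K` nodes -/

section Window

variable {V : Type} {K : ℕ}

/-- The memory update that records the node `v` and forgets the oldest one. -/
def shift (v : V) (u : Fin K → V) (k : Fin K) : V :=
  if h : 0 < (k : ℕ) then u ⟨k - 1, by omega⟩ else v

/-- The time since the last visit of the current node `v`, truncated at `K + 1`, as far as it can
be seen from the last `K` nodes `u`. -/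
noncomputable def windowLast (s : V × (Fin K → V)) : ℕ :=
  sInf (insert (K + 1) {d | ∃ k : Fin K, s.2 k = s.1 ∧ d = k + 1})

/-- The last `K` nodes that the path has visited before time `t`, padded with `v₀`. -/
def window (v₀ : V) (π : ℕ → V) (K t : ℕ) (k : Fin K) : V :=
  if (k : ℕ) < t then π (t - 1 - k) else v₀

theorem window_succ (v₀ : V) (π : ℕ → V) (t : ℕ) :
    window v₀ π K (t + 1) = shift (π t) (window v₀ π K t) := by
  funext k
  unfold window shift
  by_cases h0 : 0 < (k : ℕ)
  · rw [dif_pos h0]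
    dsimp only
    by_cases h : (k : ℕ) < t + 1
    · rw [if_pos h, if_pos (by omega)]; congr 1; omega
    · rw [if_neg h, if_neg (by omega)]
  · rw [dif_neg h0, if_pos (by omega)]; congr 1; omega

theorem windowLast_le_last (v₀ : V) (π : ℕ → V) {t : ℕ} (ht : K ≤ t) :
    windowLast (π t, window v₀ π K t) ≤ last π t (π t) := by
  have hK : windowLast (π t, window v₀ π K t) ≤ K + 1 := Nat.sInf_le (Set.mem_insert _ _)
  rcases last_mem π t (π t) with h | ⟨h1, h2, h3⟩
  · omega
  · rcases Nat.lt_or_ge K (last π t (π t)) with h | h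
    · omega
    · refine Nat.sInf_le (Or.inr ⟨⟨last π t (π t) - 1, by omega⟩, ?_, ?_⟩)
      · simp only [window]
        rw [if_pos (by omega)]
        convert h3 using 2
        omega
      · simp only; omega

theorem last_le_windowLast (v₀ : V) (π : ℕ → V) {t : ℕ} (ht : K ≤ t) :
    last π t (π t) ≤ windowLast (π t, window v₀ π K t) ∨
      windowLast (π t, window v₀ π K t) = K + 1 := by
  rcases Nat.sInf_mem (s := insert (K + 1) {d | ∃ k : Fin K,
    (π t, window v₀ π K t).2 k = (π t, window v₀ π K t).1 ∧ d = k + 1})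
    ⟨_, Set.mem_insert _ _⟩ with h | ⟨k, hk, h⟩
  · exact Or.inr h
  · refine Or.inl ?_
    change windowLast (π t, window v₀ π K t) = k + 1 at h
    rw [h]
    refine last_le_of_eq (by omega) (by omega) ?_
    simp only [window] at hk
    rw [if_pos (by omega)] at hk
    rw [← hk]; congr 1; omega

variable {γ : ℝ}

/-- The gain as far as it can be seen from the last `K` nodes. -/
noncomputable def windowGain (γ : ℝ) (s : V × (Fin K → V)) : ℝ := 1 - γ ^ windowLast s

theorem windowGain_nonneg (h0 : 0 ≤ γ) (h1 : γ ≤ 1) (s : V × (Fin K → V)) : 0 ≤ windowGain γ s :=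
  sub_nonneg.2 (pow_le_one₀ h0 h1)

theorem windowGain_le_one (h0 : 0 ≤ γ) (s : V × (Fin K → V)) : windowGain γ s ≤ 1 := by
  have := pow_nonneg h0 (windowLast s)
  unfold windowGain; linarith

theorem sum_gain_le (h0 : 0 ≤ γ) (h1 : γ ≤ 1) (v₀ : V) (π : ℕ → V) (N : ℕ) :
    ∑ t ∈ Finset.range N, gain γ π t ≤
      ∑ t ∈ Finset.range N, windowGain γ (π t, window v₀ π K t) + N * γ ^ (K + 1) + K := by
  induction N with
  | zero => simp
  | succ N ih =>
    rcases Nat.lt_or_ge N K with hN | hN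
    · have h2 : ∑ t ∈ Finset.range (N + 1), gain γ π t ≤ N + 1 := by
        simpa using Finset.sum_le_card_nsmul (Finset.range (N + 1)) (gain γ π) 1
          fun t _ => gain_le_one h0 π t
      have h3 : 0 ≤ ∑ t ∈ Finset.range (N + 1), windowGain γ (π t, window v₀ π K t) :=
        Finset.sum_nonneg fun t _ => windowGain_nonneg h0 h1 _
      have h4 : (N : ℝ) + 1 ≤ K := by exact_mod_cast hN
      have h5 : 0 ≤ ((N + 1 : ℕ) : ℝ) * γ ^ (K + 1) := by positivity
      linarith
    · rw [Finset.sum_range_succ, Finset.sum_range_succ]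
      have key : gain γ π N ≤ windowGain γ (π N, window v₀ π K N) + γ ^ (K + 1) := by
        have hp := pow_nonneg h0 (K + 1)
        unfold gain windowGain
        rcases last_le_windowLast v₀ π hN with h | h
        · have := pow_le_pow_of_le_one h0 h1 h
          linarith
        · have := pow_nonneg h0 (last π N (π N))
          rw [h]; linarith
      push_cast
      linarith

theorem sum_windowGain_le (h0 : 0 ≤ γ) (h1 : γ ≤ 1) (v₀ : V) (π : ℕ → V) (N : ℕ) :
    ∑ t ∈ Finset.range N, windowGain γ (π t, window v₀ π K t) ≤
      ∑ t ∈ Finset.range N, gain γ π t + K := by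
  induction N with
  | zero => simp
  | succ N ih =>
    rcases Nat.lt_or_ge N K with hN | hN
    · have h2 : ∑ t ∈ Finset.range (N + 1), windowGain γ (π t, window v₀ π K t) ≤ N + 1 := by
        simpa using Finset.sum_le_card_nsmul (Finset.range (N + 1))
          (fun t => windowGain γ (π t, window v₀ π K t)) 1 fun t _ => windowGain_le_one h0 _
      have h3 : 0 ≤ ∑ t ∈ Finset.range (N + 1), gain γ π t :=
        Finset.sum_nonneg fun t _ => gain_nonneg h0 h1 _ _
      have h4 : (N : ℝ) + 1 ≤ K := by exact_mod_cast hN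
      linarith
    · rw [Finset.sum_range_succ, Finset.sum_range_succ]
      have key : windowGain γ (π N, window v₀ π K N) ≤ gain γ π N := by
        unfold gain windowGain
        have := pow_le_pow_of_le_one h0 h1 (windowLast_le_last v₀ π hN)
        linarith
      linarith

/-- Remembering the last `K` nodes loses at most the rewards that have decayed for more than `K`
steps. -/
theorem exists_isBMemory_avgReward_ge {n B : ℕ} {G : Digraph (Fin n)} {v₀ : Fin n}
    (hG : ∀ v, ∃ w, G.Adj v w) (hK : n ^ K ≤ B) (h0 : 0 ≤ γ) (h1 : γ < 1) {lam : ℝ}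
    (hlam : 0 ≤ lam) {Ω : Type} [MeasurableSpace Ω] {μ : Measure Ω} {ξ : ℕ → Fin n → Ω → ℝ}
    (hξ : HasMeanReward μ ξ lam) :
    ∃ σ, IsBMemory G v₀ B σ ∧ ∀ π : ℕ → Fin n, IsInfinitePath G π → π 0 = v₀ →
      avgReward μ γ ξ π ≤ avgReward μ γ ξ (outcome v₀ σ) + lam / (1 - γ) * γ ^ (K + 1) := by
  classical
  set E : Fin n × (Fin K → Fin n) → Fin n × (Fin K → Fin n) → Prop := fun s s' =>
    G.Adj s.1 s'.1 ∧ s'.2 = shift s.1 s.2 with hE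
  have htot : ∀ s, ∃ s', E s s' := fun s => by
    obtain ⟨w, hw⟩ := hG s.1
    exact ⟨(w, shift s.1 s.2), hw, rfl⟩
  obtain ⟨f, ρ, C, hf, hlim, hle⟩ := exists_optimal_positional htot (windowGain γ)
    (v₀, fun _ => v₀)
  set 𝓜 : MemoryStructure (Fin n) (Fin K → Fin n) := ⟨fun _ => v₀, fun u v => shift v u⟩ with h𝓜
  have hc : 0 ≤ lam / (1 - γ) := div_nonneg hlam (by linarith)
  refine ⟨𝓜.strategy (fun v u => (f (v, u)).1) v₀, ⟨_, inferInstance, 𝓜, _, ?_,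
    fun v m => (hf (v, m)).1, rfl⟩, fun π hπ hπ0 => ?_⟩
  · simpa using hK
  have hup : avgReward μ γ ξ π ≤ lam / (1 - γ) * (ρ + γ ^ (K + 1)) := by
    refine avgReward_le_of_sum_le (C := C + K) hξ hlam h0 h1 fun N => ?_
    have h2 := hle (fun t => (π t, window v₀ π K t)) (Prod.ext hπ0 (by funext k; simp [window]))
      (fun t => ⟨hπ t, window_succ v₀ π t⟩) N
    have h3 := sum_gain_le (K := K) h0 h1.le v₀ π N
    linarith
  have hlow : lam / (1 - γ) * ρ ≤
      avgReward μ γ ξ (outcome v₀ (𝓜.strategy (fun v u => (f (v, u)).1) v₀)) := by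
    set π' := outcome v₀ (𝓜.strategy (fun v u => (f (v, u)).1) v₀) with hπ'
    have horb : ∀ t, f^[t] (v₀, fun _ => v₀) = (π' t, window v₀ π' K t) := by
      obtain ⟨x, hx, hx0, hxs⟩ := exists_evolution 𝓜 (fun v u => (f (v, u)).1) v₀
      rw [← hπ'] at hx
      have hx1 : ∀ t, (x t).1 = π' t := fun t => congrFun hx t
      have hx2 : ∀ t, x t = (π' t, window v₀ π' K t) := by
        intro t
        induction t with
        | zero => exact Prod.ext (hx1 0) (by rw [hx0]; funext k; simp [window, h𝓜])
        | succ t ih =>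
          refine Prod.ext (hx1 _) ?_
          rw [hxs t, window_succ, ih]
      intro t
      rw [← hx2]
      induction t with
      | zero => rw [hx0]; rfl
      | succ t ih =>
        rw [Function.iterate_succ_apply', ih, hxs]
        exact Prod.ext rfl (hf (x t)).2
    simp only [horb] at hlim
    rw [avgReward_eq_liminf hξ h1]
    have hlim' : Tendsto (fun N : ℕ => lam / (1 - γ) * ((∑ t ∈ Finset.range (N + 1),
        windowGain γ (π' t, window v₀ π' K t)) / ((N : ℝ) + 1) - K / ((N : ℝ) + 1))) atTop
        (nhds (lam / (1 - γ) * ρ)) := by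
      simpa using (hlim.sub (tendsto_const_div_succ K)).const_mul (lam / (1 - γ))
    rw [← hlim'.liminf_eq]
    refine liminf_le_liminf (Eventually.of_forall fun N => ?_) hlim'.isBoundedUnder_ge ?_
    · refine mul_le_mul_of_nonneg_left ?_ hc
      rw [← sub_div]
      have := sum_windowGain_le (K := K) h0 h1.le v₀ π' (N + 1)
      gcongr
      linarith
    · refine IsBoundedUnder.isCoboundedUnder_ge (isBoundedUnder_of ⟨lam / (1 - γ) * 1, fun N =>
        mul_le_mul_of_nonneg_left ?_ hc⟩)
      rw [div_le_one (by positivity)]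
      refine (Finset.sum_le_card_nsmul _ _ 1 fun t _ => gain_le_one h0 π' t).trans ?_
      simp
  linarith [mul_add (lam / (1 - γ)) ρ (γ ^ (K + 1))]

end Window

/-! ### The program -/

instance : Add Exp := ⟨.op .add⟩
instance : Sub Exp := ⟨.op .sub⟩
instance : Mul Exp := ⟨.op .mul⟩
instance : Div Exp := ⟨.op .div⟩
instance : Mod Exp := ⟨.op .mod⟩

/-- The test `e₁ < e₂`. -/
def Exp.less (e₁ e₂ : Exp) : Exp := .op .lt e₁ e₂

/-- The test `e₁ = e₂`. -/
def Exp.equal (e₁ e₂ : Exp) : Exp := .op .eq e₁ e₂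

section Eval

variable (s : State) (e₁ e₂ : Exp)

@[simp] theorem Exp.eval_lit (k : ℤ) : (Exp.lit k).eval s = k := rfl
@[simp] theorem Exp.eval_var (x : ℕ) : (Exp.var x).eval s = s.vars x := rfl
@[simp] theorem Exp.eval_cell (a : ℕ) (i : Exp) : (Exp.cell a i).eval s = s.arrs a (i.eval s) := rfl
@[simp] theorem Exp.eval_add : (e₁ + e₂).eval s = e₁.eval s + e₂.eval s := rfl
@[simp] theorem Exp.eval_sub : (e₁ - e₂).eval s = e₁.eval s - e₂.eval s := rfl
@[simp] theorem Exp.eval_mul : (e₁ * e₂).eval s = e₁.eval s * e₂.eval s := rfl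
@[simp] theorem Exp.eval_div : (e₁ / e₂).eval s = e₁.eval s / e₂.eval s := rfl
@[simp] theorem Exp.eval_mod : (e₁ % e₂).eval s = e₁.eval s % e₂.eval s := rfl
@[simp] theorem Exp.eval_less :
    (e₁.less e₂).eval s = if e₁.eval s < e₂.eval s then 1 else 0 := rfl
@[simp] theorem Exp.eval_equal :
    (e₁.equal e₂).eval s = if e₁.eval s = e₂.eval s then 1 else 0 := rfl

@[simp] theorem State.setVar_vars (x y : ℕ) (k : ℤ) :
    (s.setVar x k).vars y = if y = x then k else s.vars y := by
  simp [State.setVar, Function.update_apply]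

@[simp] theorem State.setVar_arrs (x : ℕ) (k : ℤ) : (s.setVar x k).arrs = s.arrs := rfl

@[simp] theorem State.setCell_vars (a : ℕ) (i k : ℤ) : (s.setCell a i k).vars = s.vars := rfl

@[simp] theorem State.setCell_arrs_self (a : ℕ) (i k : ℤ) :
    (s.setCell a i k).arrs a = Function.update (s.arrs a) i k := by
  simp [State.setCell]

theorem State.setCell_arrs_of_ne {a b : ℕ} (i k : ℤ) (h : b ≠ a) :
    (s.setCell a i k).arrs b = s.arrs b := by
  simp [State.setCell, h]

end Eval

namespace Code

/-! The variables `0`, `1`, `2`, `5`, `6` hold `n`, `B`, the initial node, and the numerator and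
denominator of the decay factor; `7` and `8` hold the base `n * B + 1` and `(n * B)!`. Array `3`
holds the powers of the base and array `4` the scaled rewards. The pass keeps the best weights in
array `5` and the parent pointers in array `6`; variables `13` and `14` hold the best weight of a
final state and that state. Variables `11`, `12` and `16` count loops. -/

def horizon : Exp := .var 0 * .var 1

def power (k : Exp) : Exp := .cell 3 k
def dgE (z k : Exp) : Exp := z / power k % .var 7
def nodeE (z : Exp) : Exp := dgE z (.lit 0)
def visitE (z u : Exp) : Exp := dgE z (.lit 1 + u)
def memE (z : Exp) : Exp := dgE z (.var 0 + .lit 1 + nodeE z)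
def clockE (z : Exp) : Exp := dgE z (.lit 2 * .var 0 + .lit 1)
def startE (z : Exp) : Exp := dgE z (.lit 2 * .var 0 + .lit 2)
def lenE (z : Exp) : Exp := dgE z (.lit 2 * .var 0 + .lit 3)

/-- The test that the last visits of the state `z` are those assumed initially. -/
def closedE (z : Exp) : Exp :=
  (z / power (.lit 1) % power (.var 0)).equal (z / power (.lit 2 * .var 0 + .lit 4))

/-- The test that the state `z` is a seed. -/
def seedE (z : Exp) : Exp :=
  (nodeE z).equal (.var 2) * ((closedE z).equal (.lit 1) *
    (z / power (.var 0 + .lit 1) % power (.var 0 + .lit 1)).equal (.lit 0))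

/-- The test that the state `z` is final. -/
def finalE (z : Exp) : Exp :=
  (Exp.lit 0).less (clockE z) * ((clockE z).equal (lenE z) *
    ((nodeE z).equal (startE z) * (closedE z).equal (.lit 1)))

def targetE (j : Exp) : Exp := j % .var 0

/-- `1` for the choices that are steps on the cycle, and `0` for those before it. -/
def cycleE (j : Exp) : Exp := (Exp.var 0 - .lit 1).less j

/-- The test that choice `j` is permitted in the state `z`. The values of alternatives
are added, since a test succeeds if its value is not `0`. -/
def edgeE (z j : Exp) : Exp :=
  .cell 0 (.var 0 * nodeE z + targetE j) * ((memE z).less (.var 1) *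
    (j.less (.var 0) * (clockE z).equal (.lit 0) +
      cycleE j * ((clockE z).less (lenE z) *
        ((Exp.lit 0).less (clockE z) + (nodeE z).equal (startE z)))))

/-- The state after choice `j` in the state `z`. -/
def nextE (z j : Exp) : Exp :=
  z + power (.var 0 + .lit 1 + nodeE z) + (targetE j - nodeE z) +
    cycleE j * (power (.lit 2 * .var 0 + .lit 1) +
      power (.lit 1 + targetE j) * (clockE z + .lit 1 - visitE z (targetE j)))

/-- The weight of choice `j` in the state `z`. -/
def weightE (z j : Exp) : Exp :=
  cycleE j * (.var 8 / lenE z * .cell 4 ((clockE z - visitE z (targetE j)) % lenE z + .lit 1))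

/-- The largest number of a state, plus one. -/
def sizeE : Exp := power (.lit 3 * .var 0 + .lit 4)

def computeBase : Cmd := .assign 7 (horizon + .lit 1)

def computePowers : Cmd :=
  .seq (.store 3 (.lit 0) (.lit 1))
    (.for 16 (.lit 3 * .var 0 + .lit 4) (.store 3 (.var 16 + .lit 1) (.var 7 * .cell 3 (.var 16))))

/-- The remainder modulo the base changes nothing; it makes the size of the factor evident. -/
def computeFactorial : Cmd :=
  .seq (.assign 8 (.lit 1))
    (.for 16 horizon (.assign 8 ((.var 16 + .lit 1) % .var 7 * .var 8)))

/-- Variable `10` runs through the numbers `a ^ g * b ^ (n * B - g)`. The division is exact until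
the last reward has been stored. -/
def computeRewards : Cmd :=
  .seq (.assign 9 (.lit 1)) <| .seq (.for 16 horizon (.assign 9 (.var 6 * .var 9))) <|
    .seq (.assign 10 (.var 9)) <| .for 16 (horizon + .lit 1) <|
      .seq (.store 4 (.var 16) (.var 9 - .var 10)) (.assign 10 (.var 5 * (.var 10 / .var 6)))

def computeTables : Cmd := .seq computePowers (.seq computeFactorial computeRewards)

/-- Update the entry of the state to which the choice in variable `12` leads from the state in
variable `11`. -/
def relax : Cmd :=
  .ite (edgeE (.var 11) (.var 12))
    (.ite ((Exp.cell 5 (nextE (.var 11) (.var 12))).less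
        (.cell 5 (.var 11) + weightE (.var 11) (.var 12)))
      (.seq (.store 5 (nextE (.var 11) (.var 12)) (.cell 5 (.var 11) + weightE (.var 11) (.var 12)))
        (.store 6 (nextE (.var 11) (.var 12)) (.var 11 + .lit 1)))
      .skip)
    .skip

def updateBest : Cmd :=
  .ite (finalE (.var 11))
    (.ite ((Exp.var 13).less (.cell 5 (.var 11)))
      (.seq (.assign 13 (.cell 5 (.var 11))) (.assign 14 (.var 11))) .skip)
    .skip

/-- The pass through all states in increasing order. An entry `0` in array `5` means that the state
has not been reached; otherwise it holds the weight of a path, plus one. -/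
def pass : Cmd :=
  .for 11 sizeE <| .seq (.ite (seedE (.var 11)) (.store 5 (.var 11) (.lit 1)) .skip) <|
    .ite ((Exp.lit 0).less (.cell 5 (.var 11)))
      (.seq updateBest (.for 12 (.lit 2 * .var 0) relax)) .skip

/-- An arbitrary edge for every node and memory state. -/
def writeDefaults : Cmd :=
  .for 11 horizon <| .for 12 (.var 0) <|
    .ite (.cell 0 (.var 0 * (.var 11 / .var 1) + .var 12)) (.store 2 (.var 11) (.var 12)) .skip

/-- Follow the parent pointers from the best final state, and record the memory state in which the
cycle is entered in variable `15`. -/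
def traceBody : Cmd :=
  .ite ((Exp.lit 0).less (.cell 6 (.var 11)))
    (.seq (.assign 17 (.cell 6 (.var 11) - .lit 1)) <|
      .seq (.store 2 (.var 1 * nodeE (.var 17) + memE (.var 17)) (nodeE (.var 11))) <|
      .seq (.store 1 (.var 0 * memE (.var 17) + nodeE (.var 17)) (memE (.var 11))) <|
      .seq (.ite ((Exp.lit 0).less (clockE (.var 11))) (.assign 15 (memE (.var 17))) .skip) <|
      .assign 11 (.var 17))
    .skip

def trace : Cmd := .seq (.assign 11 (.var 14)) (.for 12 sizeE traceBody)

/-- Close the cycle: the last memory update leads to the memory state at its start. -/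
def patch : Cmd :=
  .seq (.assign 17 (.cell 6 (.var 14) - .lit 1))
    (.store 1 (.var 0 * memE (.var 17) + nodeE (.var 17)) (.var 15))

/-- The computation of the strategy from the tables of powers and rewards. -/
def search : Cmd := .seq pass (.seq writeDefaults (.seq trace patch))

/-- The complete program. The initial memory state of the computed strategy is `0`. -/
def program : Cmd :=
  .seq computeBase (.seq computeTables (.seq search (.assign 0 (.lit 0))))

theorem computeTables_tame : computeTables.tame [0, 1, 2, 5, 6, 7] [0] [7] = true :=
  by decide +kernel

theorem search_tame : search.tame [0, 1, 2, 7, 8] [0, 3, 4] [7] = true := by decide +kernel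

end Code

namespace Problem

open Code

variable (P : Problem)

/-- The input, as far as the computation after the setup uses it. -/
structure Base (s : State) : Prop where
  n : s.vars 0 = P.n
  B : s.vars 1 = P.B
  v₀ : s.vars 2 = P.v₀
  adj : ∀ u w : ℕ, u < P.n → w < P.n → (s.arrs 0 (P.n * u + w) ≠ 0 ↔ P.Adj u w)

/-- The input together with the tables of powers and rewards. -/
structure Env (s : State) : Prop extends P.Base s where
  D : s.vars 7 = P.D
  F : s.vars 8 = P.F
  pow : ∀ k : ℕ, k ≤ 3 * P.n + 4 → s.arrs 3 k = P.D ^ k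
  rew : ∀ g : ℕ, g ≤ P.n * P.B → s.arrs 4 g = P.rew g

/-- The parts of the memory that are still in their initial state before the pass. -/
structure Fresh (s : State) : Prop where
  best : s.vars 13 = 0
  bz : s.vars 14 = 0
  update : s.arrs 1 = fun _ => 0
  val : s.arrs 5 = fun _ => 0
  par : s.arrs 6 = fun _ => 0

variable {P} {s : State}

theorem Base.setVar (h : P.Base s) {x : ℕ} (k : ℤ) (hx : 3 ≤ x) : P.Base (s.setVar x k) := by
  refine ⟨?_, ?_, ?_, h.adj⟩
  · rw [State.setVar_vars, if_neg (by omega), h.n]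
  · rw [State.setVar_vars, if_neg (by omega), h.B]
  · rw [State.setVar_vars, if_neg (by omega), h.v₀]

theorem Base.setCell (h : P.Base s) {a : ℕ} (i k : ℤ) (ha : 0 ≠ a) : P.Base (s.setCell a i k) :=
  ⟨h.n, h.B, h.v₀, by rw [State.setCell_arrs_of_ne _ _ _ ha]; exact h.adj⟩

theorem Env.setVar (h : P.Env s) {x : ℕ} (k : ℤ) (hx : 9 ≤ x) : P.Env (s.setVar x k) :=
  { h.toBase.setVar k (by omega) with
    D := by rw [State.setVar_vars, if_neg (by omega), h.D]
    F := by rw [State.setVar_vars, if_neg (by omega), h.F]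
    pow := h.pow
    rew := h.rew }

theorem Env.setCell (h : P.Env s) {a : ℕ} (i k : ℤ) (h0 : 0 ≠ a) (h3 : 3 ≠ a) (h4 : 4 ≠ a) :
    P.Env (s.setCell a i k) :=
  { h.toBase.setCell i k h0 with
    D := h.D
    F := h.F
    pow := by rw [State.setCell_arrs_of_ne _ _ _ h3]; exact h.pow
    rew := by rw [State.setCell_arrs_of_ne _ _ _ h4]; exact h.rew }

theorem Fresh.setVar (h : Fresh s) {x : ℕ} (k : ℤ) (h1 : 13 ≠ x) (h2 : 14 ≠ x) :
    Fresh (s.setVar x k) :=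
  ⟨by rw [State.setVar_vars, if_neg h1, h.best], by rw [State.setVar_vars, if_neg h2, h.bz],
    h.update, h.val, h.par⟩

theorem Fresh.setCell (h : Fresh s) {a : ℕ} (i k : ℤ) (h1 : 1 ≠ a) (h5 : 5 ≠ a) (h6 : 6 ≠ a) :
    Fresh (s.setCell a i k) :=
  ⟨h.best, h.bz, by rw [State.setCell_arrs_of_ne _ _ _ h1, h.update],
    by rw [State.setCell_arrs_of_ne _ _ _ h5, h.val],
    by rw [State.setCell_arrs_of_ne _ _ _ h6, h.par]⟩

/-! ### Correctness of the setup -/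

theorem three_mul_n_add_four_le_size : 3 * P.n + 4 ≤ P.size := by
  have h1 : 2 ≤ P.n * P.B + 1 := by
    have := n_pos (P := P); have := le_n_mul_B (P := P); omega
  exact ((3 * P.n + 4).lt_two_pow_self.le).trans (Nat.pow_le_pow_left h1 _)

theorem n_mul_B_add_one_le_size : P.n * P.B + 1 ≤ P.size :=
  Nat.le_self_pow (by omega) _

theorem Env.eval_horizon (h : P.Base s) : horizon.eval s = (P.n * P.B : ℕ) := by
  simp [horizon, h.n, h.B]

/-- What is known about the memory before the tables have been computed. -/
structure Setup (P : Problem) (s : State) : Prop extends P.Base s, Fresh s where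
  a : s.vars 5 = P.a
  b : s.vars 6 = P.b
  D : s.vars 7 = P.D

theorem Setup.setVar (h : P.Setup s) {x : ℕ} (k : ℤ) (hx : 8 ≤ x) (h1 : 13 ≠ x) (h2 : 14 ≠ x) :
    P.Setup (s.setVar x k) :=
  { h.toBase.setVar k (by omega), h.toFresh.setVar k h1 h2 with
    a := by rw [State.setVar_vars, if_neg (by omega), h.a]
    b := by rw [State.setVar_vars, if_neg (by omega), h.b]
    D := by rw [State.setVar_vars, if_neg (by omega), h.D] }

theorem Setup.setCell (h : P.Setup s) {a : ℕ} (i k : ℤ) (h0 : 0 ≠ a) (h1 : 1 ≠ a) (h5 : 5 ≠ a)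
    (h6 : 6 ≠ a) : P.Setup (s.setCell a i k) :=
  { h.toBase.setCell i k h0, h.toFresh.setCell i k h1 h5 h6 with
    a := h.a
    b := h.b
    D := h.D }

theorem triple_computePowers :
    Triple P.size P.Setup computePowers
      (fun s => P.Setup s ∧ ∀ k : ℕ, k ≤ 3 * P.n + 4 → s.arrs 3 k = P.D ^ k) := by
  refine Triple.seq (R := fun s => P.Setup s ∧ s.arrs 3 0 = 1) (Triple.store fun s h => ?_) ?_
  · exact ⟨h.setCell _ _ (by decide) (by decide) (by decide) (by decide), by simp⟩
  · refine (Triple.for (N := 3 * P.n + 4)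
      (I := fun i s => s.vars 16 = i ∧ P.Setup s ∧ ∀ k : ℕ, k ≤ i → s.arrs 3 k = P.D ^ k)
      three_mul_n_add_four_le_size (fun i s h => h.1) (fun i s h => ?_) (fun s h => ?_)
      (fun i hi => Triple.store fun s h => ?_)).conseq (fun s h => h) (fun s h => h.2)
    · simp [h.2.1.n]
    · refine ⟨by simp, h.1.setVar _ (by decide) (by decide) (by decide), fun k hk => ?_⟩
      obtain rfl : k = 0 := by omega
      simpa using h.2
    · obtain ⟨h1, h2, h3⟩ := h
      refine ⟨by simpa using h1, by simp, ?_, fun k hk => ?_⟩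
      · exact (h2.setCell _ _ (by decide) (by decide) (by decide) (by decide)).setVar _ (by decide)
          (by decide) (by decide)
      · simp only [State.setVar_arrs, State.setCell_arrs_self, Exp.eval_add, Exp.eval_var, h1,
          Exp.eval_lit, Exp.eval_mul, Exp.eval_cell, h2.D]
        rcases hk.eq_or_lt with rfl | hlt
        · rw [h3 i le_rfl, Nat.cast_succ, Function.update_self, pow_succ, mul_comm]
        · rw [Function.update_of_ne (by omega), h3 k (by omega)]

theorem triple_computeFactorial {Q : State → Prop}
    (hQ : ∀ s x k, 8 ≤ x → Q s → Q (s.setVar x k)) :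
    Triple P.size (fun s => P.Setup s ∧ Q s) computeFactorial
      (fun s => P.Setup s ∧ Q s ∧ s.vars 8 = P.F) := by
  refine Triple.seq (R := fun s => P.Setup s ∧ Q s ∧ s.vars 8 = 1) (Triple.assign fun s h => ?_) ?_
  · exact ⟨h.1.setVar _ (by decide) (by decide) (by decide), hQ _ _ _ (by decide) h.2, by simp⟩
  · refine (Triple.for (N := P.n * P.B)
      (I := fun i s => s.vars 16 = i ∧ P.Setup s ∧ Q s ∧ s.vars 8 = i.factorial)
      (by have := n_mul_B_add_one_le_size (P := P); omega) (fun i s h => h.1)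
      (fun i s h => Env.eval_horizon h.2.1.toBase) (fun s h => ?_)
      (fun i hi => Triple.assign fun s h => ?_)).conseq (fun s h => h)
      (fun s h => ⟨h.2.1, h.2.2.1, h.2.2.2⟩)
    · exact ⟨by simp, h.1.setVar _ (by decide) (by decide) (by decide), hQ _ _ _ (by decide) h.2.1,
        by simpa using h.2.2⟩
    · obtain ⟨h1, h2, h3, h4⟩ := h
      refine ⟨by simpa using h1, by simp, ?_, ?_, ?_⟩
      · exact (h2.setVar _ (by decide) (by decide) (by decide)).setVar _ (by decide) (by decide)
          (by decide)
      · exact hQ _ _ _ (by decide) (hQ _ _ _ (by decide) h3)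
      · have hmod : ((i : ℤ) + 1) % P.D = i + 1 :=
          Int.emod_eq_of_lt (by omega) (by unfold D; exact_mod_cast Nat.succ_lt_succ hi)
        simp [h1, h2.D, h4, hmod, Nat.factorial_succ]

theorem triple_computeRewards {Q : State → Prop}
    (hQ : ∀ s x k, 9 ≤ x → Q s → Q (s.setVar x k)) (hQ' : ∀ s i k, Q s → Q (s.setCell 4 i k)) :
    Triple P.size (fun s => P.Setup s ∧ Q s) computeRewards
      (fun s => P.Setup s ∧ Q s ∧ ∀ g : ℕ, g ≤ P.n * P.B → s.arrs 4 g = P.rew g) := by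
  have hN := n_mul_B_add_one_le_size (P := P)
  refine Triple.seq (R := fun s => P.Setup s ∧ Q s ∧ s.vars 9 = 1) (Triple.assign fun s h => ?_) ?_
  · exact ⟨h.1.setVar _ (by decide) (by decide) (by decide), hQ _ _ _ (by decide) h.2, by simp⟩
  refine Triple.seq (R := fun s => P.Setup s ∧ Q s ∧ s.vars 9 = P.b ^ (P.n * P.B)) ?_ ?_
  · refine (Triple.for (N := P.n * P.B)
      (I := fun i s => s.vars 16 = i ∧ P.Setup s ∧ Q s ∧ s.vars 9 = P.b ^ i)
      (by omega) (fun i s h => h.1)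
      (fun i s h => Env.eval_horizon h.2.1.toBase) (fun s h => ?_)
      (fun i hi => Triple.assign fun s h => ?_)).conseq (fun s h => h) (fun s h => h.2)
    · exact ⟨by simp, h.1.setVar _ (by decide) (by decide) (by decide), hQ _ _ _ (by decide) h.2.1,
        by simpa using h.2.2⟩
    · obtain ⟨h1, h2, h3, h4⟩ := h
      refine ⟨by simpa using h1, by simp, ?_, ?_, ?_⟩
      · exact (h2.setVar _ (by decide) (by decide) (by decide)).setVar _ (by decide) (by decide)
          (by decide)
      · exact hQ _ _ _ (by decide) (hQ _ _ _ (by decide) h3)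
      · simp [h2.b, h4, pow_succ, mul_comm]
  refine Triple.seq (R := fun s => P.Setup s ∧ Q s ∧ s.vars 9 = P.b ^ (P.n * P.B) ∧
    s.vars 10 = P.b ^ (P.n * P.B)) (Triple.assign fun s h => ?_) ?_
  · exact ⟨h.1.setVar _ (by decide) (by decide) (by decide), hQ _ _ _ (by decide) h.2.1,
      by simpa using h.2.2, by simpa using h.2.2⟩
  refine (Triple.for (N := P.n * P.B + 1)
    (I := fun i s => s.vars 16 = i ∧ P.Setup s ∧ Q s ∧ s.vars 9 = P.b ^ (P.n * P.B) ∧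
      (i ≤ P.n * P.B → s.vars 10 = P.a ^ i * P.b ^ (P.n * P.B - i)) ∧
      ∀ g : ℕ, g < i → s.arrs 4 g = P.rew g)
    hN (fun i s h => h.1)
    (fun i s h => ?_) (fun s h => ?_)
    (fun i hi => Triple.seq (R := fun s => s.vars 16 = i ∧ P.Setup s ∧ Q s ∧
      s.vars 9 = P.b ^ (P.n * P.B) ∧ s.vars 10 = P.a ^ i * P.b ^ (P.n * P.B - i) ∧
      ∀ g : ℕ, g < i + 1 → s.arrs 4 g = P.rew g) (Triple.store fun s h => ?_)
      (Triple.assign fun s h => ?_))).conseq (fun s h => h)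
      (fun s h => ⟨h.2.1, h.2.2.1, fun g hg => h.2.2.2.2.2 g (by omega)⟩)
  · rw [Exp.eval_add, Env.eval_horizon h.2.1.toBase]; simp
  · refine ⟨by simp, h.1.setVar _ (by decide) (by decide) (by decide), hQ _ _ _ (by decide) h.2.1,
      by simpa using h.2.2.1, fun _ => by simpa using h.2.2.2, fun g hg => by omega⟩
  · obtain ⟨h1, h2, h3, h4, h5, h6⟩ := h
    refine ⟨by simpa using h1, h2.setCell _ _ (by decide) (by decide) (by decide) (by decide),
      hQ' _ _ _ h3, by simpa using h4, by simpa using h5 (by omega), fun g hg => ?_⟩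
    simp only [State.setCell_arrs_self, Exp.eval_var, h1, Exp.eval_sub, h4, h5 (by omega)]
    rcases (Nat.lt_succ_iff.1 hg).eq_or_lt with rfl | hlt
    · rw [Function.update_self, Problem.rew]
    · rw [Function.update_of_ne (by exact_mod_cast hlt.ne), h6 g hlt]
  · obtain ⟨h1, h2, h3, h4, h5, h6⟩ := h
    refine ⟨by simpa using h1, by simp, ?_, ?_, by simpa using h4, fun hi' => ?_, h6⟩
    · exact (h2.setVar _ (by decide) (by decide) (by decide)).setVar _ (by decide) (by decide)
        (by decide)
    · exact hQ _ _ _ (by decide) (hQ _ _ _ (by decide) h3)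
    · have hb : (P.b : ℤ) ≠ 0 := by exact_mod_cast b_pos.ne'
      have e : (P.a : ℤ) ^ i * P.b ^ (P.n * P.B - i) / P.b =
          P.a ^ i * P.b ^ (P.n * P.B - (i + 1)) := by
        rw [show P.n * P.B - i = P.n * P.B - (i + 1) + 1 by omega, pow_succ, ← mul_assoc,
          Int.mul_ediv_cancel _ hb]
      simp only [State.setVar_vars, Exp.eval_mul, Exp.eval_var, Exp.eval_div, h2.a, h2.b, h5, e]
      rw [if_neg (by decide), if_pos trivial, pow_succ]
      ring

theorem triple_computeTables :
    Triple P.size P.Setup computeTables (fun s => P.Env s ∧ Fresh s) := by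
  refine triple_computePowers.seq (((triple_computeFactorial fun s x k _ h => h).seq
    (Q := fun s => P.Setup s ∧ ((∀ k : ℕ, k ≤ 3 * P.n + 4 → s.arrs 3 k = P.D ^ k) ∧
      s.vars 8 = P.F) ∧ ∀ g : ℕ, g ≤ P.n * P.B → s.arrs 4 g = P.rew g) ?_).conseq (fun s h => h)
    fun s h => ⟨{ h.1 with F := h.2.1.2, pow := h.2.1.1, rew := h.2.2 }, h.1.toFresh⟩)
  refine triple_computeRewards (fun s x k hx h => ⟨h.1, ?_⟩) (fun s i k h => ⟨?_, h.2⟩)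
  · rw [State.setVar_vars, if_neg (by omega), h.2]
  · rw [State.setCell_arrs_of_ne _ _ _ (by decide)]; exact h.1

end Problem

namespace Problem

open Code

/-! ### Evaluation of the expressions of the program -/

section

variable {P : Problem} {s : State} {e f : Exp} {z : ℤ}

theorem Env.eval_power (h : P.Env s) {k : ℕ} (hf : f.eval s = k) (hk : k ≤ 3 * P.n + 4) :
    (power f).eval s = P.D ^ k := by
  rw [power, Exp.eval_cell, hf, h.pow k hk]

theorem Env.eval_dg (h : P.Env s) (he : e.eval s = z) {k : ℕ} (hf : f.eval s = k)
    (hk : k ≤ 3 * P.n + 4) : (dgE e f).eval s = P.dg z k := by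
  rw [dgE, Exp.eval_mod, Exp.eval_div, h.eval_power hf hk, he, Exp.eval_var, h.D, cast_dg, digit]

theorem Env.eval_node (h : P.Env s) (he : e.eval s = z) : (nodeE e).eval s = P.node z :=
  h.eval_dg he (k := 0) (by simp) (by omega)

theorem Env.eval_visit (h : P.Env s) (he : e.eval s = z) {u : ℕ} (hf : f.eval s = u)
    (hu : u < P.n) : (visitE e f).eval s = P.visit z u :=
  h.eval_dg he (k := 1 + u) (by simp [hf]) (by omega)

theorem Env.eval_mem (h : P.Env s) (he : e.eval s = z) (hz : P.node z < P.n) :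
    (memE e).eval s = P.mem z :=
  h.eval_dg he (k := P.n + 1 + P.node z) (by simp [h.eval_node he, h.n]) (by omega)

theorem Env.eval_clock (h : P.Env s) (he : e.eval s = z) : (clockE e).eval s = P.clock z :=
  h.eval_dg he (k := 2 * P.n + 1) (by simp [h.n]) (by omega)

theorem Env.eval_start (h : P.Env s) (he : e.eval s = z) : (startE e).eval s = P.start z :=
  h.eval_dg he (k := 2 * P.n + 2) (by simp [h.n]) (by omega)

theorem Env.eval_len (h : P.Env s) (he : e.eval s = z) : (lenE e).eval s = P.len z :=
  h.eval_dg he (k := 2 * P.n + 3) (by simp [h.n]) (by have := n_pos (P := P); omega)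

theorem Env.eval_size (h : P.Base s) (h3 : ∀ k : ℕ, k ≤ 3 * P.n + 4 → s.arrs 3 k = P.D ^ k) :
    sizeE.eval s = P.size := by
  have := h3 (3 * P.n + 4) le_rfl
  push_cast at this
  rw [sizeE, power, cast_size]
  simp [h.n, this]

theorem Env.eval_closed (h : P.Env s) (he : e.eval s = z) (h0 : 0 ≤ z) (h1 : z < P.size) :
    (closedE e).eval s = if ∀ u < P.n, P.visit z u = P.visit₀ z u then 1 else 0 := by
  have hiff : z / P.D ^ 1 % P.D ^ P.n = z / P.D ^ (2 * P.n + 4) ↔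
      ∀ u < P.n, P.visit z u = P.visit₀ z u := by
    rw [block_eq_iff D_pos h0 (by rwa [show 2 * P.n + 4 + P.n = 3 * P.n + 4 by ring, ← cast_size])]
    refine forall₂_congr fun u _ => ?_
    rw [visit, visit₀, ← cast_dg, ← cast_dg, Nat.cast_inj]
  rw [closedE, Exp.eval_equal, Exp.eval_mod, Exp.eval_div, Exp.eval_div, he,
    h.eval_power (k := 1) (by simp) (by omega), h.eval_power (k := P.n) (by simp [h.n]) (by omega),
    h.eval_power (k := 2 * P.n + 4) (by simp [h.n]) (by omega)]
  exact if_congr hiff rfl rfl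

theorem Env.eval_seed (h : P.Env s) (he : e.eval s = z) (h0 : 0 ≤ z) (h1 : z < P.size) :
    (seedE e).eval s ≠ 0 ↔ P.Seed z := by
  have hiff : z / P.D ^ (P.n + 1) % P.D ^ (P.n + 1) = 0 ↔
      ∀ u < P.n + 1, P.dg z (P.n + 1 + u) = 0 := by
    rw [block_eq_zero_iff D_pos]
    refine forall₂_congr fun u _ => ?_
    rw [← cast_dg, Nat.cast_eq_zero]
  have hp := h.eval_power (f := .var 0 + .lit 1) (k := P.n + 1) (by simp [h.n]) (by omega)
  rw [seedE, Exp.eval_mul, Exp.eval_mul, Exp.eval_equal, Exp.eval_equal, Exp.eval_equal,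
    h.eval_closed he h0 h1, h.eval_node he, Exp.eval_var, h.v₀, Exp.eval_mod, Exp.eval_div, hp, he,
    Exp.eval_lit, Exp.eval_lit, Seed, ← hiff]
  simp only [ne_eq, mul_eq_zero, ite_eq_right_iff, ite_eq_left_iff,
    one_ne_zero, zero_ne_one, imp_false, not_or, not_not,
    Nat.cast_inj]

theorem Env.eval_final (h : P.Env s) (he : e.eval s = z) (h0 : 0 ≤ z) (h1 : z < P.size) :
    (finalE e).eval s ≠ 0 ↔ P.Final z := by
  rw [finalE, Exp.eval_mul, Exp.eval_mul, Exp.eval_mul, Exp.eval_less, Exp.eval_equal,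
    Exp.eval_equal, Exp.eval_equal, h.eval_closed he h0 h1, h.eval_node he, h.eval_start he,
    h.eval_clock he, h.eval_len he, Exp.eval_lit, Exp.eval_lit, Final]
  simp only [ne_eq, mul_eq_zero, ite_eq_right_iff, ite_eq_left_iff,
    one_ne_zero, zero_ne_one, imp_false, not_or, not_not,
    Nat.cast_inj, Nat.cast_pos]

variable {j : ℕ}

theorem Env.eval_target (h : P.Base s) (hf : f.eval s = j) :
    (targetE f).eval s = P.target j := by
  simp [targetE, hf, h.n, target]

theorem Env.eval_cycle (h : P.Base s) (hf : f.eval s = j) :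
    (cycleE f).eval s = if j < P.n then 0 else 1 := by
  rw [cycleE, Exp.eval_less, Exp.eval_sub, Exp.eval_var, h.n, hf, Exp.eval_lit]
  split_ifs <;> first | rfl | omega

theorem Env.eval_edge (h : P.Env s) (he : e.eval s = z) (hf : f.eval s = j)
    (hz : P.node z < P.n) : (edgeE e f).eval s ≠ 0 ↔ P.Edge z j := by
  have hadj := h.adj (P.node z) (P.target j) hz (target_lt j)
  rw [edgeE, Exp.eval_mul, Exp.eval_mul, Exp.eval_cell, Exp.eval_add, Exp.eval_mul, Exp.eval_var,
    h.n, h.eval_node he, Env.eval_target h.toBase hf, Exp.eval_less, h.eval_mem he hz, Exp.eval_var,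
    h.B, mul_ne_zero_iff, hadj, Edge]
  refine and_congr_right fun _ => ?_
  rw [Exp.eval_add, Exp.eval_mul, Exp.eval_mul, Exp.eval_mul, Exp.eval_add, Exp.eval_less,
    Exp.eval_equal, Exp.eval_less, Exp.eval_less, Exp.eval_equal, Env.eval_cycle h.toBase hf,
    h.eval_clock he, h.eval_len he, h.eval_node he, h.eval_start he, hf, Exp.eval_var, h.n,
    Exp.eval_lit]
  simp only [Nat.cast_lt, Nat.cast_inj, Nat.cast_eq_zero, Nat.cast_pos]
  by_cases h1 : P.mem z < P.B <;> by_cases h2 : j < P.n <;> by_cases h3 : P.clock z = 0 <;>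
    by_cases h4 : P.clock z < P.len z <;> by_cases h5 : P.node z = P.start z <;>
    simp [h1, h2, h3, h4, h5, Nat.pos_iff_ne_zero] <;> omega

theorem Env.eval_next (h : P.Env s) (he : e.eval s = z) (hf : f.eval s = j)
    (hz : P.node z < P.n) : (nextE e f).eval s = P.next z j := by
  have hw := target_lt (P := P) j
  rw [nextE, Exp.eval_add, Exp.eval_add, Exp.eval_add, Exp.eval_mul, Exp.eval_sub, Exp.eval_add,
    Exp.eval_mul, Exp.eval_sub, Exp.eval_add, Exp.eval_lit, he,
    h.eval_power (k := P.n + 1 + P.node z) (by simp [h.n, h.eval_node he]) (by omega),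
    h.eval_power (k := 2 * P.n + 1) (by simp [h.n]) (by omega),
    h.eval_power (k := 1 + P.target j) (by simp [Env.eval_target h.toBase hf]) (by omega),
    Env.eval_target h.toBase hf, h.eval_node he, Env.eval_cycle h.toBase hf, h.eval_clock he,
    h.eval_visit he (Env.eval_target h.toBase hf) hw, Problem.next]
  split_ifs <;> ring

theorem Env.eval_weight (h : P.Env s) (he : e.eval s = z) (hf : f.eval s = j)
    (hE : P.Edge z j) : (weightE e f).eval s = P.weight z j := by
  have hw := target_lt (P := P) j
  rw [weightE, Exp.eval_mul, Exp.eval_mul, Exp.eval_div, Exp.eval_cell, Exp.eval_add, Exp.eval_mod,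
    Exp.eval_sub, Exp.eval_lit, Env.eval_cycle h.toBase hf, h.eval_clock he, h.eval_len he,
    h.eval_visit he (Env.eval_target h.toBase hf) hw, Exp.eval_var, h.F, Problem.weight]
  split_ifs with hj
  · simp
  · have hl : 0 < P.len z := by have := hE.2.2; omega
    have hgap : ((P.clock z : ℤ) - P.visit z (P.target j)) % P.len z + 1 =
        (P.gap z (P.target j) : ℤ) := by
      rw [gap]
      push_cast
      rw [Int.toNat_of_nonneg (Int.emod_nonneg _ (by omega))]
    rw [hgap, h.rew _ ((gap_le _ hl).trans (dg_le _ _)), one_mul]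

end

/-! ### Correctness of the pass -/

variable {P : Problem}

/-- The memory during the relaxation of the edges from `z`. -/
structure Relaxing (P : Problem) (z : ℤ) (j : ℕ) (s : State) : Prop where
  env : P.Env s
  update : s.arrs 1 = fun _ => 0
  cur : s.vars 11 = z
  inv : P.system.Inv (s.arrs 5) (s.arrs 6) (z + 1) z j
  best : P.system.Best (s.arrs 5) (z + 1) (s.vars 13) (s.vars 14)
  pos : 0 < s.arrs 5 z

/-- The memory between the visits of two states in the pass. -/
structure Passing (P : Problem) (z : ℤ) (s : State) : Prop where
  env : P.Env s
  update : s.arrs 1 = fun _ => 0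
  inv : P.system.Inv (s.arrs 5) (s.arrs 6) z z 0
  best : P.system.Best (s.arrs 5) z (s.vars 13) (s.vars 14)

theorem Passing.setVar {z : ℤ} {s : State} (h : P.Passing z s) {x : ℕ} (k : ℤ) (hx : 9 ≤ x)
    (h1 : 13 ≠ x) (h2 : 14 ≠ x) : P.Passing z (s.setVar x k) where
  env := h.env.setVar k hx
  update := h.update
  inv := h.inv
  best := by
    rw [State.setVar_vars, if_neg h1, State.setVar_vars, if_neg h2]
    exact h.best

theorem Relaxing.setVar {z : ℤ} {j : ℕ} {s : State} (h : P.Relaxing z j s) {x : ℕ} (k : ℤ)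
    (hx : 9 ≤ x) (h0 : 11 ≠ x) (h1 : 13 ≠ x) (h2 : 14 ≠ x) : P.Relaxing z j (s.setVar x k) where
  env := h.env.setVar k hx
  update := h.update
  cur := by rw [State.setVar_vars, if_neg h0, h.cur]
  inv := h.inv
  best := by
    rw [State.setVar_vars, if_neg h1, State.setVar_vars, if_neg h2]
    exact h.best
  pos := h.pos

theorem triple_relax (T : ℕ) (z : ℤ) {j : ℕ} (hj : j < 2 * P.n) :
    Triple T (fun s => s.vars 12 = j ∧ P.Relaxing z j s) relax
      (fun s => s.vars 12 = j ∧ P.Relaxing z (j + 1) s) := by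
  have hedge : ∀ s : State, s.vars 12 = j → P.Relaxing z j s →
      ((edgeE (.var 11) (.var 12)).eval s ≠ 0 ↔ P.Edge z j) := fun s h1 h =>
    h.env.eval_edge (e := .var 11) (f := .var 12) h.cur h1 (h.inv.good z h.pos).2.2
  refine Triple.ite (Triple.ite (Triple.seq (R := fun s => s.vars 12 = j ∧ P.Env s ∧
    s.arrs 1 = (fun _ => 0) ∧ s.vars 11 = z ∧ P.node z < P.n ∧ 0 < s.arrs 5 z ∧
    P.system.Inv (s.arrs 5) (Function.update (s.arrs 6) (P.next z j) (z + 1)) (z + 1) z (j + 1) ∧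
    P.system.Best (s.arrs 5) (z + 1) (s.vars 13) (s.vars 14))
    (Triple.store ?_) (Triple.store ?_)) (Triple.skip ?_)) (Triple.skip ?_)
  · rintro s ⟨⟨⟨h1, h⟩, h2⟩, h3⟩
    have hg := h.inv.good z h.pos
    have hE := (hedge s h1 h).1 h2
    have hn := h.env.eval_next (e := .var 11) (f := .var 12) h.cur h1 hg.2.2
    have hw := h.env.eval_weight (e := .var 11) (f := .var 12) h.cur h1 hE
    rw [Exp.eval_less, Exp.eval_add, Exp.eval_cell, Exp.eval_cell, hn, hw, Exp.eval_var,
      h.cur] at h3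
    have hlt : s.arrs 5 (P.next z j) < s.arrs 5 z + P.weight z j := by
      by_contra hc; exact h3 (if_neg hc)
    have hzn : z < P.next z j := lt_next hg hE
    have hinv := h.inv.relax_step hj h.pos hE hlt
    rw [hn, Exp.eval_add, Exp.eval_cell, hw, Exp.eval_var, h.cur]
    refine ⟨by simpa using h1, h.env.setCell _ _ (by decide) (by decide) (by decide), ?_, h.cur,
      hg.2.2, ?_, ?_, ?_⟩
    · rw [State.setCell_arrs_of_ne _ _ _ (by decide), h.update]
    · rw [State.setCell_arrs_self, Function.update_of_ne hzn.ne]; exact h.pos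
    · rw [State.setCell_arrs_self, State.setCell_arrs_of_ne _ _ _ (by decide)]; exact hinv
    · rw [State.setCell_arrs_self]
      exact h.best.congr fun y hy => Function.update_of_ne (by omega) _ _
  · rintro s ⟨h1, h2, h3, h4, h5, h6, h7, h8⟩
    have hn := h2.eval_next (e := .var 11) (f := .var 12) h4 h1 h5
    rw [hn, Exp.eval_add, Exp.eval_lit, Exp.eval_var, h4]
    refine ⟨by simpa using h1, h2.setCell _ _ (by decide) (by decide) (by decide),
      ?_, h4, ?_, ?_, ?_⟩
    · rw [State.setCell_arrs_of_ne _ _ _ (by decide), h3]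
    · rw [State.setCell_arrs_self, State.setCell_arrs_of_ne _ _ _ (by decide)]; exact h7
    · rw [State.setCell_arrs_of_ne _ _ _ (by decide)]; exact h8
    · rw [State.setCell_arrs_of_ne _ _ _ (by decide)]; exact h6
  · rintro s ⟨⟨⟨h1, h⟩, h2⟩, h3⟩
    have hg := h.inv.good z h.pos
    have hE := (hedge s h1 h).1 h2
    have hn := h.env.eval_next (e := .var 11) (f := .var 12) h.cur h1 hg.2.2
    have hw := h.env.eval_weight (e := .var 11) (f := .var 12) h.cur h1 hE
    rw [Exp.eval_less, Exp.eval_add, Exp.eval_cell, Exp.eval_cell, hn, hw, Exp.eval_var,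
      h.cur] at h3
    have hge : s.arrs 5 z + P.weight z j ≤ s.arrs 5 (P.next z j) := by
      by_contra hc; rw [if_pos (not_le.1 hc)] at h3; exact one_ne_zero h3
    exact ⟨h1, { h with inv := h.inv.no_relax_step fun _ _ => hge }⟩
  · rintro s ⟨⟨h1, h⟩, h2⟩
    exact ⟨h1, { h with
      inv := h.inv.no_relax_step fun _ hE => absurd h2 ((hedge s h1 h).2 hE) }⟩

theorem triple_updateBest (T : ℕ) {z : ℤ} (h0 : 0 ≤ z) (h1 : z < P.size) :
    Triple T (fun s => s.vars 11 = z ∧ P.Env s ∧ s.arrs 1 = (fun _ => 0) ∧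
        P.system.Inv (s.arrs 5) (s.arrs 6) (z + 1) z 0 ∧
        P.system.Best (s.arrs 5) z (s.vars 13) (s.vars 14) ∧ 0 < s.arrs 5 z)
      updateBest (P.Relaxing z 0) := by
  refine Triple.ite (Triple.ite (Triple.seq (R := fun s => s.vars 11 = z ∧ P.Env s ∧
    s.arrs 1 = (fun _ => 0) ∧ P.system.Inv (s.arrs 5) (s.arrs 6) (z + 1) z 0 ∧
    P.system.Best (s.arrs 5) (z + 1) (s.vars 13) z ∧ 0 < s.arrs 5 z)
    (Triple.assign ?_) (Triple.assign ?_)) (Triple.skip ?_)) (Triple.skip ?_)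
  · rintro s ⟨⟨⟨hz, he, hu, hi, hb, hp⟩, hf⟩, hlt⟩
    rw [he.eval_final (e := .var 11) hz h0 h1] at hf
    rw [Exp.eval_less, Exp.eval_cell, Exp.eval_var, Exp.eval_var, hz] at hlt
    have hlt' : s.vars 13 < s.arrs 5 z := by by_contra hc; exact hlt (if_neg hc)
    rw [Exp.eval_cell, Exp.eval_var, hz]
    refine ⟨by simpa using hz, he.setVar _ (by decide), hu, hi, ?_, hp⟩
    rw [State.setVar_vars, if_pos rfl]
    exact hb.improve hf hlt'
  · rintro s ⟨hz, he, hu, hi, hb, hp⟩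
    rw [Exp.eval_var, hz]
    refine ⟨he.setVar _ (by decide), hu, by simpa using hz, hi, ?_, hp⟩
    simpa using hb
  · rintro s ⟨⟨⟨hz, he, hu, hi, hb, hp⟩, -⟩, hlt⟩
    rw [Exp.eval_less, Exp.eval_cell, Exp.eval_var, Exp.eval_var, hz] at hlt
    refine ⟨he, hu, hz, hi, hb.keep fun _ => ?_, hp⟩
    by_contra hc; rw [if_pos (not_le.1 hc)] at hlt; exact one_ne_zero hlt
  · rintro s ⟨⟨hz, he, hu, hi, hb, hp⟩, hf⟩
    exact ⟨he, hu, hz, hi,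
      hb.keep fun h => absurd hf ((he.eval_final (e := .var 11) hz h0 h1).2 h), hp⟩

theorem triple_pass :
    Triple P.size (fun s => P.Env s ∧ Fresh s) pass (P.Passing P.size) := by
  refine (Triple.for (N := P.size) (I := fun i s => s.vars 11 = i ∧ P.Passing i s) le_rfl
    (fun i s h => h.1) (fun i s h => Env.eval_size h.2.env.toBase h.2.env.pow)
    (fun s h => ⟨by simp, ?_⟩) (fun i hi => ?_)).conseq (fun s h => h) (fun s h => h.2)
  · obtain ⟨he, hf⟩ := h
    refine Passing.setVar ⟨he, hf.update, ?_, ?_⟩ _ (by decide) (by decide) (by decide)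
    · rw [hf.val, hf.par]; exact System.Inv.init
    · rw [hf.val, hf.best]; exact System.Best.init _ fun _ _ => rfl
  · have h0 : (0 : ℤ) ≤ i := by positivity
    have h1 : (i : ℤ) < P.size := by exact_mod_cast hi
    refine Triple.seq (R := fun s => s.vars 11 = i ∧ P.Env s ∧ s.arrs 1 = (fun _ => 0) ∧
      P.system.Inv (s.arrs 5) (s.arrs 6) (i + 1) i 0 ∧
      P.system.Best (s.arrs 5) i (s.vars 13) (s.vars 14)) (Triple.ite (Triple.store ?_)
      (Triple.skip ?_)) (Triple.ite (Triple.conseq (P := fun s => s.vars 11 = i ∧ P.Env s ∧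
        s.arrs 1 = (fun _ => 0) ∧ P.system.Inv (s.arrs 5) (s.arrs 6) (i + 1) i 0 ∧
        P.system.Best (s.arrs 5) i (s.vars 13) (s.vars 14) ∧ 0 < s.arrs 5 i)
        (Triple.seq (triple_updateBest _ h0 h1) (Triple.for (N := 2 * P.n)
          (I := fun j s => s.vars 12 = j ∧ P.Relaxing i j s) ?_ (fun j s h => h.1)
          (fun j s h => ?_) (fun s h => ?_)
          (fun j hj => (triple_relax _ i hj).conseq (fun s h => h) fun s h => ?_))) ?_ ?_)
      (Triple.skip ?_))
    · rintro s ⟨⟨hz, h⟩, hs⟩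
      rw [h.env.eval_seed (e := .var 11) hz h0 h1] at hs
      rw [Exp.eval_var, hz, Exp.eval_lit]
      refine ⟨hz, h.env.setCell _ _ (by decide) (by decide) (by decide), ?_, ?_, ?_⟩
      · rw [State.setCell_arrs_of_ne _ _ _ (by decide), h.update]
      · rw [State.setCell_arrs_self, State.setCell_arrs_of_ne _ _ _ (by decide)]
        exact h.inv.seed_step h0 h1 hs
      · rw [State.setCell_arrs_self]
        exact h.best.congr fun y hy => Function.update_of_ne hy.ne _ _
    · rintro s ⟨⟨hz, h⟩, hs⟩
      exact ⟨hz, h.env, h.update, h.inv.no_seed_step fun h' => absurd hs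
        ((h.env.eval_seed (e := .var 11) hz h0 h1).2 h'), h.best⟩
    · have := three_mul_n_add_four_le_size (P := P); omega
    · simp [h.2.env.n]
    · exact ⟨by simp, h.setVar _ (by decide) (by decide) (by decide) (by decide)⟩
    · exact ⟨h.1, by simp, h.2.setVar _ (by decide) (by decide) (by decide) (by decide)⟩
    · rintro s ⟨⟨hz, he, hu, hi, hb⟩, hp⟩
      refine ⟨hz, he, hu, hi, hb, ?_⟩
      rw [Exp.eval_less, Exp.eval_cell, Exp.eval_var, Exp.eval_lit, hz] at hp
      by_contra hc; exact hp (if_neg hc)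
    · rintro s ⟨-, h⟩
      refine ⟨h.cur, by simp, ?_⟩
      have : P.Passing (i + 1 : ℤ) s := ⟨h.env, h.update, h.inv.next_state, h.best⟩
      push_cast
      exact this.setVar _ (by decide) (by decide) (by decide)
    · rintro s ⟨⟨hz, he, hu, hi, hb⟩, hp⟩
      rw [Exp.eval_less, Exp.eval_cell, Exp.eval_var, Exp.eval_lit, hz] at hp
      have hle : s.arrs 5 i ≤ 0 := by
        by_contra hc; rw [if_pos (not_le.1 hc)] at hp; exact one_ne_zero hp
      refine ⟨hz, by simp, ?_⟩
      have : P.Passing (i + 1 : ℤ) s :=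
        ⟨he, hu, hi.skip_state hle, hb.keep fun _ => hle.trans hb.nonneg⟩
      push_cast
      exact this.setVar _ (by decide) (by decide) (by decide)

end Problem

namespace Problem

open Code

variable {P : Problem}

/-! ### Correctness of the output -/

/-- The chain of states `zs` that leads to `bz` along the parent pointers describes the lasso
`π`. -/
structure Traced (P : Problem) (π : ℕ → Fin P.n) (p l : ℕ) (zs : ℕ → ℤ) (par : ℤ → ℤ) (bz : ℤ) :
    Prop where
  lasso : P.IsLasso π p l
  last : zs (p + l) = bz
  par_seed : par (zs 0) = 0
  par : ∀ i < p + l, par (zs (i + 1)) = zs i + 1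
  nonneg : ∀ i ≤ p + l, 0 ≤ zs i
  node : ∀ i ≤ p + l, P.node (zs i) = π i
  mem : ∀ i ≤ p + l, P.mem (zs i) = P.occ π i (π i)
  clock : ∀ i ≤ p + l, P.clock (zs i) = i - p
  le : p + l ≤ P.size

/-- The tables in arrays `1` and `2` describe a strategy that follows the lasso `π`, where the
memory state at time `i` is the number of earlier visits of the current node. -/
structure Tables (P : Problem) (π : ℕ → Fin P.n) (p l : ℕ) (s : State) : Prop where
  choice_adj : ∀ k < P.n * P.B, ∃ w : ℕ, s.arrs 2 k = w ∧ P.Adj (k / P.B) w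
  update_range : ∀ m < P.B, ∀ v < P.n, ∃ m' : ℕ, m' < P.B ∧ s.arrs 1 (P.n * m + v) = m'
  choice : ∀ i < p + l, s.arrs 2 (P.B * (π i : ℕ) + P.occ π i (π i)) = (π (i + 1) : ℕ)
  update : ∀ i, i + 1 < p + l →
    s.arrs 1 (P.n * P.occ π i (π i) + (π i : ℕ)) = P.occ π (i + 1) (π (i + 1))
  close : s.arrs 1 (P.n * P.occ π (p + l - 1) (π (p + l - 1)) + (π (p + l - 1) : ℕ)) =
    P.occ π p (π p)

theorem IsLasso.occ_lt {π : ℕ → Fin P.n} {p l i : ℕ} (h : P.IsLasso π p l) (hi : i < p + l) :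
    P.occ π i (π i) < P.B := by
  have h1 := h.occ_le (π i)
  have h2 := occ_mono (π := π) (show i + 1 ≤ p + l by omega) (π i)
  rw [occ_succ, if_pos rfl] at h2
  omega

/-- Different times before the repetition are told apart by node and memory state. -/
theorem occ_ne {π : ℕ → Fin P.n} {i k : ℕ} (h : i < k) :
    (π i : ℕ) ≠ π k ∨ P.occ π i (π i) ≠ P.occ π k (π k) := by
  by_cases hv : π i = π k
  · refine Or.inr ?_
    have h2 := occ_mono (π := π) (show i + 1 ≤ k by omega) (π i)
    rw [occ_succ, if_pos rfl, hv] at h2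
    rw [hv]; omega
  · exact Or.inl fun e => hv (Fin.ext e)

theorem index_ne {B v m v' m' : ℕ} (hm : m < B) (hm' : m' < B) (h : v ≠ v' ∨ m ≠ m') :
    (B : ℤ) * v + m ≠ B * v' + m' := by
  intro e
  have e' : B * v + m = B * v' + m' := by exact_mod_cast e
  have h1 : (B * v + m) / B = v := by
    rw [Nat.mul_add_div (by omega), Nat.div_eq_of_lt hm, add_zero]
  have h2 : (B * v' + m') / B = v' := by
    rw [Nat.mul_add_div (by omega), Nat.div_eq_of_lt hm', add_zero]
  have hv : v = v' := by rw [← h1, ← h2, e']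
  subst hv
  omega

section Defaults

theorem triple_writeDefaults (hG : ∀ v, ∃ w, P.G.Adj v w) (par : ℤ → ℤ) (bz : ℤ) :
    Triple P.size
      (fun s => P.Env s ∧ s.arrs 1 = (fun _ => 0) ∧ s.arrs 6 = par ∧ s.vars 14 = bz) writeDefaults
      (fun s => P.Env s ∧ s.arrs 1 = (fun _ => 0) ∧ s.arrs 6 = par ∧ s.vars 14 = bz ∧
        ∀ k < P.n * P.B, ∃ w : ℕ, s.arrs 2 k = w ∧ P.Adj (k / P.B) w) := by
  have hsize := n_mul_B_add_one_le_size (P := P)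
  have hnB := le_n_mul_B (P := P)
  refine (Triple.for (N := P.n * P.B) (I := fun i s => s.vars 11 = i ∧ P.Env s ∧
    s.arrs 1 = (fun _ => 0) ∧ s.arrs 6 = par ∧ s.vars 14 = bz ∧
    ∀ k < i, ∃ w : ℕ, s.arrs 2 k = w ∧ P.Adj (k / P.B) w)
    (by omega) (fun i s h => h.1) (fun i s h => Env.eval_horizon h.2.1.toBase) (fun s h => ?_)
    (fun i hi => (Triple.for (N := P.n) (I := fun w s => s.vars 12 = w ∧ s.vars 11 = i ∧ P.Env s ∧
      s.arrs 1 = (fun _ => 0) ∧ s.arrs 6 = par ∧ s.vars 14 = bz ∧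
      (∀ k < i, ∃ w : ℕ, s.arrs 2 k = w ∧ P.Adj (k / P.B) w) ∧
      ((∃ w' < w, P.Adj (i / P.B) w') → ∃ w : ℕ, s.arrs 2 i = w ∧ P.Adj (i / P.B) w))
      (by omega) (fun w s h => h.1) (fun w s h => by simp [h.2.2.1.n]) (fun s h => ?_)
      (fun w hw => ?_)).conseq (fun s h => h) (fun s h => ?_))).conseq (fun s h => h)
      (fun s h => h.2)
  · exact ⟨by simp, h.1.setVar _ (by decide), h.2.1, h.2.2.1, by simpa using h.2.2.2,
      fun k hk => by omega⟩
  · obtain ⟨h1, h2, h3, h4, h5, h6⟩ := h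
    refine ⟨by simp, by simpa using h1, h2.setVar _ (by decide), h3, h4, by simpa using h5, h6, ?_⟩
    rintro ⟨w', hw', -⟩
    omega
  · have hiB : i / P.B < P.n := Nat.div_lt_of_lt_mul (by rwa [mul_comm])
    have heval : ∀ s : State, s.vars 12 = w → s.vars 11 = i → P.Env s →
        (((Exp.cell 0 (.var 0 * (.var 11 / .var 1) + .var 12)).eval s ≠ 0) ↔
          P.Adj (i / P.B) w) := by
      intro s h1 h2 h3
      have := h3.adj (i / P.B) w hiB hw
      push_cast at this
      simpa [h1, h2, h3.n, h3.B] using this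
    refine Triple.ite (Triple.store ?_) (Triple.skip ?_)
    · rintro s ⟨⟨h1, h2, h3, h4, h5, h6, h7, h8⟩, h9⟩
      have hadj := (heval s h1 h2 h3).1 h9
      rw [Exp.eval_var, Exp.eval_var, h1, h2]
      refine ⟨by simpa using h1, by simp, by simpa using h2,
        (h3.setCell _ _ (by decide) (by decide) (by decide)).setVar _ (by decide), ?_, ?_,
        by simpa using h6, fun k hk => ?_, fun _ => ⟨w, by simp, hadj⟩⟩
      · rw [State.setVar_arrs, State.setCell_arrs_of_ne _ _ _ (by decide), h4]
      · rw [State.setVar_arrs, State.setCell_arrs_of_ne _ _ _ (by decide), h5]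
      · rw [State.setVar_arrs, State.setCell_arrs_self,
          Function.update_of_ne (by exact_mod_cast hk.ne)]
        exact h7 k hk
    · rintro s ⟨⟨h1, h2, h3, h4, h5, h6, h7, h8⟩, h9⟩
      refine ⟨h1, by simp, by simpa using h2, h3.setVar _ (by decide), h4, h5, by simpa using h6,
        h7, ?_⟩
      rintro ⟨w', hw', ha⟩
      rcases (Nat.lt_succ_iff.1 hw').eq_or_lt with rfl | hlt
      · exact absurd h9 ((heval s h1 h2 h3).2 ha)
      · exact h8 ⟨w', hlt, ha⟩
  · obtain ⟨h1, h2, h3, h4, h5, h6, h7, h8⟩ := h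
    refine ⟨h2, by simp, h3.setVar _ (by decide), h4, h5, by simpa using h6, fun k hk => ?_⟩
    rcases (Nat.lt_succ_iff.1 hk).eq_or_lt with rfl | hlt
    · have hiB : k / P.B < P.n := Nat.div_lt_of_lt_mul (by rwa [mul_comm])
      obtain ⟨w, hw⟩ := hG ⟨k / P.B, hiB⟩
      exact h8 ⟨w, w.2, hiB, w.2, hw⟩
    · exact h7 k hlt

end Defaults

section Trace

variable {π : ℕ → Fin P.n} {p l : ℕ} {zs : ℕ → ℤ} {par : ℤ → ℤ} {bz : ℤ}

/-- The memory after `i` steps of the traversal of the chain. -/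
structure Tracing (P : Problem) (π : ℕ → Fin P.n) (p l : ℕ) (zs : ℕ → ℤ) (par : ℤ → ℤ) (bz : ℤ)
    (i : ℕ) (s : State) : Prop where
  env : P.Env s
  par : s.arrs 6 = par
  bz : s.vars 14 = bz
  cur : s.vars 11 = zs (p + l - i)
  choice_adj : ∀ k < P.n * P.B, ∃ w : ℕ, s.arrs 2 k = w ∧ P.Adj (k / P.B) w
  update_range : ∀ m < P.B, ∀ v < P.n,
    (m ≠ P.occ π (p + l - 1) (π (p + l - 1)) ∨ v ≠ π (p + l - 1)) →
      ∃ m' : ℕ, m' < P.B ∧ s.arrs 1 (P.n * m + v) = m'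
  choice : ∀ k, p + l - i ≤ k → k < p + l →
    s.arrs 2 (P.B * (π k : ℕ) + P.occ π k (π k)) = (π (k + 1) : ℕ)
  update : ∀ k, p + l - i ≤ k → k + 1 < p + l →
    s.arrs 1 (P.n * P.occ π k (π k) + (π k : ℕ)) = P.occ π (k + 1) (π (k + 1))
  entry : 0 < i → s.vars 15 = P.occ π (max p (p + l - i)) (π (max p (p + l - i)))

theorem Tracing.setVar {i : ℕ} {s : State} (h : Tracing P π p l zs par bz i s) {x : ℕ} (k : ℤ)
    (hx : 9 ≤ x) (h1 : 11 ≠ x) (h2 : 14 ≠ x) (h3 : 15 ≠ x) :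
    Tracing P π p l zs par bz i (s.setVar x k) :=
  { h with
    env := h.env.setVar k hx
    bz := by rw [State.setVar_vars, if_neg h2, h.bz]
    cur := by rw [State.setVar_vars, if_neg h1, h.cur]
    entry := fun hi => by rw [State.setVar_vars, if_neg h3, h.entry hi] }

/-- The effect of one step of the traversal on the tables. -/
theorem Tracing.step {i k : ℕ} {s : State} (h : Tracing P π p l zs par bz i s)
    (ht : P.Traced π p l zs par bz) (hk : p + l - i = k + 1) {y : ℤ}
    (hy : y = P.occ π (max p k) (π (max p k))) :
    Tracing P π p l zs par bz (i + 1)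
      (((((s.setVar 17 (zs k)).setCell
        2 (P.B * (π k : ℕ) + P.occ π k (π k)) (π (k + 1) : ℕ)).setCell
        1 (P.n * P.occ π k (π k) + (π k : ℕ)) (P.occ π (k + 1) (π (k + 1)))).setVar 15 y).setVar
        11 (zs k)) := by
  have hkq : k < p + l := by omega
  have hki : p + l - (i + 1) = k := by omega
  have hB := ht.lasso.occ_lt hkq
  have ha2 : ∀ x, (((((s.setVar 17 (zs k)).setCell 2 (P.B * (π k : ℕ) + P.occ π k (π k))
      (π (k + 1) : ℕ)).setCell 1 (P.n * P.occ π k (π k) + (π k : ℕ))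
      (P.occ π (k + 1) (π (k + 1)))).setVar 15 y).setVar 11 (zs k)).arrs 2 x =
      Function.update (s.arrs 2) (P.B * (π k : ℕ) + P.occ π k (π k)) (π (k + 1) : ℕ) x := by
    intro x
    rw [State.setVar_arrs, State.setVar_arrs, State.setCell_arrs_of_ne _ _ _ (by decide),
      State.setCell_arrs_self, State.setVar_arrs]
  have ha1 : ∀ x, (((((s.setVar 17 (zs k)).setCell 2 (P.B * (π k : ℕ) + P.occ π k (π k))
      (π (k + 1) : ℕ)).setCell 1 (P.n * P.occ π k (π k) + (π k : ℕ))
      (P.occ π (k + 1) (π (k + 1)))).setVar 15 y).setVar 11 (zs k)).arrs 1 x =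
      Function.update (s.arrs 1) (P.n * P.occ π k (π k) + (π k : ℕ))
        (P.occ π (k + 1) (π (k + 1)) : ℤ) x := by
    intro x
    rw [State.setVar_arrs, State.setVar_arrs, State.setCell_arrs_self,
      State.setCell_arrs_of_ne _ _ _ (by decide), State.setVar_arrs]
  refine ⟨?_, ?_, by simpa using h.bz, by simp [hki], fun j hj => ?_, fun m hm v hv hne => ?_,
    fun j hj1 hj2 => ?_, fun j hj1 hj2 => ?_, fun _ => ?_⟩
  · exact ((((h.env.setVar _ (by decide)).setCell _ _ (by decide) (by decide) (by decide)).setCell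
      _ _ (by decide) (by decide) (by decide)).setVar _ (by decide)).setVar _ (by decide)
  · rw [State.setVar_arrs, State.setVar_arrs, State.setCell_arrs_of_ne _ _ _ (by decide),
      State.setCell_arrs_of_ne _ _ _ (by decide), State.setVar_arrs, h.par]
  · rw [ha2]
    by_cases hj' : j = P.B * π k + P.occ π k (π k)
    · have hdiv : j / P.B = π k := by
        rw [hj', Nat.mul_add_div (by omega), Nat.div_eq_of_lt hB, add_zero]
      refine ⟨π (k + 1), ?_, ?_⟩
      · rw [hj']; push_cast; rw [Function.update_self]
      · rw [hdiv]; exact ⟨(π k).2, (π (k + 1)).2, ht.lasso.adj k⟩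
    · rw [Function.update_of_ne (by exact_mod_cast hj')]
      exact h.choice_adj j hj
  · rw [ha1]
    by_cases hcase : m = P.occ π k (π k) ∧ v = π k
    · obtain ⟨rfl, rfl⟩ := hcase
      refine ⟨P.occ π (k + 1) (π (k + 1)), ?_, by rw [Function.update_self]⟩
      -- The exceptional entry belongs to the last step, so that `k + 1` is before the repetition.
      have : k + 1 ≠ p + l := by
        rintro e
        rw [show p + l - 1 = k by omega] at hne
        rcases hne with hne | hne <;> exact hne rfl
      exact ht.lasso.occ_lt (by omega)
    · rw [Function.update_of_ne (index_ne hv (π k).2 (by omega))]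
      exact h.update_range m hm v hv hne
  · rw [ha2]
    rcases (hki ▸ hj1 : k ≤ j).eq_or_lt with rfl | hlt
    · rw [Function.update_self]
    · rw [Function.update_of_ne (index_ne (ht.lasso.occ_lt hj2) hB
        ((occ_ne (π := π) hlt).imp Ne.symm Ne.symm))]
      exact h.choice j (by omega) hj2
  · rw [ha1]
    rcases (hki ▸ hj1 : k ≤ j).eq_or_lt with rfl | hlt
    · rw [Function.update_self]
    · rw [Function.update_of_ne (index_ne (π j).2 (π k).2
        ((occ_ne (π := π) hlt).imp Ne.symm Ne.symm).symm)]
      exact h.update j (by omega) hj2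
  · rw [hki, ← hy]; simp

theorem triple_traceBody (T : ℕ) (ht : P.Traced π p l zs par bz) (i : ℕ) :
    Triple T (fun s => s.vars 12 = i ∧ Tracing P π p l zs par bz i s) traceBody
      (fun s => s.vars 12 = i ∧ Tracing P π p l zs par bz (i + 1) s) := by
  have hl := ht.lasso.len_pos
  rcases Nat.eq_zero_or_pos (p + l - i) with h0 | hpos
  · refine Triple.ite ?_ (Triple.skip ?_)
    · rintro s ⟨⟨h1, h⟩, h2⟩
      exact absurd (by simp [h.cur, h.par, h0, ht.par_seed]) h2
    · rintro s ⟨⟨h1, h⟩, -⟩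
      have e : p + l - (i + 1) = p + l - i := by omega
      exact ⟨h1, { h with
        cur := by rw [e]; exact h.cur
        choice := by rw [e]; exact h.choice
        update := by rw [e]; exact h.update
        entry := fun _ => by rw [e]; exact h.entry (by omega) }⟩
  · obtain ⟨k, hk⟩ : ∃ k, p + l - i = k + 1 := ⟨p + l - i - 1, by omega⟩
    have hkq : k < p + l := by omega
    have hpar : par (zs (k + 1)) = zs k + 1 := ht.par k hkq
    have h0 := ht.nonneg k hkq.le
    have hnk := ht.node k hkq.le
    have hmk := ht.mem k hkq.le
    have hnk' := ht.node (k + 1) hkq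
    have hmk' := ht.mem (k + 1) hkq
    refine Triple.ite ?_ (Triple.skip ?_)
    · set s₁ : State → State := fun s => s.setVar 17 (zs k)
      set s₂ : State → State := fun s =>
        (s₁ s).setCell 2 (P.B * (π k : ℕ) + P.occ π k (π k)) (π (k + 1) : ℕ)
      set s₃ : State → State := fun s =>
        (s₂ s).setCell 1 (P.n * P.occ π k (π k) + (π k : ℕ)) (P.occ π (k + 1) (π (k + 1)))
      have e₁ : ∀ s, P.Env s → P.Env (s₁ s) := fun s h => h.setVar _ (by decide)
      have e₂ : ∀ s, P.Env s → P.Env (s₂ s) := fun s h =>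
        (e₁ s h).setCell _ _ (by decide) (by decide) (by decide)
      have e₃ : ∀ s, P.Env s → P.Env (s₃ s) := fun s h =>
        (e₂ s h).setCell _ _ (by decide) (by decide) (by decide)
      have hn17 : P.node (zs k) < P.n := by rw [hnk]; exact (π k).2
      have hn11 : P.node (zs (k + 1)) < P.n := by rw [hnk']; exact (π (k + 1)).2
      refine Triple.seq (R := fun s' => ∃ s : State, (s.vars 12 = i ∧
        Tracing P π p l zs par bz i s) ∧
        s' = s₁ s) (Triple.assign ?_) ?_
      · rintro s ⟨⟨h1, h⟩, -⟩
        refine ⟨s, ⟨h1, h⟩, ?_⟩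
        have : (Exp.cell 6 (.var 11) - .lit 1).eval s = zs k := by
          simp [h.cur, h.par, hk, hpar]
        rw [this]
      refine Triple.seq (R := fun s' => ∃ s : State, (s.vars 12 = i ∧
        Tracing P π p l zs par bz i s) ∧
        s' = s₂ s) (Triple.store ?_) ?_
      · rintro _ ⟨s, ⟨h1, h⟩, rfl⟩
        refine ⟨s, ⟨h1, h⟩, ?_⟩
        have c17 : (Exp.var 17).eval (s₁ s) = zs k := by simp [s₁]
        have c11 : (Exp.var 11).eval (s₁ s) = zs (k + 1) := by simp [s₁, h.cur, hk]
        rw [Exp.eval_add, Exp.eval_mul, Exp.eval_var, (e₁ s h.env).B, (e₁ s h.env).eval_node c17,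
          (e₁ s h.env).eval_mem c17 hn17, (e₁ s h.env).eval_node c11, hnk, hmk, hnk']
      refine Triple.seq (R := fun s' => ∃ s : State, (s.vars 12 = i ∧
        Tracing P π p l zs par bz i s) ∧
        s' = s₃ s) (Triple.store ?_) ?_
      · rintro _ ⟨s, ⟨h1, h⟩, rfl⟩
        refine ⟨s, ⟨h1, h⟩, ?_⟩
        have c17 : (Exp.var 17).eval (s₂ s) = zs k := by simp [s₁, s₂]
        have c11 : (Exp.var 11).eval (s₂ s) = zs (k + 1) := by simp [s₁, s₂, h.cur, hk]
        rw [Exp.eval_add, Exp.eval_mul, Exp.eval_var, (e₂ s h.env).n, (e₂ s h.env).eval_node c17,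
          (e₂ s h.env).eval_mem c17 hn17, (e₂ s h.env).eval_mem c11 hn11, hnk, hmk, hmk']
      have hclk : ∀ s, Tracing P π p l zs par bz i s →
          ((Exp.lit 0).less (clockE (.var 11))).eval (s₃ s) = if p ≤ k then 1 else 0 := by
        intro s h
        have c11 : (Exp.var 11).eval (s₃ s) = zs (k + 1) := by simp [s₁, s₂, s₃, h.cur, hk]
        rw [Exp.eval_less, (e₃ s h.env).eval_clock c11, ht.clock (k + 1) hkq, Exp.eval_lit]
        by_cases hpk : p ≤ k
        · rw [if_pos (by omega), if_pos hpk]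
        · rw [if_neg (by omega), if_neg hpk]
      refine Triple.seq (R := fun s' => ∃ s : State, (s.vars 12 = i ∧
        Tracing P π p l zs par bz i s) ∧
        s' = (s₃ s).setVar 15 (P.occ π (max p k) (π (max p k)))) (Triple.ite (Triple.assign ?_)
        (Triple.skip ?_)) (Triple.assign ?_)
      · rintro _ ⟨⟨s, ⟨h1, h⟩, rfl⟩, h2⟩
        refine ⟨s, ⟨h1, h⟩, ?_⟩
        rw [hclk s h] at h2
        have hpk : p ≤ k := by by_contra hc; exact h2 (if_neg hc)
        have c17 : (Exp.var 17).eval (s₃ s) = zs k := by simp [s₁, s₂, s₃]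
        rw [(e₃ s h.env).eval_mem c17 hn17, hmk, max_eq_right hpk]
      · rintro _ ⟨⟨s, ⟨h1, h⟩, rfl⟩, h2⟩
        refine ⟨s, ⟨h1, h⟩, ?_⟩
        rw [hclk s h] at h2
        have hpk : ¬ p ≤ k := fun hc => by rw [if_pos hc] at h2; exact one_ne_zero h2
        -- The entry of the cycle has been passed before, and the variable holds the right value.
        have h15 := h.entry (by omega)
        rw [hk, max_eq_left (by omega)] at h15
        rw [max_eq_left (by omega), ← h15]
        have : (s₃ s).vars 15 = s.vars 15 := by simp [s₁, s₂, s₃]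
        rw [← this]
        simp [State.setVar]
      · rintro _ ⟨s, ⟨h1, h⟩, rfl⟩
        have c17 : (Exp.var 17).eval ((s₃ s).setVar 15 (P.occ π (max p k) (π (max p k)))) =
          zs k := by
          simp [s₁, s₂, s₃]
        rw [c17]
        exact ⟨by simpa [s₁, s₂, s₃] using h1, h.step ht hk rfl⟩
    · rintro s ⟨⟨h1, h⟩, h2⟩
      rw [Exp.eval_less, Exp.eval_lit, Exp.eval_cell, Exp.eval_var, h.cur, h.par, hk, hpar,
        if_pos (by omega)] at h2
      exact absurd h2 one_ne_zero

theorem triple_trace (ht : P.Traced π p l zs par bz) :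
    Triple P.size
      (fun s => P.Env s ∧ s.arrs 1 = (fun _ => 0) ∧ s.arrs 6 = par ∧ s.vars 14 = bz ∧
        ∀ k < P.n * P.B, ∃ w : ℕ, s.arrs 2 k = w ∧ P.Adj (k / P.B) w)
      trace (Tracing P π p l zs par bz P.size) := by
  refine Triple.seq (R := Tracing P π p l zs par bz 0) (Triple.assign fun s h => ?_)
    ((Triple.for (N := P.size) (I := fun i s => s.vars 12 = i ∧ Tracing P π p l zs par bz i s)
      le_rfl
      (fun i s h => h.1) (fun i s h => Env.eval_size h.2.env.toBase h.2.env.pow) (fun s h => ?_)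
      (fun i hi => (triple_traceBody _ ht i).conseq (fun s h => h) fun s h => ?_)).conseq
      (fun s h => h) (fun s h => h.2))
  · obtain ⟨h1, h2, h3, h4, h5⟩ := h
    refine ⟨h1.setVar _ (by decide), h3, by simpa using h4, ?_, h5, fun m _ v _ _ => ?_,
      fun k hk hk' => by omega, fun k hk hk' => by omega, fun hi => by omega⟩
    · simp [h4, ht.last]
    · exact ⟨0, by have := P.one_lt_B; omega, by simp [h2]⟩
  · exact ⟨by simp, h.setVar _ (by decide) (by decide) (by decide) (by decide)⟩
  · exact ⟨h.1, by simp, h.2.setVar _ (by decide) (by decide) (by decide) (by decide)⟩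

theorem triple_patch (T : ℕ) (ht : P.Traced π p l zs par bz) :
    Triple T (Tracing P π p l zs par bz P.size) patch (P.Tables π p l) := by
  have hl := ht.lasso.len_pos
  obtain ⟨k, hk⟩ : ∃ k, p + l = k + 1 := ⟨p + l - 1, by omega⟩
  have hkq : k < p + l := by omega
  refine Triple.seq (R := fun s => s.vars 17 = zs k ∧ Tracing P π p l zs par bz P.size s)
    (Triple.assign fun s h => ?_) (Triple.store ?_)
  · refine ⟨?_, h.setVar _ (by decide) (by decide) (by decide) (by decide)⟩
    have hpar := ht.par k hkq
    rw [← hk, ht.last] at hpar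
    simp [h.bz, h.par, hpar]
  · rintro s ⟨h17, h⟩
    have hnk := ht.node k hkq.le
    have hmk := ht.mem k hkq.le
    have h0 : p + l - P.size = 0 := by have := ht.le; omega
    have h15 := h.entry (by have := ht.le; omega)
    rw [h0, max_eq_left (Nat.zero_le p)] at h15
    rw [Exp.eval_add, Exp.eval_mul, Exp.eval_var, h.env.n, h.env.eval_node (e := .var 17) h17,
      h.env.eval_mem (e := .var 17) h17 (by rw [hnk]; exact (π k).2), hnk, hmk, Exp.eval_var, h15]
    have hkl : p + l - 1 = k := by omega
    have ha2 := State.setCell_arrs_of_ne s (a := 1) (b := 2)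
      (P.n * P.occ π k (π k) + (π k : ℕ)) (P.occ π p (π p)) (by decide)
    refine ⟨?_, fun m hm v hv => ?_, fun i hi => ?_, fun i hi => ?_, ?_⟩
    · rw [ha2]; exact h.choice_adj
    · rw [State.setCell_arrs_self]
      by_cases hcase : m = P.occ π k (π k) ∧ v = π k
      · obtain ⟨rfl, rfl⟩ := hcase
        exact ⟨_, ht.lasso.occ_lt (by omega : p < p + l), by rw [Function.update_self]⟩
      · rw [Function.update_of_ne (index_ne hv (π k).2 (by omega))]
        exact h.update_range m hm v hv (by rw [hkl]; omega)
    · rw [ha2]; exact h.choice i (by omega) hi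
    · rw [State.setCell_arrs_self, Function.update_of_ne (index_ne (π i).2 (π k).2
        (occ_ne (π := π) (by omega)).symm)]
      exact h.update i (by omega) hi
    · rw [hkl, State.setCell_arrs_self, Function.update_self]

end Trace

/-- The search stores a strategy that follows a lasso of largest weight. -/
theorem triple_search (hG : ∀ v, ∃ w, P.G.Adj v w) (hlasso : ∃ π p l, P.IsLasso π p l) :
    Triple P.size (fun s => P.Env s ∧ Fresh s) search (fun s => ∃ (π : ℕ → Fin P.n) (p l : ℕ)
      (L₀ : ℕ → ℕ), P.IsLasso π p l ∧ (∀ u < P.n, lastVisit π p L₀ (p + l) u = L₀ u) ∧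
      P.Tables π p l s ∧ ∀ π' p' l', P.IsLasso π' p' l' → ∃ L₀' : ℕ → ℕ,
        (∀ u < P.n, lastVisit π' p' L₀' (p' + l') u = L₀' u) ∧
        ∑ i ∈ Finset.range (p' + l'), P.lassoWeight π' p' l' L₀' i ≤
          ∑ i ∈ Finset.range (p + l), P.lassoWeight π p l L₀ i) := by
  refine triple_pass.seq ?_
  intro s h
  have hbest : ∀ {z a : ℤ}, P.system.Run z a → P.Final z → 1 ≤ a ∧ a ≤ s.vars 13 := by
    intro z a hr hf
    obtain ⟨h1, h2⟩ := h.inv.run_le hr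
    exact ⟨h1, h2.trans (h.best.le z (P.system.good_range z hr.good).2 hf)⟩
  obtain ⟨hfin, -, hval⟩ : P.Final (s.vars 14) ∧ _ ∧ s.arrs 5 (s.vars 14) = s.vars 13 := by
    refine h.best.eq.resolve_left fun h0 => ?_
    obtain ⟨π, p, l, hπ⟩ := hlasso
    obtain ⟨L₀, -, z, hr, hf⟩ := hπ.exists_run
    have := hbest hr hf
    omega
  have hpos : 0 < s.arrs 5 (s.vars 14) := by
    obtain ⟨π, p, l, hπ⟩ := hlasso
    obtain ⟨L₀, -, z, hr, hf⟩ := hπ.exists_run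
    have := hbest hr hf
    omega
  obtain ⟨q, zs, js, hc, hq⟩ := h.inv.exists_chain _ hpos
  obtain ⟨π, p, l, L₀, hπ, hfix, rfl, hspec, hsum⟩ := exists_lasso hc hfin
  have ht : P.Traced π p l zs (s.arrs 6) (s.vars 14) :=
    { lasso := hπ
      last := hc.last
      par_seed := hc.par_seed
      par := hc.par
      nonneg := fun i hi => (hspec i hi).good.1
      node := fun i hi => (hspec i hi).node
      mem := fun i hi => (hspec i hi).mem_eq
      clock := fun i hi => (hspec i hi).clock
      le := by
        have := (P.system.good_range _ (h.inv.good _ hpos)).2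
        have : ((p + l : ℕ) : ℤ) < P.size := hq.trans_lt this
        exact_mod_cast this.le }
  obtain ⟨s', t, b, ex, hle, htab⟩ := (triple_writeDefaults hG (s.arrs 6) (s.vars 14)).seq
    ((triple_trace ht).seq (triple_patch _ ht)) s ⟨h.env, h.update, rfl, rfl⟩
  refine ⟨s', t, b, ex, hle, π, p, l, L₀, hπ, hfix, htab, fun π' p' l' hπ' => ?_⟩
  obtain ⟨L₀', hfix', z, hr, hf⟩ := hπ'.exists_run
  refine ⟨L₀', hfix', ?_⟩
  have := (hbest hr hf).2
  omega

end Problem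

/-! ### Correctness and cost of the program -/

namespace Problem

open Code

variable {P : Problem}

/-- The tables describe a strategy with `B` memory states that follows the lasso `π`. Its memory
state is the number of earlier visits to the current node, counted before the first repetition. -/
theorem Tables.exists_strategy {π : ℕ → Fin P.n} {p l : ℕ} {s : State} (hπ : P.IsLasso π p l)
    (h : P.Tables π p l s) (h0 : s.vars 0 = 0) :
    ∃ (𝓜 : MemoryStructure (Fin P.n) (Fin P.B)) (τ : Fin P.n → Fin P.B → Fin P.n),
      s.Outputs 𝓜 τ ∧ (∀ v m, P.G.Adj v (τ v m)) ∧ outcome P.v₀ (𝓜.strategy τ P.v₀) = π := by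
  have hB : 0 < P.B := by have := P.one_lt_B; omega
  have hl := hπ.len_pos
  have hτ : ∀ (v : Fin P.n) (m : Fin P.B), ∃ w : Fin P.n,
      s.arrs 2 (P.B * (v : ℕ) + (m : ℕ)) = (w : ℕ) ∧ P.G.Adj v w := by
    intro v m
    have hlt : P.B * (v : ℕ) + m < P.n * P.B :=
      calc P.B * (v : ℕ) + m < P.B * v + P.B := by have := m.2; omega
        _ = (v + 1) * P.B := by ring
        _ ≤ P.n * P.B := Nat.mul_le_mul_right _ v.2
    obtain ⟨w, hw, hu, hwn, hadj⟩ := h.choice_adj _ hlt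
    refine ⟨⟨w, hwn⟩, by rw [← hw]; push_cast; rfl, ?_⟩
    have hdiv : (P.B * (v : ℕ) + m) / P.B = v := by
      rw [Nat.mul_add_div hB, Nat.div_eq_of_lt m.2, add_zero]
    have hv : (⟨(P.B * (v : ℕ) + m) / P.B, hu⟩ : Fin P.n) = v := Fin.ext hdiv
    rwa [hv] at hadj
  choose τ hτ hadj using hτ
  have hδ : ∀ (m : Fin P.B) (v : Fin P.n), ∃ m' : Fin P.B,
      s.arrs 1 (P.n * (m : ℕ) + (v : ℕ)) = (m' : ℕ) := by
    intro m v
    obtain ⟨m', hm', he⟩ := h.update_range m m.2 v v.2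
    exact ⟨⟨m', hm'⟩, he⟩
  choose δ hδ using hδ
  refine ⟨⟨⟨0, hB⟩, δ⟩, τ, ⟨by simpa using h0, fun m v => ?_, fun v m => ?_⟩, hadj, ?_⟩
  · rw [mul_comm]; exact hδ m v
  · rw [mul_comm]; exact hτ v m
  -- From time `p + l` on, the evolution repeats itself; `f i` is the time that `i` repeats.
  set f : ℕ → ℕ := fun i => if i < p + l then i else p + (i - p) % l with hf
  have hflt : ∀ i, f i < p + l := by
    intro i
    have := Nat.mod_lt (i - p) hl
    simp only [hf]; split_ifs <;> omega
  have hfs : ∀ i, f (i + 1) = f i + 1 ∨ f i + 1 = p + l ∧ f (i + 1) = p := by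
    have hfmod : ∀ i, p ≤ i → f i = p + (i - p) % l := by
      intro i hi
      simp only [hf]
      split_ifs with hlt
      · rw [Nat.mod_eq_of_lt (by omega)]; omega
      · rfl
    intro i
    by_cases hi : i + 1 < p + l
    · left; simp only [hf]; rw [if_pos hi, if_pos (by omega)]
    · have hmod := Nat.mod_lt (i - p) hl
      have hdiv := Nat.div_add_mod (i - p) l
      rw [hfmod (i + 1) (by omega), hfmod i (by omega)]
      by_cases hc : (i - p) % l + 1 = l
      · right
        refine ⟨by omega, ?_⟩
        have : i + 1 - p = l * ((i - p) / l + 1) := by rw [mul_add]; omega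
        rw [this, Nat.mul_mod_right, add_zero]
      · left
        have : i + 1 - p = ((i - p) % l + 1) + l * ((i - p) / l) := by omega
        rw [this, Nat.add_mul_mod_self_left, Nat.mod_eq_of_lt (by omega)]
        omega
  have hfπ : ∀ i, π (f i) = π i := by
    have hper : ∀ k i, p ≤ i → π (i + l * k) = π i := by
      intro k
      induction k with
      | zero => simp
      | succ k ih =>
        intro i hi
        rw [mul_add, mul_one, ← add_assoc, hπ.period _ (hi.trans (by omega)), ih i hi]
    intro i
    simp only [hf]
    split_ifs with hi
    · rfl
    · have hdiv := Nat.div_add_mod (i - p) l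
      rw [← hper ((i - p) / l) _ (by omega)]
      congr 1; omega
  obtain ⟨m, hm⟩ : ∃ m : ℕ → Fin P.B, ∀ i, (m i : ℕ) = P.occ π (f i) (π (f i)) :=
    ⟨fun i => ⟨_, hπ.occ_lt (hflt i)⟩, fun i => rfl⟩
  refine outcome_strategy_eq (m := m) hπ.zero ?_ (fun i => ?_) fun i => ?_
  · have : f 0 = 0 := by simp only [hf]; rw [if_pos (by omega)]
    exact Fin.ext (by simp [hm, this, occ])
  · have h1 := hτ (π i) (m i)
    have h2 := h.choice (f i) (hflt i)
    rw [← hm, hfπ] at h2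
    have h3 : π (f i + 1) = π (i + 1) := by
      rcases hfs i with e | ⟨e1, e2⟩
      · rw [← e, hfπ]
      · rw [e1, hπ.period p le_rfl, ← hfπ (i + 1), e2]
    rw [h3] at h2
    exact Fin.ext (by exact_mod_cast h2.symm.trans h1)
  · have h1 := hδ (m i) (π i)
    refine Fin.ext ?_
    rw [hm (i + 1)]
    rcases hfs i with e | ⟨e1, e2⟩
    · have h2 := h.update (f i) (by rw [← e]; exact hflt _)
      rw [← e, ← hm i, hfπ i] at h2
      exact_mod_cast h2.symm.trans h1
    · have h2 := h.close
      rw [← e1, Nat.add_sub_cancel, ← hm i, hfπ i] at h2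
      rw [e2]
      exact_mod_cast h2.symm.trans h1

theorem exists_isLasso (hG : ∀ v, ∃ w, P.G.Adj v w) : ∃ π p l, P.IsLasso π p l := by
  choose τ hτ using hG
  obtain ⟨p, l, h⟩ := exists_isLasso_of_isBMemory (P := P) (σ := MemoryStructure.strategy
    (⟨(), fun _ _ => ()⟩ : MemoryStructure (Fin P.n) Unit) (fun v _ => τ v) P.v₀)
    ⟨Unit, inferInstance, _, _, by simpa using P.one_lt_B.le, fun v _ => hτ v, rfl⟩
  exact ⟨_, p, l, h⟩

theorem setup_inputState {lam gam : ℚ} (ha : gam.num = P.a) (hb : gam.den = P.b) :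
    P.Setup ((inputState P.G P.v₀ lam gam P.B).setVar 7
      ((horizon + .lit 1).eval (inputState P.G P.v₀ lam gam P.B))) where
  n := rfl
  B := rfl
  v₀ := rfl
  adj u w hu hw := by
    have huw : ∀ u' w' : Fin P.n, (P.n : ℤ) * u + w = ((u' : ℕ) : ℤ) * P.n + ((w' : ℕ) : ℤ) →
        u = u' ∧ w = w' := by
      intro u' w' e
      have e' : w + P.n * u = w' + P.n * u' := by
        have : ((w + P.n * u : ℕ) : ℤ) = (w' + P.n * u' : ℕ) := by push_cast; linarith
        exact_mod_cast this
      have hn : 0 < P.n := n_pos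
      have h1 := congrArg (· % P.n) e'
      have h2 := congrArg (· / P.n) e'
      simp only [Nat.add_mul_mod_self_left, Nat.mod_eq_of_lt hw, Nat.mod_eq_of_lt w'.2] at h1
      simp only [Nat.add_mul_div_left _ _ hn, Nat.div_eq_of_lt hw, Nat.div_eq_of_lt w'.2] at h2
      omega
    simp only [State.setVar_arrs, inputState, Adj]
    constructor
    · intro h
      by_contra hc
      refine h (if_neg ?_)
      rintro ⟨-, u', w', hadj, e⟩
      obtain ⟨h1, h2⟩ := huw u' w' e
      subst h1 h2
      exact hc ⟨u'.2, w'.2, hadj⟩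
    · rintro ⟨hu, hw, hadj⟩
      rw [if_pos ⟨rfl, ⟨u, hu⟩, ⟨w, hw⟩, hadj, by push_cast; ring⟩]
      exact one_ne_zero
  best := rfl
  bz := rfl
  update := by funext k; simp [inputState]
  val := by funext k; simp [inputState]
  par := by funext k; simp [inputState]
  a := by simpa [inputState] using ha
  b := by simpa [inputState] using hb
  D := by simp [horizon, inputState, D]

end Problem

theorem bitLength_natCast_le (k : ℕ) : bitLength k ≤ k := by
  rw [bitLength_le_iff, Int.natAbs_natCast]
  exact k.lt_two_pow_self

open Classical in
theorem inputState_bitsLE {n B M : ℕ} (G : Digraph (Fin n)) (v₀ : Fin n) (lam gam : ℚ)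
    (hn : n ≤ M) (hB : B ≤ M) (hlam : ratLength lam ≤ M) (hgam : ratLength gam ≤ M) :
    (inputState G v₀ lam gam B).BitsLE M := by
  unfold ratLength at hlam hgam
  have hv := v₀.2
  refine ⟨fun x => ?_, fun a k => (bitLength_ite_le _).trans (by omega)⟩
  have h0 : bitLength 0 ≤ M := by simp [bitLength]
  unfold inputState
  dsimp only
  split
  · exact (bitLength_natCast_le _).trans hn
  · exact (bitLength_natCast_le _).trans hB
  · exact (bitLength_natCast_le _).trans (by omega)
  · omega
  · omega
  · omega
  · omega
  · exact h0

/-- The growth of a bound on the number of bits through four phases of at most `T` steps. -/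
theorem four_phases_le {T M M₁ M₂ M₃ M₄ b₁ b₂ b₃ b₄ : ℕ} (h₁ : M₁ = (T + 1) * (M + 1))
    (h₂ : M₂ = (T + 1) * (M₁ + 1)) (h₃ : M₃ = (T + 1) * (M₂ + 1)) (h₄ : M₄ = (T + 1) * (M₃ + 1))
    (c₁ : b₁ ≤ (T + 1) * M₁) (c₂ : b₂ ≤ (T + 1) * M₂) (c₃ : b₃ ≤ (T + 1) * M₃)
    (c₄ : b₄ ≤ (T + 1) * M₄) : b₁ + (b₂ + (b₃ + b₄)) ≤ 4 * (T + 2) ^ 5 * (M + 1) := by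
  have g : ∀ {m k : ℕ}, k = (T + 1) * (m + 1) → m ≤ k ∧ k + 1 ≤ (T + 2) * (m + 1) := by
    rintro m k rfl
    constructor <;> nlinarith
  have g₄ : M₄ ≤ (T + 2) ^ 4 * (M + 1) :=
    calc M₄ ≤ (T + 2) * (M₃ + 1) := (Nat.le_succ _).trans (g h₄).2
      _ ≤ (T + 2) * ((T + 2) * ((T + 2) * ((T + 2) * (M + 1)))) :=
        Nat.mul_le_mul_left _ ((g h₃).2.trans (Nat.mul_le_mul_left _
          ((g h₂).2.trans (Nat.mul_le_mul_left _ (g h₁).2))))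
      _ = (T + 2) ^ 4 * (M + 1) := by ring
  have l₃ := (g h₄).1
  have l₂ := (g h₃).1.trans l₃
  have l₁ := (g h₂).1.trans l₂
  calc b₁ + (b₂ + (b₃ + b₄)) ≤ (T + 1) * M₄ + ((T + 1) * M₄ + ((T + 1) * M₄ + (T + 1) * M₄)) :=
        add_le_add (c₁.trans (Nat.mul_le_mul_left _ l₁)) (add_le_add
          (c₂.trans (Nat.mul_le_mul_left _ l₂))
            (add_le_add (c₃.trans (Nat.mul_le_mul_left _ l₃)) c₄))
    _ = 4 * ((T + 1) * M₄) := by ring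
    _ ≤ 4 * ((T + 2) * ((T + 2) ^ 4 * (M + 1))) :=
      Nat.mul_le_mul_left _ (Nat.mul_le_mul (by omega) g₄)
    _ = 4 * (T + 2) ^ 5 * (M + 1) := by ring

open Code in
/-- The program halts with the tables of a strategy that follows a lasso of largest weight. The
bound on the logarithmic cost treats the four phases of the program separately, because no variable
is constant and small in all of them. -/
theorem Problem.exec_program {P : Problem} {lam gam : ℚ} {M T : ℕ} (ha : gam.num = P.a)
    (hb : gam.den = P.b) (hG : ∀ v, ∃ w, P.G.Adj v w) (hM : 3 ≤ M)
    (hbits : (inputState P.G P.v₀ lam gam P.B).BitsLE M)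
    (hT : program.coeff * (P.size + 2) ^ program.depth = T) :
    ∃ s t b, Exec program (inputState P.G P.v₀ lam gam P.B) s t b ∧ t ≤ T ∧
      b ≤ 4 * (T + 2) ^ 5 * (M + 1) ∧ s.vars 0 = 0 ∧
      ∃ (π : ℕ → Fin P.n) (p l : ℕ) (L₀ : ℕ → ℕ), P.IsLasso π p l ∧
        (∀ u < P.n, lastVisit π p L₀ (p + l) u = L₀ u) ∧ P.Tables π p l s ∧
        ∀ π' p' l', P.IsLasso π' p' l' → ∃ L₀' : ℕ → ℕ,
          (∀ u < P.n, lastVisit π' p' L₀' (p' + l') u = L₀' u) ∧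
          ∑ i ∈ Finset.range (p' + l'), P.lassoWeight π' p' l' L₀' i ≤
            ∑ i ∈ Finset.range (p + l), P.lassoWeight π p l L₀ i := by
  set s₀ := inputState P.G P.v₀ lam gam P.B with hs₀
  have hsetup : P.Setup (s₀.setVar 7 ((horizon + .lit 1).eval s₀)) := setup_inputState ha hb
  have ex₁ := Exec.assign 7 (horizon + .lit 1) s₀
  set s₁ := s₀.setVar 7 ((horizon + .lit 1).eval s₀) with hs₁
  obtain ⟨s₂, t₂, b₂, ex₂, ht₂, henv, hfresh⟩ := triple_computeTables s₁ hsetup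
  obtain ⟨s₃, t₃, b₃, ex₃, ht₃, π, p, l, L₀, hπ, hfix, htab, hmax⟩ :=
    triple_search hG (exists_isLasso hG) s₂ ⟨henv, hfresh⟩
  have ex₄ := Exec.assign 0 (.lit 0) s₃
  have hsum : ((horizon + .lit 1).steps + 1) + (t₂ + (t₃ + ((Exp.lit 0).steps + 1))) ≤ T := by
    have h1 : 1 ≤ (P.size + 2) ^ program.depth := Nat.one_le_pow _ _ (by omega)
    have h2 := mul_pow_le_of_le ht₂ (show computeTables.depth ≤ program.depth by decide)
    have h3 := mul_pow_le_of_le ht₃ (show search.depth ≤ program.depth by decide)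
    have h4 : program.coeff = ((horizon + .lit 1).steps + 1) +
      (computeTables.coeff + (search.coeff + ((Exp.lit 0).steps + 1))) := rfl
    rw [← hT, h4]
    generalize (P.size + 2) ^ program.depth = X at *
    nlinarith
  have hD : P.D ≠ 0 := by unfold D; positivity
  obtain ⟨m₁, c₁⟩ := ex₁.bits_le (K := [0, 1]) (A := []) (Z := []) (T := T) hM (by simp) (by simp)
    hbits (by decide) (by omega)
  obtain ⟨M₁, hM₁⟩ : ∃ k, k = (T + 1) * (M + 1) := ⟨_, rfl⟩
  rw [← hM₁] at m₁ c₁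
  have hle₁ : M ≤ M₁ := by rw [hM₁]; nlinarith
  obtain ⟨m₂, c₂⟩ := ex₂.bits_le (T := T) (by omega) (by simp) (by simp [hsetup.D, hD]) m₁
    computeTables_tame (by omega)
  obtain ⟨M₂, hM₂⟩ : ∃ k, k = (T + 1) * (M₁ + 1) := ⟨_, rfl⟩
  rw [← hM₂] at m₂ c₂
  have hle₂ : M₁ ≤ M₂ := by rw [hM₂]; nlinarith
  obtain ⟨m₃, c₃⟩ := ex₃.bits_le (T := T) (by omega) (by simp) (by simp [henv.D, hD]) m₂
    search_tame (by omega)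
  obtain ⟨M₃, hM₃⟩ : ∃ k, k = (T + 1) * (M₂ + 1) := ⟨_, rfl⟩
  rw [← hM₃] at m₃ c₃
  have hle₃ : M₂ ≤ M₃ := by rw [hM₃]; nlinarith
  obtain ⟨m₄, c₄⟩ := ex₄.bits_le (K := []) (A := []) (Z := []) (T := T) (by omega) (by simp)
    (by simp) m₃ (by decide) (by omega)
  obtain ⟨M₄, hM₄⟩ : ∃ k, k = (T + 1) * (M₃ + 1) := ⟨_, rfl⟩
  rw [← hM₄] at m₄ c₄
  refine ⟨_, _, _, ex₁.seq (ex₂.seq (ex₃.seq ex₄)), hsum, ?_, ?_, π, p, l, L₀, hπ, hfix,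
    ⟨htab.choice_adj, htab.update_range, htab.choice, htab.update, htab.close⟩, hmax⟩
  · exact four_phases_le hM₁ hM₂ hM₃ hM₄ c₁ c₂ c₃ c₄
  · simp

/-! ### Optimality, and comparison with strategies of unbounded memory -/

section Value

variable {n B : ℕ} {G : Digraph (Fin n)} {v₀ : Fin n} {Ω : Type} [MeasurableSpace Ω]
  {μ : Measure Ω} {ξ : ℕ → Fin n → Ω → ℝ} {γ lam : ℝ}

/-- A lasso of largest weight has the largest average reward among all lassos. -/
theorem Problem.avgReward_le_of_isLasso {P : Problem} {ξ : ℕ → Fin P.n → Ω → ℝ}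
    {π π' : ℕ → Fin P.n} {p l p' l' : ℕ} {L₀ L₀' : ℕ → ℕ}
    (hπ : P.IsLasso π p l) (hfix : ∀ u < P.n, lastVisit π p L₀ (p + l) u = L₀ u)
    (hπ' : P.IsLasso π' p' l') (hfix' : ∀ u < P.n, lastVisit π' p' L₀' (p' + l') u = L₀' u)
    (hle : ∑ i ∈ Finset.range (p' + l'), P.lassoWeight π' p' l' L₀' i ≤
      ∑ i ∈ Finset.range (p + l), P.lassoWeight π p l L₀ i)
    (hγ : γ = (P.a : ℝ) / P.b) (h1 : γ < 1) (hlam : 0 ≤ lam) (hξ : HasMeanReward μ ξ lam) :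
    avgReward μ γ ξ π' ≤ avgReward μ γ ξ π := by
  rw [avgReward_eq_of_tendsto hξ h1 (hγ ▸ hπ'.tendsto_gain hfix'),
    avgReward_eq_of_tendsto hξ h1 (hγ ▸ hπ.tendsto_gain hfix)]
  refine mul_le_mul_of_nonneg_left ?_ (div_nonneg hlam (by linarith))
  exact div_le_div_of_nonneg_right (by exact_mod_cast hle) P.scale_pos.le

theorem isInfinitePath_outcome {σ : List (Fin n) → Fin n} (hσ : IsBMemory G v₀ B σ) :
    IsInfinitePath G (outcome v₀ σ) := by
  obtain ⟨M, _, 𝓜, τ, -, hadj, rfl⟩ := hσ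
  obtain ⟨x, hx, -, hxs⟩ := exists_evolution 𝓜 τ v₀
  intro i
  rw [← hx]
  simp only [hxs]
  exact hadj _ _

theorem avgReward_le_avgValue (h0 : 0 ≤ γ) (h1 : γ < 1) (hlam : 0 ≤ lam)
    (hξ : HasMeanReward μ ξ lam) {π : ℕ → Fin n} (hπ : IsInfinitePath G π) (hv : π 0 = v₀) :
    avgReward μ γ ξ π ≤ avgValue μ γ ξ G v₀ := by
  refine le_csSup ⟨lam / (1 - γ), ?_⟩ ⟨π, hπ, hv, rfl⟩
  rintro _ ⟨π', -, -, rfl⟩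
  exact avgReward_le hξ hlam h0 h1 π'

theorem pow_floor_log_div_log_le (hn : 2 ≤ n) (hB : 1 < B) :
    n ^ ⌊Real.log (B : ℝ) / Real.log (n : ℝ)⌋.toNat ≤ B := by
  have hn' : (1 : ℝ) < n := by exact_mod_cast (by omega : 1 < n)
  have hB' : (1 : ℝ) < B := by exact_mod_cast hB
  have hlog := Real.log_pos hn'
  have hq : 0 ≤ Real.log (B : ℝ) / Real.log (n : ℝ) := div_nonneg (Real.log_pos hB').le hlog.le
  set K := ⌊Real.log (B : ℝ) / Real.log (n : ℝ)⌋ with hK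
  have hK0 : 0 ≤ K := Int.floor_nonneg.2 hq
  have hcast : ((K.toNat : ℕ) : ℝ) = (K : ℝ) := by
    exact_mod_cast congrArg (Int.cast : ℤ → ℝ) (Int.toNat_of_nonneg hK0)
  have h : (K.toNat : ℝ) * Real.log n ≤ Real.log B := by
    rw [hcast, ← le_div_iff₀ hlog]
    exact Int.floor_le _
  rw [← Real.log_pow] at h
  have := (Real.log_le_log_iff (by positivity) (by positivity)).1 h
  exact_mod_cast this

/-- An optimal strategy with memory `B` is at least as good as the strategy that remembers the last
`⌊log B / log n⌋` nodes. -/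
theorem abs_avgValue_sub_le {σ : List (Fin n) → Fin n} (hG : ∀ v, ∃ w, G.Adj v w) (hn : 2 ≤ n)
    (hB : 1 < B) (h0 : 0 < γ) (h1 : γ < 1) (hlam : 0 ≤ lam) (hξ : HasMeanReward μ ξ lam)
    (hσ : IsBMemoryOptimal G v₀ B (avgReward μ γ ξ) σ) :
    |avgValue μ γ ξ G v₀ - avgReward μ γ ξ (outcome v₀ σ)| ≤
      lam / (1 - γ) * γ ^ (⌊Real.log (B : ℝ) / Real.log (n : ℝ)⌋ - 1 : ℤ) := by
  have hpath := isInfinitePath_outcome hσ.1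
  have hge := avgReward_le_avgValue (v₀ := v₀) h0.le h1 hlam hξ hpath rfl
  obtain ⟨σ', hσ', hle⟩ := exists_isBMemory_avgReward_ge (v₀ := v₀) hG
    (pow_floor_log_div_log_le hn hB) h0.le h1 hlam hξ
  rw [abs_of_nonneg (sub_nonneg.2 hge), sub_le_iff_le_add']
  refine csSup_le ⟨_, _, hpath, rfl, rfl⟩ ?_
  rintro _ ⟨π, hπ, hv, rfl⟩
  refine (hle π hπ hv).trans (add_le_add (hσ.2 σ' hσ') ?_)
  refine mul_le_mul_of_nonneg_left ?_ (div_nonneg hlam (by linarith))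
  rw [← zpow_natCast]
  refine zpow_le_zpow_right_of_le_one₀ h0 h1.le ?_
  have := Int.self_le_toNat ⌊Real.log (B : ℝ) / Real.log (n : ℝ)⌋
  push_cast
  omega

theorem avgReward_eq_avgValue_of_subsingleton [Subsingleton (Fin n)] {π : ℕ → Fin n}
    (hπ : IsInfinitePath G π) : avgReward μ γ ξ π = avgValue μ γ ξ G v₀ := by
  have : {r | ∃ π : ℕ → Fin n, IsInfinitePath G π ∧ π 0 = v₀ ∧ avgReward μ γ ξ π = r} =
      {avgReward μ γ ξ π} := by
    ext r
    constructor
    · rintro ⟨π', -, -, rfl⟩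
      rw [Subsingleton.elim π' π]; rfl
    · rintro rfl
      exact ⟨π, hπ, Subsingleton.elim _ _, rfl⟩
  rw [avgValue, this, csSup_singleton]

end Value

/-! ### The polynomial bounds -/

theorem Problem.size_le (P : Problem) : P.size ≤ (P.n ^ (P.n + 1) * P.B ^ P.n) ^ 14 := by
  have hn : 0 < P.n := n_pos
  have hB := P.one_lt_B
  have h2 : 2 ≤ P.n * P.B := by nlinarith
  have hX : (P.n * P.B) ^ P.n ≤ P.n ^ (P.n + 1) * P.B ^ P.n := by
    rw [mul_pow]
    exact Nat.mul_le_mul_right _ (Nat.pow_le_pow_right hn (by omega))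
  calc (P.n * P.B + 1) ^ (3 * P.n + 4) ≤ ((P.n * P.B) ^ 2) ^ (7 * P.n) :=
        (Nat.pow_le_pow_left (by nlinarith) _).trans
          (Nat.pow_le_pow_right (by positivity) (by omega))
    _ = ((P.n * P.B) ^ P.n) ^ 14 := by rw [← pow_mul, ← pow_mul]; congr 1; ring
    _ ≤ _ := Nat.pow_le_pow_left hX _

end RobotRouting

open RobotRouting

theorem mainTheorem5 :
    ∃ (prog : RobotRouting.Cmd) (p q : Polynomial ℕ),
      ∀ (n B : ℕ) (G : Digraph (Fin n)) (v₀ : Fin n) (lam gam : ℚ),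
        1 < B → 0 ≤ lam → 0 < gam → gam < 1 → (∀ v, ∃ w, G.Adj v w) →
        ∃ (s : RobotRouting.State) (t b : ℕ)
          (𝓜 : RobotRouting.MemoryStructure (Fin n) (Fin B)) (τ : Fin n → Fin B → Fin n),
          RobotRouting.Exec prog (RobotRouting.inputState G v₀ lam gam B) s t b ∧
          t ≤ p.eval (n ^ (n + 1) * B ^ n) ∧
          b ≤ q.eval (n ^ (n + 1) * B ^ n +
            RobotRouting.ratLength lam + RobotRouting.ratLength gam) ∧
          s.Outputs 𝓜 τ ∧
          (∀ v m, G.Adj v (τ v m)) ∧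
          ∀ (Ω : Type) [MeasurableSpace Ω] (μ : MeasureTheory.Measure Ω)
            [MeasureTheory.IsProbabilityMeasure μ] (ξ : ℕ → Fin n → Ω → ℝ),
            RobotRouting.HasMeanReward μ ξ (lam : ℝ) →
            RobotRouting.IsBMemoryOptimal G v₀ B
              (RobotRouting.avgReward μ (gam : ℝ) ξ) (𝓜.strategy τ v₀) ∧
            (2 ≤ n →
              |RobotRouting.avgValue μ (gam : ℝ) ξ G v₀ -
                RobotRouting.avgReward μ (gam : ℝ) ξ
                  (RobotRouting.outcome v₀ (𝓜.strategy τ v₀))| ≤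
              (lam : ℝ) / (1 - (gam : ℝ)) *
                (gam : ℝ) ^ (⌊Real.log (B : ℝ) / Real.log (n : ℝ)⌋ - 1 : ℤ)) ∧
            (n = 1 →
              RobotRouting.avgReward μ (gam : ℝ) ξ
                (RobotRouting.outcome v₀ (𝓜.strategy τ v₀)) =
              RobotRouting.avgValue μ (gam : ℝ) ξ G v₀) := by
  set T : Polynomial ℕ := Polynomial.C Code.program.coeff *
    (Polynomial.X ^ 14 + Polynomial.C 2) ^ Code.program.depth with hT
  have hTeval : ∀ x, T.eval x = Code.program.coeff * (x ^ 14 + 2) ^ Code.program.depth := by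
    intro x
    simp only [hT, Polynomial.eval_mul, Polynomial.eval_pow, Polynomial.eval_add,
      Polynomial.eval_C, Polynomial.eval_X]
  refine ⟨Code.program, T, Polynomial.C 4 * (T + Polynomial.C 2) ^ 5 *
    (Polynomial.X + Polynomial.C 4), ?_⟩
  intro n B G v₀ lam gam hB hlam hgam0 hgam1 hG
  have hnum : 0 < gam.num := Rat.num_pos.2 hgam0
  have hnumden : gam.num < gam.den := Rat.num_lt_denom_iff.2 hgam1
  let P : Problem :=
    { n := n, B := B, G := G, v₀ := v₀, a := gam.num.toNat, b := gam.den, one_lt_B := hB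
      a_pos := by omega
      a_lt_b := by omega }
  set x := n ^ (n + 1) * B ^ n with hx
  have hn : 0 < n := v₀.pos
  have hnx : n ≤ x := (Nat.le_self_pow (by omega) n).trans
    (Nat.le_mul_of_pos_right _ (by positivity))
  have hBx : B ≤ x := (Nat.le_self_pow hn.ne' B).trans (Nat.le_mul_of_pos_left _ (by positivity))
  have hsize : P.size ≤ x ^ 14 := P.size_le
  obtain ⟨s, t, b, ex, ht, hb, hs0, π, p, l, L₀, hπ, hfix, htab, hmax⟩ :=
    P.exec_program (lam := lam) (gam := gam) (M := x + ratLength lam + ratLength gam + 3)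
      (T := _) (Int.toNat_of_nonneg hnum.le).symm rfl hG (by omega)
      (inputState_bitsLE _ _ _ _ (hnx.trans (by omega)) (hBx.trans (by omega)) (by omega)
        (by omega)) rfl
  obtain ⟨𝓜, τ, hout, hadj, hπσ⟩ := htab.exists_strategy hπ hs0
  refine ⟨s, t, b, 𝓜, τ, ex, ht.trans ?_, hb.trans ?_, hout, hadj, ?_⟩
  · rw [hTeval]
    gcongr
  · simp only [Polynomial.eval_mul, Polynomial.eval_pow, Polynomial.eval_add, Polynomial.eval_C,
      Polynomial.eval_X, hTeval, add_assoc]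
    gcongr
    exact hsize.trans (Nat.pow_le_pow_left (by omega) _)
  intro Ω _ μ _ ξ hξ
  have h0 : (0 : ℝ) < gam := by exact_mod_cast hgam0
  have h1 : (gam : ℝ) < 1 := by exact_mod_cast hgam1
  have hlam' : (0 : ℝ) ≤ lam := by exact_mod_cast hlam
  have hγ : (gam : ℝ) = (P.a : ℝ) / P.b := by
    have : ((P.a : ℕ) : ℝ) = (gam.num : ℝ) := by
      exact_mod_cast congrArg (Int.cast : ℤ → ℝ) (Int.toNat_of_nonneg hnum.le)
    rw [this]
    exact Rat.cast_def gam
  have hmem : IsBMemory G v₀ B (𝓜.strategy τ v₀) :=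
    ⟨Fin B, inferInstance, 𝓜, τ, by simp, hadj, rfl⟩
  have hopt : IsBMemoryOptimal G v₀ B (avgReward μ (gam : ℝ) ξ) (𝓜.strategy τ v₀) := by
    refine ⟨hmem, fun σ' hσ' => ?_⟩
    obtain ⟨p', l', hπ'⟩ := Problem.exists_isLasso_of_isBMemory (P := P) hσ'
    obtain ⟨L₀', hfix', hle⟩ := hmax _ _ _ hπ'
    have := Problem.avgReward_le_of_isLasso hπ hfix hπ' hfix' hle hγ h1 hlam' hξ
    rw [← hπσ] at this
    exact this
  refine ⟨hopt, fun hn => abs_avgValue_sub_le hG hn hB h0 h1 hlam' hξ hopt, ?_⟩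
  rintro rfl
  exact avgReward_eq_avgValue_of_subsingleton (isInfinitePath_outcome hmem)
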